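/- **Setting.** Consider spin-1 chains: to a finite interval $\Lambda\subset\mathbb Z$ belongs the Hilbert space $\mathcal H_\Lambda=\bigotimes_{x\in\Lambda}\mathbb C^3$, where $\mathbb C^3$ has the orthonormal basis $|+\rangle,|0\rangle,|-\rangle$ of eigenvectors of $S^z$. The AKLT interaction $h(x,x+1)=P_2(\boldsymbol S_x+\boldsymbol S_{x+1})$ is the orthogonal projection onto the states in which the sites $x,x+1$ have total spin $2$. For $a\le b$ let $H(a,b)=\sum_{a\le x<b}h(x,x+1)$, let $\mathcal G(a,b)=\operatorname{Ker}H(a,b)$, and let $G(a,b)$ be the orthogonal projection onto $\mathcal G(a,b)$. For $N\ge2$ the spectral gap $\gamma(N)$ is the largest real $\gamma$ with $H(1,N)\ge\gamma\,(1-G(1,N))$, and $\gamma_N=\min_{2\le n\le N}\gamma(n)$. For $m,n\ge1$ put $$\varepsilon(m,n)=\sup\{\langle\psi,G(0,n)\psi\rangle:\psi\in\mathcal G(-m,0)\cap\mathcal G(-m,n)^\perp,\ \|\psi\|=1\},\qquad \varepsilon_{m,n}=\sup_{m'\ge m}\varepsilon(m',n).$$ Let $U=\prod_{j<k}\exp(i\pi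 S^z_jS^x_k)$ be the Kennedy–Tasaki transformation of a chain, let $\phi_{1,2}=(|0\rangle\pm\sqrt2\,|+\rangle)/\sqrt3$ and $\phi_{3,4}=(|0\rangle\pm\sqrt2\,|-\rangle)/\sqrt3$, and let $\Phi_i(a,b)=\bigotimes_{x=a}^b(\phi_i)_x$. Let $M(a,b)=[\langle\Phi_i(a,b),\Phi_j(a,b)\rangle]_{i,j=1}^4$, let $W(a,b)=M(a,b)^{-1}$ (for $b>a$), let $\Theta_{ij}=\Phi_i(-m,0)\otimes\Phi_j(1,n)$, and let $\mathcal A=\mathcal A_{m,n}$ be the $16\times16$ matrix with entries $$\mathcal A(ij,rk)=\sum_{l,s}W(0,n)_{kl}M(0,0)_{li}M(1,n)_{lj}W(-m,0)_{rs}M(0,0)_{sk}M(-m,-1)_{si}.$$ Finally put $D=(1-(-\frac13)^{m+1})(1-(-\frac13)^{n+1})$ and $$\lambda_5=\frac{(1-(-\frac13)^m)(1-(-\frac13)^n)}{9D},\qquad \lambda_1=\frac{(1-(-\frac13)^{m-1})(1-(-\frac13)^{n-1})}{9D},$$ $$\lambda_{3\pm}=\frac{1+(-\frac13)^m+(-\frac13)^n-19(-\frac13)^{m+n+2}\pm2\sqrt{R}}{9D},$$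 $$R=[(-\tfrac13)^m-(-\tfrac13)^n]^2-128(-\tfrac13)^{2m+2n+4}+4(-\tfrac13)^{m+n+2}(1+(-\tfrac13)^m)(1+(-\tfrac13)^n).$$ **Theorem.** 1. For every $N\ge2$ the operator $U$ on $N$ sites is unitary, the product states $\Phi_1(1,N),\dots,\Phi_4(1,N)$ are linearly independent, and $U\,\mathcal G(1,N)$ is their span. 2. Let $m,n\ge1$, and let $\widetilde K=U\,G(-m,0)\,G(0,n)\,G(-m,0)\,U^*$ on the interval $[-m,n]$. Then $\widetilde K\Theta_{ij}=\sum_{r,k}\mathcal A(ij,rk)\,\Theta_{rk}$ for all $i,j$, the range of $\widetilde K$ is contained in the span of the $\Theta_{ij}$, and the $\Theta_{ij}$ are linearly independent if $n\ge2$. Moreover $R\ge0$, and the eigenvalues of $\mathcal A$ with their algebraic multiplicities are $1$ (four times), $\lambda_5$ (five times), $\lambda_1$ (once), $\lambda_{3+}$ and $\lambda_{3-}$ (three times each), i.e. its characteristic polynomial is $(X-1)^4(X-\lambda_5)^5(X-\lambda_1)(X-\lambda_{3+})^3(X-\lambda_{3-})^3$. All of $\lambda_5,\lambda_1,\lambda_{3\pm}$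 are less than $1$, and $\varepsilon(m,n)=\max(\lambda_5,\lambda_1,\lambda_{3+})$ is the fifth largest eigenvalue of $\mathcal A$. 3. $\varepsilon_{1,1}=\varepsilon(1,1)=\lambda_5(1,1)=\frac14$, $\gamma(2)=1$, and $$\inf_{N\ge2}\gamma(N)\ \ge\ 1-\frac{\sqrt3}{2}.$$ 4. $\varepsilon_{3,3}=\varepsilon(3,3)=\lambda_5(3,3)=(7/20)^2$, and $$\inf_{N\ge2}\gamma(N)\ \ge\ \gamma_6\,\bigl(1-2\sqrt{\varepsilon_{3,3}(1-\varepsilon_{3,3})}\bigr),\qquad \inf_{N\ge2}\gamma(N)\ \ge\ 0.137194.$$ -/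

import Mathlib

noncomputable section

namespace AKLT

open Complex

/-- The Hilbert space `⨂_{x < L} ℂ³` of a spin-1 chain with sites `0, …, L - 1`, written in the
product basis of configurations. At each site the index `0, 1, 2` stands for `|+⟩, |0⟩, |-⟩`. -/
abbrev Chain (L : ℕ) : Type := EuclideanSpace ℂ (Fin L → Fin 3)

/-- Operators on the chain Hilbert space. -/
abbrev Op (L : ℕ) : Type := Chain L →L[ℂ] Chain L

/-- The spin-1 matrices. -/
def spinX : Matrix (Fin 3) (Fin 3) ℂ :=
  ((Real.sqrt 2 : ℝ) : ℂ)⁻¹ • !![0, 1, 0; 1, 0, 1; 0, 1, 0]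

def spinY : Matrix (Fin 3) (Fin 3) ℂ :=
  ((Real.sqrt 2 : ℝ) : ℂ)⁻¹ • !![0, -I, 0; I, 0, -I; 0, I, 0]

def spinZ : Matrix (Fin 3) (Fin 3) ℂ :=
  !![1, 0, 0; 0, 0, 0; 0, 0, -1]

/-- The one-site matrix `A` acting at the site `x`, tensored with the identity elsewhere. -/
def siteOp {L : ℕ} (x : Fin L) (A : Matrix (Fin 3) (Fin 3) ℂ) : Op L :=
  LinearMap.toContinuousLinearMap
    { toFun := fun ψ => WithLp.toLp 2 fun σ =>
        ∑ s : Fin 3, A (σ x) s * ψ (Function.update σ x s)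
      map_add' := by
        intro ψ χ
        ext σ
        simp [mul_add, Finset.sum_add_distrib]
      map_smul' := by
        intro c ψ
        ext σ
        simp only [PiLp.smul_apply, smul_eq_mul, RingHom.id_apply, Finset.mul_sum]
        exact Finset.sum_congr rfl fun s _ => by ring }

/-- `(S_x + S_y)²`, the square of the total spin of the sites `x` and `y`. -/
def totalSpinSq {L : ℕ} (x y : Fin L) : Op L :=
  (siteOp x spinX + siteOp y spinX) ^ 2 + (siteOp x spinY + siteOp y spinY) ^ 2
    + (siteOp x spinZ + siteOp y spinZ) ^ 2

/-- The AKLT interaction `P₂(S_x + S_y)`: the orthogonal projection onto the states in which the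
sites `x` and `y` have total spin 2, i.e. onto the eigenspace of `(S_x + S_y)²` for `2(2+1)`. -/
def bond {L : ℕ} (x y : Fin L) : Op L :=
  (Module.End.eigenspace ((totalSpinSq x y : Op L) : Chain L →ₗ[ℂ] Chain L) 6).starProjection

/-- The Hamiltonian `H(a, b) = ∑_{a ≤ x, x + 1 ≤ b} h(x, x + 1)` of the sub-interval `[a, b]`,
as an operator on the chain with sites `0, …, L - 1`. -/
def ham (L a b : ℕ) : Op L :=
  ∑ p : Fin L × Fin L with
    (a ≤ (p.1 : ℕ) ∧ (p.2 : ℕ) = (p.1 : ℕ) + 1 ∧ (p.2 : ℕ) ≤ b), bond p.1 p.2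

/-- The ground state space `𝒢(a, b) = Ker H(a, b)`. -/
def groundSpace (L a b : ℕ) : Submodule ℂ (Chain L) :=
  LinearMap.ker (ham L a b : Chain L →ₗ[ℂ] Chain L)

/-- The orthogonal projection `G(a, b)` onto `𝒢(a, b)`. -/
def groundProj (L a b : ℕ) : Op L := (groundSpace L a b).starProjection

/-- The spectral gap `γ(N)` of the chain of `N ≥ 2` sites: the largest real `g` with
`H ≥ g (1 - G)`. -/
def gap (N : ℕ) : ℝ :=
  sSup {g : ℝ | (g : ℂ) • (1 - groundProj N 0 (N - 1)) ≤ ham N 0 (N - 1)}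

/-- `γ_N = min_{2 ≤ n ≤ N} γ(n)`. -/
def minGap (N : ℕ) : ℝ := ⨅ n : Set.Icc (2 : ℕ) N, gap n

/-- `inf_{N ≥ 2} γ(N)`. -/
def infGap : ℝ := ⨅ N : Set.Ici (2 : ℕ), gap N

/-- `ε(m, n)`: the supremum of `⟨ψ, G(0, n) ψ⟩` over unit vectors `ψ ∈ 𝒢(-m, 0) ∩ 𝒢(-m, n)ᗮ`.
The interval `[-m, n]` is shifted to `[0, m + n]`, so that the common site `0` becomes `m`. -/
def eps (m n : ℕ) : ℝ :=
  sSup {r : ℝ | ∃ ψ : Chain (m + n + 1), ψ ∈ groundSpace (m + n + 1) 0 m ∧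
    ψ ∈ (groundSpace (m + n + 1) 0 (m + n))ᗮ ∧ ‖ψ‖ = 1 ∧
    r = (inner ℂ ψ (groundProj (m + n + 1) m (m + n) ψ)).re}

/-- `ε_{m,n} = sup_{m' ≥ m} ε(m', n)`. -/
def epsSup (m n : ℕ) : ℝ := ⨆ k : Set.Ici m, eps k n

/-- `K(-m, n) = G(-m, 0) G(0, n) G(-m, 0)`, on the shifted interval `[0, m + n]`. -/
def K (m n : ℕ) : Op (m + n + 1) :=
  groundProj (m + n + 1) 0 m * groundProj (m + n + 1) m (m + n) * groundProj (m + n + 1) 0 m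

/-- The Kennedy–Tasaki transformation `U = ∏_{j < k} exp(iπ S_j^z S_k^x)`. (The factors commute;
they are multiplied in lexicographic order.) -/
def kennedyTasaki (L : ℕ) : Op L :=
  (((List.finRange L ×ˢ List.finRange L).filter fun p => p.1 < p.2).map fun p =>
    NormedSpace.exp (((Real.pi : ℂ) * I) • (siteOp p.1 spinZ * siteOp p.2 spinX))).prod

/-- The one-site vectors `φ_{1,2} = (|0⟩ ± √2 |+⟩)/√3` and `φ_{3,4} = (|0⟩ ± √2 |-⟩)/√3`. -/
def phi (i : Fin 4) (s : Fin 3) : ℂ :=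
  (![![(Real.sqrt 2 : ℂ), 1, 0], ![-(Real.sqrt 2 : ℂ), 1, 0],
     ![0, 1, (Real.sqrt 2 : ℂ)], ![0, 1, -(Real.sqrt 2 : ℂ)]] i s) / (Real.sqrt 3 : ℂ)

/-- The product state `Φ_i = φ_i ⊗ ⋯ ⊗ φ_i` on `N` sites. -/
def Phi (N : ℕ) (i : Fin 4) : Chain N :=
  WithLp.toLp 2 fun σ => ∏ x : Fin N, phi i (σ x)

/-- `Θ_{ij}(-m, n) = Φ_i(-m, 0) ⊗ Φ_j(1, n)`, on the shifted interval `[0, m + n]`. -/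
def Theta (m n : ℕ) (ij : Fin 4 × Fin 4) : Chain (m + n + 1) :=
  WithLp.toLp 2 fun σ => ∏ x : Fin (m + n + 1), if (x : ℕ) ≤ m then phi ij.1 (σ x) else phi ij.2 (σ x)

/-- The Gram matrix of the four product states on `N` sites. -/
def M (N : ℕ) : Matrix (Fin 4) (Fin 4) ℂ :=
  Matrix.of fun i j => inner ℂ (Phi N i) (Phi N j)

/-- The inverse Gram matrix. -/
def W (N : ℕ) : Matrix (Fin 4) (Fin 4) ℂ := (M N)⁻¹

/-- The `16 × 16` matrix with entries
`𝒜(ij, rk) = ∑_{l,s} W(0,n)_{kl} M(0,0)_{li} M(1,n)_{lj} W(-m,0)_{rs} M(0,0)_{sk} M(-m,-1)_{si}`;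
`M` and `W` depend only on the number of sites of the interval. -/
def A (m n : ℕ) : Matrix (Fin 4 × Fin 4) (Fin 4 × Fin 4) ℂ :=
  Matrix.of fun ij rk => ∑ l, ∑ s,
    W (n + 1) rk.2 l * M 1 l ij.1 * M n l ij.2 * W (m + 1) rk.1 s * M 1 s rk.2 * M m s ij.1

/-- The common denominator `(1 - (-1/3)^{m+1}) (1 - (-1/3)^{n+1})`. -/
def lamDen (m n : ℕ) : ℝ := (1 - (-1 / 3) ^ (m + 1)) * (1 - (-1 / 3) ^ (n + 1))

def lam5 (m n : ℕ) : ℝ :=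
  1 / 9 * ((1 - (-1 / 3) ^ m) * (1 - (-1 / 3) ^ n) / lamDen m n)

/-- Used for `m, n ≥ 1` only. -/
def lam1 (m n : ℕ) : ℝ :=
  1 / 9 * ((1 - (-1 / 3) ^ (m - 1)) * (1 - (-1 / 3) ^ (n - 1)) / lamDen m n)

def lamR (m n : ℕ) : ℝ :=
  ((-1 / 3) ^ m - (-1 / 3) ^ n) ^ 2 - 128 * (-1 / 3) ^ (2 * m + 2 * n + 4)
    + 4 * (-1 / 3) ^ (m + n + 2) * (1 + (-1 / 3) ^ m) * (1 + (-1 / 3) ^ n)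

def lam3plus (m n : ℕ) : ℝ :=
  1 / 9 * ((1 + (-1 / 3) ^ m + (-1 / 3) ^ n - 19 * (-1 / 3) ^ (m + n + 2)
    + 2 * Real.sqrt (lamR m n)) / lamDen m n)

def lam3minus (m n : ℕ) : ℝ :=
  1 / 9 * ((1 + (-1 / 3) ^ m + (-1 / 3) ^ n - 19 * (-1 / 3) ^ (m + n + 2)
    - 2 * Real.sqrt (lamR m n)) / lamDen m n)

end AKLT

end

/-! ### Two-site operators on the chain. -/

noncomputable section

namespace AKLT

open Complex
open scoped Kronecker

/-! Ground states. Each `h(x,x+1)` is a projection, so a ground state is annihilated by every bond.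
The Casimir matrix of two spins 1 has the eigenvalues 0, 2, 6, which makes the projection explicit
and turns "the bond annihilates `ψ`" into five linear equations. Each factor of `U` is `1 - 2T²`
with `T³ = T`: it flips spin `k`, with a sign, when spin `j` is nonzero. Hence `U` is a signed
permutation of configurations and an involution, and it turns the five equations into `StringCond`,
which the four products `φ_i ⊗ φ_i` solve and span. Appending one site at a time shows that nothing
but the `Φ_i` survives on longer intervals (`stringSpace_eq_span`).

Spectrum. The projection onto the span of the `Φ_i` is given by their Gram matrix. Applied to a
product vector that is constant on pieces it replaces factors by some `φ_k`, which produces `𝒜`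
(`kennedyTasaki_K_Theta`). Up to a diagonal matrix of signs, all Gram matrices are `(1 - x) 1 + x
J`, so `𝒜` is invariant under simultaneous permutations of the four states. The representation `ℂ⁴ ⊗
ℂ⁴` of `S₄` contains the trivial representation twice and the standard one three times, and the
complement has dimension five. This gives one 2×2 block, one 3×3 block occurring three times, and a
scalar on five vectors; their characteristic polynomials give `charpoly_A`. Since `𝒢(-m,0) ∩ 𝒢(0,n)
= 𝒢(-m,n)`, the number `ε(m,n)` is the largest eigenvalue of `K` other than 1 (`eps_eq`), and the
nonzero eigenvalues of `K` are those of `𝒜`, even when the `Θ_{ij}` are dependent.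

Gap. All the lower bounds follow from the single inequality `H² ≥ 0.18 H`, which does not use
`ε(m,n)`. In `H² = ∑ P_j P_k` the terms at distance three or more are nonnegative and are dropped.
The others are distributed over windows of three consecutive bonds. In a window the two outer
projections commute, and the middle one is at a small angle to their common kernel: for `u` in that
kernel, at least 2/3 of `‖P₂ u‖²` survives projection onto it again (`three_site`, `four_site`,
explicit sums of squares). This makes every window nonnegative at the price of `0.82 ∑ P_k`
(`window_nonneg`). The bound with `γ_6` also needs an upper bound for `γ_6`, which the three-site
chain supplies: `γ(3) ≤ 1/2`. -/

/-- The configuration `σ` with the values at `x` and `y` replaced by `s` and `t`. -/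
def upd2 {L : ℕ} (σ : Fin L → Fin 3) (x y : Fin L) (s t : Fin 3) : Fin L → Fin 3 :=
  Function.update (Function.update σ x s) y t

section Upd2

variable {L : ℕ} {x y : Fin L}

@[simp] lemma upd2_right (σ : Fin L → Fin 3) (s t : Fin 3) : upd2 σ x y s t y = t := by
  simp [upd2]

lemma upd2_left (hxy : x ≠ y) (σ : Fin L → Fin 3) (s t : Fin 3) : upd2 σ x y s t x = s := by
  simp [upd2, hxy]

lemma upd2_of_ne {z : Fin L} (hx : z ≠ x) (hy : z ≠ y) (σ : Fin L → Fin 3) (s t : Fin 3) :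
    upd2 σ x y s t z = σ z := by
  simp [upd2, hx, hy]

lemma upd2_upd2 (hxy : x ≠ y) (σ : Fin L → Fin 3) (s t s' t' : Fin 3) :
    upd2 (upd2 σ x y s t) x y s' t' = upd2 σ x y s' t' := by
  ext z
  by_cases hy : z = y
  · subst hy; simp
  by_cases hx : z = x
  · subst hx; simp [upd2_left hxy]
  simp [upd2_of_ne hx hy]

lemma upd2_self (hxy : x ≠ y) (σ : Fin L → Fin 3) : upd2 σ x y (σ x) (σ y) = σ := by
  ext z
  by_cases hy : z = y
  · subst hy; simp
  by_cases hx : z = x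
  · subst hx; simp [upd2_left hxy]
  simp [upd2_of_ne hx hy]

lemma upd2_comm {z w : Fin L} (hxz : x ≠ z) (hxw : x ≠ w) (hyz : y ≠ z) (hyw : y ≠ w)
    (σ : Fin L → Fin 3) (s t s' t' : Fin 3) :
    upd2 (upd2 σ x y s t) z w s' t' = upd2 (upd2 σ z w s' t') x y s t := by
  ext u
  simp only [upd2, Function.update_apply]
  split_ifs <;> simp_all

/-- The involution `(σ, s, t) ↦ (σ[x ↦ s, y ↦ t], σ x, σ y)`. -/
lemma sum_upd2_swap {β : Type*} [AddCommMonoid β] (hxy : x ≠ y)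
    (F : (Fin L → Fin 3) → (Fin L → Fin 3) → β) :
    ∑ σ, ∑ s, ∑ t, F σ (upd2 σ x y s t) = ∑ σ, ∑ s, ∑ t, F (upd2 σ x y s t) σ := by
  have key : ∀ f : (Fin L → Fin 3) → Fin 3 → Fin 3 → β,
      ∑ σ, ∑ s, ∑ t, f σ s t = ∑ p : (Fin L → Fin 3) × Fin 3 × Fin 3, f p.1 p.2.1 p.2.2 := by
    intro f
    simp [Fintype.sum_prod_type]
  rw [key, key (fun σ s t => F (upd2 σ x y s t) σ)]
  let e : (Fin L → Fin 3) × Fin 3 × Fin 3 → (Fin L → Fin 3) × Fin 3 × Fin 3 :=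
    fun p => (upd2 p.1 x y p.2.1 p.2.2, p.1 x, p.1 y)
  have he : Function.Involutive e := by
    rintro ⟨σ, s, t⟩
    simp [e, upd2_upd2 hxy, upd2_self hxy, upd2_left hxy]
  refine Fintype.sum_equiv he.toPerm _ _ ?_
  rintro ⟨σ, s, t⟩
  simp [e, upd2_upd2 hxy, upd2_self hxy]

/-- Every configuration is reached nine times. Averages of this kind reduce inequalities between
norms on the chain to inequalities for functions of a few sites. -/
lemma sum_upd2 (hxy : x ≠ y) (F : (Fin L → Fin 3) → ℝ) :
    ∑ σ, F σ = (1 / 9) * ∑ σ, ∑ s, ∑ t, F (upd2 σ x y s t) := by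
  rw [sum_upd2_swap hxy fun _ τ => F τ]
  simp only [Finset.sum_const, Finset.card_univ, Fintype.card_fin, nsmul_eq_mul,
    ← Finset.mul_sum]
  push_cast
  ring

end Upd2

/-- A two-site matrix. -/
abbrev PairMat : Type := Matrix (Fin 3 × Fin 3) (Fin 3 × Fin 3) ℂ

/-- The two-site matrix `B` acting at the sites `x` and `y`. -/
def pairOp {L : ℕ} (x y : Fin L) (B : PairMat) : Op L :=
  LinearMap.toContinuousLinearMap
    { toFun := fun ψ => WithLp.toLp 2 fun σ =>
        ∑ s : Fin 3, ∑ t : Fin 3, B (σ x, σ y) (s, t) * ψ (upd2 σ x y s t)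
      map_add' := by
        intro ψ χ
        ext σ
        simp [mul_add, Finset.sum_add_distrib]
      map_smul' := by
        intro c ψ
        ext σ
        simp only [PiLp.smul_apply, smul_eq_mul, RingHom.id_apply, Finset.mul_sum]
        exact Finset.sum_congr rfl fun s _ => Finset.sum_congr rfl fun t _ => by ring }

section PairOp

variable {L : ℕ} {x y : Fin L}

lemma pairOp_apply (B : PairMat) (ψ : Chain L) (σ : Fin L → Fin 3) :
    pairOp x y B ψ σ = ∑ s : Fin 3, ∑ t : Fin 3, B (σ x, σ y) (s, t) * ψ (upd2 σ x y s t) := rfl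

lemma siteOp_apply (A : Matrix (Fin 3) (Fin 3) ℂ) (ψ : Chain L) (σ : Fin L → Fin 3) :
    siteOp x A ψ σ = ∑ s : Fin 3, A (σ x) s * ψ (Function.update σ x s) := rfl

lemma pairOp_add (B C : PairMat) : pairOp x y (B + C) = pairOp x y B + pairOp x y C := by
  ext ψ σ
  simp [pairOp_apply, add_mul, Finset.sum_add_distrib]

lemma pairOp_smul (c : ℂ) (B : PairMat) : pairOp x y (c • B) = c • pairOp x y B := by
  ext ψ σ
  simp [pairOp_apply, Finset.mul_sum, mul_assoc]

lemma pairOp_mul (hxy : x ≠ y) (B C : PairMat) :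
    pairOp x y (B * C) = pairOp x y B * pairOp x y C := by
  ext ψ σ
  rw [mul_apply_eq_comp, pairOp_apply, pairOp_apply]
  simp only [pairOp_apply, upd2_upd2 hxy, upd2_left hxy, upd2_right, Matrix.mul_apply,
    Fintype.sum_prod_type, Fin.sum_univ_three]
  ring

/-- The matrix element couples `σ` with a configuration that differs from it only at `x` and `y`;
`sum_upd2_swap` exchanges the roles of the two. -/
lemma pairOp_inner (hxy : x ≠ y) (B : PairMat) (ψ χ : Chain L) :
    inner ℂ (pairOp x y B ψ) χ = inner ℂ ψ (pairOp x y B.conjTranspose χ) := by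
  simp only [PiLp.inner_apply, pairOp_apply, RCLike.inner_apply, map_sum, map_mul,
    Finset.mul_sum, Finset.sum_mul, Matrix.conjTranspose_apply]
  have h := sum_upd2_swap hxy (fun σ τ : Fin L → Fin 3 =>
    χ σ * ((starRingEnd ℂ) (B (σ x, σ y) (τ x, τ y)) * (starRingEnd ℂ) (ψ τ)))
  simp only [upd2_left hxy, upd2_right] at h
  rw [h]
  refine Finset.sum_congr rfl fun σ _ => Finset.sum_congr rfl fun s _ =>
    Finset.sum_congr rfl fun t _ => ?_
  simp only [RCLike.star_def]
  ring

lemma siteOp_eq_pairOp_left (hxy : x ≠ y) (A : Matrix (Fin 3) (Fin 3) ℂ) :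
    siteOp x A = pairOp x y (A ⊗ₖ 1) := by
  ext ψ σ
  rw [siteOp_apply, pairOp_apply]
  refine Finset.sum_congr rfl fun s _ => ?_
  rw [Finset.sum_eq_single (σ y)]
  · simp only [Matrix.kronecker_apply, Matrix.one_apply_eq, mul_one]
    congr 1
    refine congrArg ψ.ofLp (funext fun z => ?_)
    by_cases hy : z = y
    · subst hy; simp [Ne.symm hxy]
    · simp [upd2, hy]
  · intro t _ ht
    simp [Matrix.one_apply_ne (Ne.symm ht)]
  · simp

lemma siteOp_eq_pairOp_right (A : Matrix (Fin 3) (Fin 3) ℂ) :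
    siteOp y A = pairOp x y (1 ⊗ₖ A) := by
  ext ψ σ
  rw [siteOp_apply, pairOp_apply]
  symm
  rw [Finset.sum_eq_single (σ x)]
  · refine Finset.sum_congr rfl fun s _ => ?_
    simp [upd2]
  · intro t _ ht
    simp [Matrix.one_apply_ne (Ne.symm ht)]
  · simp

end PairOp

/-! ### The interaction as an explicit matrix. -/

/-- The spin-2 vectors of two spins 1, up to normalization. -/
def quint : Fin 5 → Fin 3 → Fin 3 → ℤ :=
  ![![![1, 0, 0], ![0, 0, 0], ![0, 0, 0]],
    ![![0, 1, 0], ![1, 0, 0], ![0, 0, 0]],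
    ![![0, 0, 1], ![0, 2, 0], ![1, 0, 0]],
    ![![0, 0, 0], ![0, 0, 1], ![0, 1, 0]],
    ![![0, 0, 0], ![0, 0, 0], ![0, 0, 1]]]

/-- Their square norms. -/
def quintNorm : Fin 5 → ℤ := ![1, 2, 6, 2, 1]

/-- The matrix of the projection onto spin 2, multiplied by 6. -/
def quintProj (p q : Fin 3 × Fin 3) : ℤ :=
  ∑ a, (6 / quintNorm a) * (quint a p.1 p.2 * quint a q.1 q.2)

/-- The projection of two spins 1 onto total spin 2. -/
def spinTwo : PairMat := Matrix.of fun p q => (quintProj p q : ℂ) / 6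

/-- The Casimir matrix `(S ⊗ 1 + 1 ⊗ S)²` of two spins 1. -/
def casimir : PairMat :=
  ((spinX ⊗ₖ 1) + (1 ⊗ₖ spinX)) ^ 2
    + ((spinY ⊗ₖ 1) + (1 ⊗ₖ spinY)) ^ 2
    + ((spinZ ⊗ₖ 1) + (1 ⊗ₖ spinZ)) ^ 2

/-- The integer entries of the Casimir matrix. -/
def casimirInt : Matrix (Fin 3 × Fin 3) (Fin 3 × Fin 3) ℤ :=
  Matrix.of fun p q =>
    (if p = q then 4 + 2 * (1 - (p.1 : ℤ)) * (1 - (p.2 : ℤ)) else 0) +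
    (if (p.1 : ℤ) = q.1 + 1 ∧ (q.2 : ℤ) = p.2 + 1 then 2 else 0) +
    (if (q.1 : ℤ) = p.1 + 1 ∧ (p.2 : ℤ) = q.2 + 1 then 2 else 0)

lemma inv_sqrt_two_mul_self :
    (((Real.sqrt 2 : ℝ) : ℂ)⁻¹) * ((Real.sqrt 2 : ℝ) : ℂ)⁻¹ = 1 / 2 := by
  rw [← mul_inv, ← Complex.ofReal_mul, Real.mul_self_sqrt (by norm_num)]
  norm_num

lemma casimir_eq : casimir = casimirInt.map (fun z : ℤ => (z : ℂ)) := by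
  have hs := inv_sqrt_two_mul_self
  -- The two summands commute, so the cross terms combine to `2 A ⊗ A`. After this the factors
  -- `1/√2` occur only in pairs, and the entries become rational.
  have e : ∀ A : Matrix (Fin 3) (Fin 3) ℂ,
      ((A ⊗ₖ 1) + (1 ⊗ₖ A) : PairMat) ^ 2
        = ((A * A) ⊗ₖ 1) + (1 ⊗ₖ (A * A)) + (2 : ℂ) • (A ⊗ₖ A) := by
    intro A
    rw [sq, add_mul, mul_add, mul_add]
    simp only [← Matrix.mul_kronecker_mul, mul_one, one_mul, two_smul]
    abel
  have hx : spinX * spinX = (1 / 2 : ℂ) • !![1, 0, 1; 0, 2, 0; 1, 0, 1] := by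
    simp only [spinX, Matrix.smul_mul, Matrix.mul_smul, smul_smul, hs]
    congr 1
    ext i j
    fin_cases i <;> fin_cases j <;> simp [Matrix.mul_apply, Fin.sum_univ_three]; norm_num
  have hy : spinY * spinY = (1 / 2 : ℂ) • !![1, 0, -1; 0, 2, 0; -1, 0, 1] := by
    simp only [spinY, Matrix.smul_mul, Matrix.mul_smul, smul_smul, hs]
    congr 1
    ext i j
    fin_cases i <;> fin_cases j <;> simp [Matrix.mul_apply, Fin.sum_univ_three]; norm_num
  have hz : spinZ * spinZ = !![1, 0, 0; 0, 0, 0; 0, 0, 1] := by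
    ext i j
    fin_cases i <;> fin_cases j <;> simp [spinZ, Matrix.mul_apply, Fin.sum_univ_three]
  have hxx : ∀ a b c d, spinX a b * spinX c d
      = 1 / 2 * ((!![0, 1, 0; 1, 0, 1; 0, 1, 0] : Matrix (Fin 3) (Fin 3) ℂ) a b
        * (!![0, 1, 0; 1, 0, 1; 0, 1, 0] : Matrix (Fin 3) (Fin 3) ℂ) c d) := by
    intro a b c d
    simp only [spinX, Matrix.smul_apply, smul_eq_mul, ← hs]
    ring
  have hyy : ∀ a b c d, spinY a b * spinY c d
      = 1 / 2 * ((!![0, -I, 0; I, 0, -I; 0, I, 0] : Matrix (Fin 3) (Fin 3) ℂ) a b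
        * (!![0, -I, 0; I, 0, -I; 0, I, 0] : Matrix (Fin 3) (Fin 3) ℂ) c d) := by
    intro a b c d
    simp only [spinY, Matrix.smul_apply, smul_eq_mul, ← hs]
    ring
  rw [casimir, e, e, e, hx, hy, hz]
  ext ⟨a, b⟩ ⟨c, d⟩
  simp only [Matrix.add_apply, Matrix.smul_apply, Matrix.kronecker_apply, Matrix.map_apply,
    casimirInt, Matrix.of_apply, hxx, hyy, smul_eq_mul]
  fin_cases a <;> fin_cases b <;> fin_cases c <;> fin_cases d <;>
    simp [spinZ] <;> norm_num

lemma casimir_mul_spinTwo : casimir * spinTwo = (6 : ℂ) • spinTwo := by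
  have h : ∀ p q, ∑ r, casimirInt p r * quintProj r q = 6 * quintProj p q := by decide
  rw [casimir_eq]
  ext p q
  have := congrArg (fun z : ℤ => (z : ℂ)) (h p q)
  push_cast at this
  simp only [Matrix.mul_apply, Matrix.map_apply, spinTwo, Matrix.of_apply, Matrix.smul_apply,
    smul_eq_mul, ← mul_div_assoc, ← Finset.sum_div]
  rw [this]

/-- On total spin 0, 1, 2 the Casimir matrix is 0, 2, 6, so `C (C - 2)` vanishes on the first two
and equals 24 on the last. Multiplied by 6, the projection has integer entries, and the identity can
be decided. -/
lemma casimir_sq : casimir * casimir = (2 : ℂ) • casimir + (24 : ℂ) • spinTwo := by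
  have h : ∀ p q, ∑ r, casimirInt p r * casimirInt r q
      = 2 * casimirInt p q + 4 * quintProj p q := by decide
  rw [casimir_eq]
  ext p q
  have := congrArg (fun z : ℤ => (z : ℂ)) (h p q)
  push_cast at this
  simp only [Matrix.mul_apply, Matrix.map_apply, spinTwo, Matrix.of_apply, Matrix.smul_apply,
    smul_eq_mul, Matrix.add_apply]
  rw [this]
  ring

lemma spinTwo_conjTranspose : spinTwo.conjTranspose = spinTwo := by
  have h : ∀ p q, quintProj q p = quintProj p q := by decide
  ext p q
  simp [Matrix.conjTranspose_apply, spinTwo, h p q]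

variable {L : ℕ} {x y : Fin L}

lemma totalSpinSq_eq (hxy : x ≠ y) : totalSpinSq x y = pairOp x y casimir := by
  simp only [totalSpinSq, casimir, pairOp_add, sq, pairOp_mul hxy, siteOp_eq_pairOp_left hxy,
    siteOp_eq_pairOp_right (x := x) (y := y)]

/-- `casimir_mul_spinTwo` places the range of the matrix in the eigenspace, `casimir_sq` shows that
it fixes the eigenspace, and it is Hermitian. -/
lemma bond_eq (hxy : x ≠ y) : bond x y = pairOp x y spinTwo := by
  have hmem : ∀ ψ : Chain L, ψ ∈ Module.End.eigenspace
      ((totalSpinSq x y : Op L) : Chain L →ₗ[ℂ] Chain L) 6 ↔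
      pairOp x y casimir ψ = (6 : ℂ) • ψ := by
    intro ψ
    rw [Module.End.mem_eigenspace_iff, totalSpinSq_eq hxy]
    rfl
  have hfix : ∀ ψ : Chain L, pairOp x y casimir ψ = (6 : ℂ) • ψ → pairOp x y spinTwo ψ = ψ := by
    intro ψ h
    have h2 := congrArg (fun T : Op L => T ψ) (congrArg (pairOp x y) casimir_sq)
    simp only [pairOp_mul hxy, pairOp_add, pairOp_smul, mul_apply_eq_comp,
      add_apply, smul_apply, h, map_smul, smul_smul] at h2
    have h3 : (24 : ℂ) • ψ = (24 : ℂ) • pairOp x y spinTwo ψ := by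
      rw [← sub_eq_iff_eq_add', ← sub_smul] at h2
      rw [← h2]
      norm_num
    exact (smul_right_injective _ (by norm_num : (24 : ℂ) ≠ 0) h3).symm
  ext1 ψ
  rw [bond]
  refine Submodule.eq_starProjection_of_mem_orthogonal ?_ ?_
  · rw [hmem]
    have := congrArg (fun T : Op L => T ψ) (congrArg (pairOp x y) casimir_mul_spinTwo)
    simpa [pairOp_mul hxy, pairOp_smul] using this
  · rw [Submodule.mem_orthogonal]
    intro u hu
    have hu' := hfix u ((hmem u).1 hu)
    rw [inner_sub_right, ← spinTwo_conjTranspose, ← pairOp_inner hxy, hu', sub_self]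

lemma bond_apply (hxy : x ≠ y) (ψ : Chain L) (σ : Fin L → Fin 3) :
    bond x y ψ σ = ∑ s, ∑ t, (quintProj (σ x, σ y) (s, t) : ℂ) / 6 * ψ (upd2 σ x y s t) := by
  rw [bond_eq hxy, pairOp_apply]
  rfl

/-- The component of `ψ` along the spin-2 vector `a` at the sites `x` and `y`. -/
def quintPart (x y : Fin L) (a : Fin 5) (ψ : Chain L) (σ : Fin L → Fin 3) : ℂ :=
  ∑ s, ∑ t, (quint a s t : ℂ) * ψ (upd2 σ x y s t)

lemma bond_apply_eq_sum (hxy : x ≠ y) (ψ : Chain L) (σ : Fin L → Fin 3) :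
    bond x y ψ σ = ∑ a, (quint a (σ x) (σ y) : ℂ) / quintNorm a * quintPart x y a ψ σ := by
  rw [bond_apply hxy]
  have h : ∀ p q : Fin 3 × Fin 3, (quintProj p q : ℂ) / 6
      = ∑ a, (quint a p.1 p.2 : ℂ) / quintNorm a * quint a q.1 q.2 := by
    intro p q
    rw [quintProj]
    push_cast
    rw [Finset.sum_div]
    refine Finset.sum_congr rfl fun a _ => ?_
    fin_cases a <;> simp [quintNorm] <;> ring
  simp only [h, quintPart, Finset.mul_sum, Finset.sum_mul]
  simp only [Fin.sum_univ_three, Fin.sum_univ_five]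
  ring

lemma quintPart_bond (hxy : x ≠ y) (a : Fin 5) (ψ : Chain L) (σ : Fin L → Fin 3) :
    quintPart x y a (bond x y ψ) σ = quintPart x y a ψ σ := by
  have h : ∀ (a : Fin 5) (q : Fin 3 × Fin 3),
      ∑ s, ∑ t, quint a s t * quintProj (s, t) q = 6 * quint a q.1 q.2 := by decide
  have h' : ∀ (a : Fin 5) (s' t' : Fin 3),
      ∑ s, ∑ t, (quint a s t : ℂ) * ((quintProj (s, t) (s', t') : ℂ) / 6) = quint a s' t' := by
    intro a s' t'
    have := congrArg (fun z : ℤ => (z : ℂ)) (h a (s', t'))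
    push_cast at this
    simp only [← mul_div_assoc, ← Finset.sum_div]
    rw [this]
    ring
  simp only [quintPart, bond_apply hxy, upd2_upd2 hxy, upd2_left hxy, upd2_right]
  have e : ∀ s t, (quint a s t : ℂ) * ψ (upd2 σ x y s t)
      = (∑ s', ∑ t', (quint a s' t' : ℂ) * ((quintProj (s', t') (s, t) : ℂ) / 6))
        * ψ (upd2 σ x y s t) := fun s t => by rw [h']
  simp only [e]
  simp only [Fin.sum_univ_three]
  ring

/-- The components along the five spin-2 vectors are unchanged by the projection and determine its
value, so they are the equations of its kernel. -/
lemma bond_eq_zero_iff (hxy : x ≠ y) (ψ : Chain L) :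
    bond x y ψ = 0 ↔ ∀ a σ, quintPart x y a ψ σ = 0 := by
  constructor
  · intro h a σ
    rw [← quintPart_bond hxy, h]
    simp [quintPart]
  · intro h
    ext σ
    rw [bond_apply_eq_sum hxy]
    simp [h]

end AKLT

end

/-! ### Ground states as solutions of local equations. -/

noncomputable section

namespace AKLT

open Complex
open scoped Kronecker

lemma bond_inner {L : ℕ} (x y : Fin L) (ψ χ : Chain L) :
    inner ℂ (bond x y ψ) χ = inner ℂ ψ (bond x y χ) :=
  Submodule.inner_starProjection_left_eq_right _ _ _

lemma bond_bond {L : ℕ} (x y : Fin L) (ψ : Chain L) : bond x y (bond x y ψ) = bond x y ψ := by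
  rw [bond, Submodule.starProjection_eq_self_iff]
  exact Submodule.starProjection_apply_mem _ _

lemma ham_apply (L a b : ℕ) (ψ : Chain L) :
    ham L a b ψ = ∑ p : Fin L × Fin L with
      (a ≤ (p.1 : ℕ) ∧ (p.2 : ℕ) = (p.1 : ℕ) + 1 ∧ (p.2 : ℕ) ≤ b), bond p.1 p.2 ψ := by
  simp [ham, sum_apply]

lemma inner_bond_self {L : ℕ} (x y : Fin L) (ψ : Chain L) :
    inner ℂ ψ (bond x y ψ) = ((‖bond x y ψ‖ ^ 2 : ℝ) : ℂ) := by
  conv_lhs => rw [← bond_bond, ← bond_inner, inner_self_eq_norm_sq_to_K]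
  simp

/-- The expectation of the Hamiltonian is the sum of the squares `‖bond x y ψ‖²`, hence it vanishes
only if each of them does. -/
lemma mem_groundSpace_iff {L a b : ℕ} {ψ : Chain L} :
    ψ ∈ groundSpace L a b ↔ ∀ x y : Fin L, a ≤ (x : ℕ) → (y : ℕ) = x + 1 → (y : ℕ) ≤ b →
      bond x y ψ = 0 := by
  have hker : ψ ∈ groundSpace L a b ↔ ham L a b ψ = 0 := by
    rw [groundSpace, LinearMap.mem_ker]; rfl
  rw [hker]
  constructor
  · intro h x y hx hxy hy
    have h2 : inner ℂ ψ (ham L a b ψ) = 0 := by rw [h, inner_zero_right]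
    rw [ham_apply, inner_sum] at h2
    simp only [inner_bond_self, ← Complex.ofReal_sum] at h2
    rw [Complex.ofReal_eq_zero, Finset.sum_eq_zero_iff_of_nonneg (fun _ _ => by positivity)] at h2
    have := h2 (x, y) (by simp [hx, hxy]; omega)
    simpa using this
  · intro h
    rw [ham_apply]
    refine Finset.sum_eq_zero fun p hp => ?_
    simp only [Finset.mem_filter, Finset.mem_univ, true_and] at hp
    exact h p.1 p.2 hp.1 hp.2.1 hp.2.2

/-- The five equations for `bond x y ψ = 0`. -/
lemma bond_eq_zero_iff' {L : ℕ} {x y : Fin L} (hxy : x ≠ y) (ψ : Chain L) :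
    bond x y ψ = 0 ↔ ∀ σ, ψ (upd2 σ x y 0 0) = 0 ∧ ψ (upd2 σ x y 2 2) = 0 ∧
      ψ (upd2 σ x y 0 1) + ψ (upd2 σ x y 1 0) = 0 ∧
      ψ (upd2 σ x y 2 1) + ψ (upd2 σ x y 1 2) = 0 ∧
      ψ (upd2 σ x y 0 2) + ψ (upd2 σ x y 2 0) + 2 * ψ (upd2 σ x y 1 1) = 0 := by
  rw [bond_eq_zero_iff hxy, forall_comm]
  refine forall_congr' fun σ => ?_
  have e : (∀ a, quintPart x y a ψ σ = 0) ↔ (ψ (upd2 σ x y 0 0) = 0 ∧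
      ψ (upd2 σ x y 0 1) + ψ (upd2 σ x y 1 0) = 0 ∧
      ψ (upd2 σ x y 0 2) + 2 * ψ (upd2 σ x y 1 1) + ψ (upd2 σ x y 2 0) = 0 ∧
      ψ (upd2 σ x y 1 2) + ψ (upd2 σ x y 2 1) = 0 ∧ ψ (upd2 σ x y 2 2) = 0) := by
    simp [Fin.forall_fin_succ, quintPart, Fin.sum_univ_three, quint]
  rw [e]
  constructor
  · rintro ⟨h1, h2, h3, h4, h5⟩
    refine ⟨h1, h5, h2, ?_, ?_⟩
    · rw [← h4]; ring
    · rw [← h3]; ring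
  · rintro ⟨h1, h2, h3, h4, h5⟩
    refine ⟨h1, h3, ?_, ?_, h2⟩
    · rw [← h5]; ring
    · rw [← h4]; ring

/-! ### Exponentials of operators with spectrum in `{-1, 0, 1}`. -/

section Exp

variable {𝔸 : Type*} [NormedRing 𝔸] [NormedAlgebra ℂ 𝔸] [CompleteSpace 𝔸]

lemma exp_smul_of_idempotent (c : ℂ) {E : 𝔸} (hE : E * E = E) :
    NormedSpace.exp (c • E) = 1 + (Complex.exp c - 1) • E := by
  have hpow : ∀ n : ℕ, E ^ (n + 1) = E := by
    intro n
    induction n with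
    | zero => simp
    | succ n ih => rw [pow_succ, ih, hE]
  have h1 := NormedSpace.exp_series_hasSum_exp' (𝕂 := ℂ) (c • E)
  have h2 := (NormedSpace.exp_series_hasSum_exp' (𝕂 := ℂ) c).smul_const E
  have h3 := h2.add (hasSum_ite_eq (0 : ℕ) (1 - E))
  have h4 : (fun n : ℕ => ((n.factorial : ℂ)⁻¹ • c ^ n) • E + if n = 0 then 1 - E else 0)
      = fun n : ℕ => (n.factorial : ℂ)⁻¹ • (c • E) ^ n := by
    funext n
    cases n with
    | zero => simp
    | succ n => simp [smul_pow, hpow, smul_smul]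
  rw [h4] at h3
  rw [h1.unique h3, ← Complex.exp_eq_exp_ℂ]
  rw [sub_smul, one_smul]
  abel

/-- `E` and `F` below are the spectral idempotents for the eigenvalues `1` and `-1`. Both `exp(iπ)`
and `exp(-iπ)` equal `-1`, so the exponential is `1 - 2(E + F)`, and `E + F = T²`. -/
lemma exp_pi_I_smul {T : 𝔸} (hT : T * T * T = T) :
    NormedSpace.exp (((Real.pi : ℂ) * I) • T) = 1 - (2 : ℂ) • (T * T) := by
  have hT' : T * (T * T) = T := by rw [← mul_assoc, hT]
  have hT4 : T * T * (T * T) = T * T := by rw [← mul_assoc, hT]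
  obtain ⟨E, hE⟩ : ∃ E : 𝔸, E = (1 / 2 : ℂ) • (T * T + T) := ⟨_, rfl⟩
  obtain ⟨F, hF⟩ : ∃ F : 𝔸, F = (1 / 2 : ℂ) • (T * T - T) := ⟨_, rfl⟩
  have hEE : E * E = E := by
    rw [hE, smul_mul_smul_comm, mul_add, add_mul, add_mul, hT, hT', hT4]
    rw [show T * T + T + (T + T * T) = (2 : ℂ) • (T * T + T) by rw [two_smul]; abel, smul_smul]
    norm_num
  have hFF : F * F = F := by
    rw [hF, smul_mul_smul_comm, mul_sub, sub_mul, sub_mul, hT, hT', hT4]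
    rw [show T * T - T - (T - T * T) = (2 : ℂ) • (T * T - T) by rw [two_smul]; abel, smul_smul]
    norm_num
  have hEF : E * F = 0 := by
    rw [hE, hF, smul_mul_smul_comm, mul_sub, add_mul, add_mul, hT, hT', hT4]
    rw [show T * T + T - (T + T * T) = 0 by abel, smul_zero]
  have hFE : F * E = 0 := by
    rw [hE, hF, smul_mul_smul_comm, mul_add, sub_mul, sub_mul, hT, hT', hT4]
    rw [show T * T - T + (T - T * T) = 0 by abel, smul_zero]
  have hdec : ((Real.pi : ℂ) * I) • T = ((Real.pi : ℂ) * I) • E + (-((Real.pi : ℂ) * I)) • F := by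
    rw [neg_smul, ← sub_eq_add_neg, ← smul_sub, hE, hF, ← smul_sub,
      show T * T + T - (T * T - T) = (2 : ℂ) • T by rw [two_smul]; abel, smul_smul (1 / 2 : ℂ)]
    norm_num
  have hTT : T * T = E + F := by
    rw [hE, hF, ← smul_add, show (T * T + T) + (T * T - T) = (2 : ℂ) • (T * T) by
      rw [two_smul]; abel, smul_smul]
    norm_num
  have hcomm : Commute (((Real.pi : ℂ) * I) • E) ((-((Real.pi : ℂ) * I)) • F) := by
    rw [commute_iff_eq, smul_mul_smul_comm, smul_mul_smul_comm, hEF, hFE, smul_zero, smul_zero]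
  let _ : NormedAlgebra ℚ 𝔸 := NormedAlgebra.restrictScalars ℚ ℂ 𝔸
  rw [hdec, NormedSpace.exp_add_of_commute hcomm, exp_smul_of_idempotent _ hEE,
    exp_smul_of_idempotent _ hFF, Complex.exp_neg, Complex.exp_pi_mul_I, hTT]
  rw [mul_add, add_mul, add_mul, smul_mul_smul_comm, hEF, smul_zero, one_mul, mul_one, one_mul,
    add_zero, smul_add]
  rw [show (-1 - 1 : ℂ) = -2 by norm_num, show ((-1 : ℂ)⁻¹ - 1) = -2 by norm_num, neg_smul, neg_smul]
  abel

end Exp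

/-! ### One factor of the Kennedy–Tasaki transformation. -/

section Factor

variable {L : ℕ} {j k : Fin L}

lemma rev_eq_one_iff {s : Fin 3} : Fin.rev s = 1 ↔ s = 1 := by
  revert s; decide

/-- The factor `exp(iπ S_j^z S_k^x)` of the Kennedy–Tasaki transformation. -/
def ktFactor (p : Fin L × Fin L) : Op L :=
  NormedSpace.exp (((Real.pi : ℂ) * I) • (siteOp p.1 spinZ * siteOp p.2 spinX))

lemma spinX_sq : spinX * spinX = (1 / 2 : ℂ) • !![1, 0, 1; 0, 2, 0; 1, 0, 1] := by
  simp only [spinX, Matrix.smul_mul, Matrix.mul_smul, smul_smul, inv_sqrt_two_mul_self]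
  congr 1
  ext i j
  fin_cases i <;> fin_cases j <;> simp [Matrix.mul_apply, Fin.sum_univ_three]; norm_num

lemma spinX_cube : spinX * spinX * spinX = spinX := by
  rw [spinX_sq, spinX, Matrix.smul_mul, Matrix.mul_smul, smul_smul, mul_comm, ← smul_smul]
  congr 1
  ext i j
  fin_cases i <;> fin_cases j <;> simp <;> norm_num

lemma spinZ_sq : spinZ * spinZ = !![1, 0, 0; 0, 0, 0; 0, 0, 1] := by
  ext i j
  fin_cases i <;> fin_cases j <;> simp [spinZ, Matrix.mul_apply, Fin.sum_univ_three]

lemma spinZ_cube : spinZ * spinZ * spinZ = spinZ := by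
  rw [spinZ_sq]
  ext i j
  fin_cases i <;> fin_cases j <;> simp [spinZ, Matrix.mul_apply, Fin.sum_univ_three]

/-- `(S^z)²` is the indicator of a nonzero spin at `j`, and `1 - 2 (S^x)²` is minus the exchange of
`|+⟩` and `|-⟩` at `k`, that is, minus `Fin.rev`. -/
lemma ktFactor_apply (hjk : j ≠ k) (ψ : Chain L) (σ : Fin L → Fin 3) :
    ktFactor (j, k) ψ σ =
      if σ j = 1 then ψ σ else -ψ (Function.update σ k (Fin.rev (σ k))) := by
  have hT : siteOp j spinZ * siteOp k spinX = pairOp j k (spinZ ⊗ₖ spinX) := by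
    rw [siteOp_eq_pairOp_left hjk, siteOp_eq_pairOp_right (x := j), ← pairOp_mul hjk,
      ← Matrix.mul_kronecker_mul, mul_one, one_mul]
  have hcube : pairOp j k (spinZ ⊗ₖ spinX) * pairOp j k (spinZ ⊗ₖ spinX)
      * pairOp j k (spinZ ⊗ₖ spinX) = pairOp j k (spinZ ⊗ₖ spinX) := by
    rw [← pairOp_mul hjk, ← pairOp_mul hjk, ← Matrix.mul_kronecker_mul,
      ← Matrix.mul_kronecker_mul, spinX_cube, spinZ_cube]
  rw [ktFactor, hT, exp_pi_I_smul hcube, ← pairOp_mul hjk, ← Matrix.mul_kronecker_mul, spinX_sq,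
    spinZ_sq]
  have key : ∀ (s t : Fin 3) (f : Fin 3 → Fin 3 → ℂ),
      f s t - 2 * ∑ s', ∑ t', ((!![1, 0, 0; 0, 0, 0; 0, 0, 1] : Matrix (Fin 3) (Fin 3) ℂ) ⊗ₖ
        ((1 / 2 : ℂ) • !![1, 0, 1; 0, 2, 0; 1, 0, 1])) (s, t) (s', t') * f s' t'
      = if s = 1 then f s t else -f s (Fin.rev t) := by
    intro s t f
    fin_cases s <;> fin_cases t <;> simp [Fin.sum_univ_three, Fin.rev] <;> ring
  have h := key (σ j) (σ k) fun s t => ψ (upd2 σ j k s t)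
  rw [upd2_self hjk, show upd2 σ j k (σ j) (Fin.rev (σ k))
    = Function.update σ k (Fin.rev (σ k)) by simp [upd2]] at h
  rw [← h]
  rfl

end Factor

end AKLT

end

/-! ### The Kennedy–Tasaki transformation as a signed permutation. -/

noncomputable section

namespace AKLT

open Complex

lemma rev_involutive : Function.Involutive (Fin.rev : Fin 3 → Fin 3) := Fin.rev_rev

lemma rev_iterate_mod_two (n : ℕ) : (Fin.rev : Fin 3 → Fin 3)^[n] = Fin.rev^[n % 2] := by
  conv_lhs => rw [← Nat.mod_add_div n 2, Function.iterate_add, rev_involutive.iterate_two_mul]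
  rfl

lemma rev_iterate_eq_one_iff (n : ℕ) {s : Fin 3} : Fin.rev^[n] s = 1 ↔ s = 1 := by
  induction n with
  | zero => rfl
  | succ n ih => rw [Function.iterate_succ_apply', rev_eq_one_iff, ih]

/-- The indicator of a nonzero spin. -/
def occ (s : Fin 3) : ℕ := if s = 1 then 0 else 1

lemma occ_rev_iterate (n : ℕ) (s : Fin 3) : occ (Fin.rev^[n] s) = occ s := by
  simp [occ, rev_iterate_eq_one_iff]

/-- Flips do not change which spins are nonzero, so every factor may be evaluated on the original
configuration, and signs and flips simply accumulate. -/
lemma prod_ktFactor_apply {L : ℕ} (l : List (Fin L × Fin L)) (hl : ∀ p ∈ l, p.1 ≠ p.2)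
    (ψ : Chain L) (σ : Fin L → Fin 3) :
    (l.map ktFactor).prod ψ σ = (-1) ^ (l.map fun p => occ (σ p.1)).sum *
      ψ (fun k => Fin.rev^[(l.map fun p => if p.2 = k then occ (σ p.1) else 0).sum] (σ k)) := by
  induction l generalizing σ with
  | nil => simp
  | cons p l ih =>
    have ih' := ih (fun q hq => hl q (List.mem_cons_of_mem _ hq))
    rw [List.map_cons, List.prod_cons, mul_apply_eq_comp, show p = (p.1, p.2) from rfl,
      ktFactor_apply (hl p List.mem_cons_self)]
    by_cases hp : σ p.1 = 1
    · simp [hp, ih', occ]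
    · have hocc : ∀ q : Fin L, occ (Function.update σ p.2 (Fin.rev (σ p.2)) q) = occ (σ q) := by
        intro q
        by_cases hq : q = p.2
        · subst hq
          simpa using occ_rev_iterate 1 (σ p.2)
        · simp [hq]
      have h1 : occ (σ p.1) = 1 := by simp [occ, hp]
      simp only [hp, if_false, ih', hocc, List.map_cons, List.sum_cons, h1, pow_add]
      rw [show (fun k => Fin.rev^[(l.map fun q => if q.2 = k then occ (σ q.1) else 0).sum]
          (Function.update σ p.2 (Fin.rev (σ p.2)) k)) = fun k => Fin.rev^[(if p.2 = k then 1 else 0)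
          + (l.map fun q => if q.2 = k then occ (σ q.1) else 0).sum] (σ k) from ?_]
      · ring
      · funext k
        by_cases hk : p.2 = k
        · subst hk
          simp [Nat.add_comm 1]
        · simp [hk, Ne.symm hk]

/-- The number of nonzero spins to the left of `k`. -/
def leftOcc {L : ℕ} (σ : Fin L → Fin 3) (k : Fin L) : ℕ := ∑ j, if j < k then occ (σ j) else 0

lemma kennedyTasaki_apply {L : ℕ} (ψ : Chain L) (σ : Fin L → Fin 3) :
    kennedyTasaki L ψ σ = (-1) ^ (∑ k, leftOcc σ k) * ψ (fun k => Fin.rev^[leftOcc σ k] (σ k)) := by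
  have hsum : ∀ f : Fin L × Fin L → ℕ,
      (((List.finRange L ×ˢ List.finRange L).filter fun p => p.1 < p.2).map f).sum
        = ∑ k, ∑ j, if j < k then f (j, k) else 0 := by
    intro f
    rw [Finset.sum_comm, ← Fintype.sum_prod_type' (fun j k => if j < k then f (j, k) else 0),
      ← Finset.sum_filter (p := fun p : Fin L × Fin L => p.1 < p.2),
      ← List.sum_toFinset]
    · congr 1
      ext ⟨j, k⟩
      simp only [Finset.mem_filter, Finset.mem_univ, true_and, List.mem_toFinset, List.mem_filter,
        decide_eq_true_eq]
      exact (and_iff_right (List.pair_mem_product.2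
        ⟨List.mem_finRange _, List.mem_finRange _⟩))
    · exact (List.Nodup.product (List.nodup_finRange L) (List.nodup_finRange L)).filter _
  have h := prod_ktFactor_apply ((List.finRange L ×ˢ List.finRange L).filter fun p => p.1 < p.2)
    (by
      intro p hp
      simp only [List.mem_filter, decide_eq_true_eq] at hp
      exact hp.2.ne) ψ σ
  rw [hsum] at h
  simp only [hsum] at h
  rw [kennedyTasaki]
  refine h.trans ?_
  congr 1
  refine congrArg ψ.ofLp (funext fun k => ?_)
  rw [leftOcc, Finset.sum_eq_single k]
  · simp
  · intro k' _ hk'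
    simp [hk']
  · simp

lemma leftOcc_congr {L : ℕ} {σ τ : Fin L → Fin 3} (h : ∀ j, occ (σ j) = occ (τ j)) :
    leftOcc σ = leftOcc τ := by
  funext k
  simp [leftOcc, h]

lemma kennedyTasaki_mul_self (L : ℕ) : kennedyTasaki L * kennedyTasaki L = 1 := by
  ext ψ σ
  rw [mul_apply_eq_comp, kennedyTasaki_apply, kennedyTasaki_apply]
  rw [leftOcc_congr (τ := σ) (fun j => occ_rev_iterate _ _)]
  rw [← mul_assoc, ← pow_add, ← two_mul, pow_mul]
  simp only [even_two, Even.neg_pow, one_pow, one_mul, one_apply_eq_self]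
  refine congrArg ψ.ofLp (funext fun k => ?_)
  rw [← Function.iterate_add_apply, ← two_mul, rev_involutive.iterate_two_mul]
  rfl

lemma kennedyTasaki_apply_self {L : ℕ} (ψ : Chain L) :
    kennedyTasaki L (kennedyTasaki L ψ) = ψ := by
  rw [← mul_apply_eq_comp, kennedyTasaki_mul_self]
  rfl

/-- The permutation of configurations is an involution and leaves the sign invariant, because both
depend only on the positions of the nonzero spins. -/
lemma kennedyTasaki_inner {L : ℕ} (ψ χ : Chain L) :
    inner ℂ (kennedyTasaki L ψ) χ = inner ℂ ψ (kennedyTasaki L χ) := by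
  let τ : (Fin L → Fin 3) → (Fin L → Fin 3) := fun σ k => Fin.rev^[leftOcc σ k] (σ k)
  have hocc : ∀ σ, leftOcc (τ σ) = leftOcc σ := fun σ => leftOcc_congr fun j => occ_rev_iterate _ _
  have hτ : Function.Involutive τ := by
    intro σ
    funext k
    show Fin.rev^[leftOcc (τ σ) k] (Fin.rev^[leftOcc σ k] (σ k)) = σ k
    rw [hocc, ← Function.iterate_add_apply, ← two_mul, rev_involutive.iterate_two_mul]
    rfl
  simp only [PiLp.inner_apply, RCLike.inner_apply, kennedyTasaki_apply, map_mul, map_pow, map_neg,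
    map_one]
  refine Fintype.sum_equiv hτ.toPerm _ _ fun σ => ?_
  have e : (fun k => Fin.rev^[leftOcc (τ σ) k] (τ σ k)) = σ := hτ σ
  simp only [Function.Involutive.coe_toPerm, hocc] at e ⊢
  rw [e]
  show χ σ * ((-1) ^ _ * (starRingEnd ℂ) (ψ (τ σ))) = _
  ring

lemma star_kennedyTasaki (L : ℕ) : star (kennedyTasaki L) = kennedyTasaki L := by
  rw [ContinuousLinearMap.star_eq_adjoint]
  symm
  rw [ContinuousLinearMap.eq_adjoint_iff]
  exact kennedyTasaki_inner

lemma kennedyTasaki_mem_unitary (L : ℕ) : kennedyTasaki L ∈ unitary (Op L) := by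
  rw [Unitary.mem_iff, star_kennedyTasaki, kennedyTasaki_mul_self]
  exact ⟨rfl, rfl⟩

/-- The transformation at two neighbouring sites, for a given parity of their occupation. -/
lemma kennedyTasaki_upd2 {L : ℕ} {x y : Fin L} (hxy : (y : ℕ) = x + 1) (σ : Fin L → Fin 3) (q : ℕ) :
    ∃ (ε : ℂ) (τ : Fin L → Fin 3) (n : ℕ), n < 2 ∧ ∀ s t : Fin 3, (occ s + occ t) % 2 = q % 2 →
      ∀ ψ : Chain L, kennedyTasaki L ψ (upd2 σ x y s t) =
        ε * (-1) ^ occ s * ψ (upd2 τ x y (Fin.rev^[n] s) (Fin.rev^[n + occ s] t)) := by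
  have hne : x ≠ y := by rintro rfl; omega
  let rest : Fin L → ℕ := fun k => ∑ j, if j < k then (if j = x ∨ j = y then 0 else occ (σ j)) else 0
  have hleft : ∀ s t k, leftOcc (upd2 σ x y s t) k
      = rest k + (if x < k then occ s else 0) + (if y < k then occ t else 0) := by
    intro s t k
    have e : ∀ j, (if j < k then occ (upd2 σ x y s t j) else 0)
        = (if j < k then (if j = x ∨ j = y then 0 else occ (σ j)) else 0)
          + (if j = x then (if x < k then occ s else 0) else 0)
          + (if j = y then (if y < k then occ t else 0) else 0) := by
      intro j
      by_cases hx : j = x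
      · subst hx; simp [upd2_left hne, hne]
      by_cases hy : j = y
      · subst hy; simp [Ne.symm hne]
      · simp [upd2_of_ne hx hy, hx, hy]
    simp only [leftOcc, e, Finset.sum_add_distrib, Finset.sum_ite_eq', Finset.mem_univ, if_true, rest]
  -- The number of sites to the right of `y`: each of them sees both spins of the pair, while `y`
  -- itself sees only the spin at `x`.
  let c : ℕ := ∑ k, if y < k then 1 else 0
  have htot : ∀ s t, ∑ k, leftOcc (upd2 σ x y s t) k
      = ∑ k, rest k + occ s + c * (occ s + occ t) := by
    intro s t
    have e : ∀ k : Fin L, (if x < k then occ s else 0)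
        = (if k = y then occ s else 0) + (if y < k then 1 else 0) * occ s := by
      intro k
      by_cases h1 : y < k
      · have : x < k := by rw [Fin.lt_def] at *; omega
        simp [h1, h1.ne', this]
      · by_cases h2 : k = y
        · subst h2
          have : x < k := by rw [Fin.lt_def]; omega
          simp [this]
        · have : ¬ x < k := by
            intro h
            rw [Fin.lt_def] at h h1
            exact h2 (Fin.ext (by omega))
          simp [h1, h2, this]
    have e' : ∀ k : Fin L, (if y < k then occ t else 0) = (if y < k then 1 else 0) * occ t := by
      intro k; split_ifs <;> simp
    simp only [hleft, e, e', Finset.sum_add_distrib, Finset.sum_ite_eq', Finset.mem_univ, if_true,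
      ← Finset.sum_mul, c]
    ring
  have hrest : rest y = rest x := by
    simp only [rest]
    refine Finset.sum_congr rfl fun j _ => ?_
    by_cases hx : j = x
    · simp [hx]
    · have : j < y ↔ j < x := by
        rw [Fin.lt_def, Fin.lt_def]
        have : (j : ℕ) ≠ x := fun h => hx (Fin.ext h)
        omega
      simp [this]
  -- With the parity of `occ s + occ t` fixed, the flips outside the pair do not depend on `s, t`.
  -- What remains is the sign and the flip at `y` caused by the spin at `x`, and a common flip `n`
  -- caused by the spins further left.
  refine ⟨(-1) ^ (∑ k, rest k + c * q),
    fun k => Fin.rev^[rest k + if y < k then q else 0] (σ k), rest x % 2, Nat.mod_lt _ two_pos, ?_⟩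
  intro s t hst ψ
  rw [kennedyTasaki_apply, htot]
  congr 1
  · rw [mul_comm c q, mul_comm c, pow_add, pow_add, pow_add, pow_mul, pow_mul, neg_one_pow_eq_pow_mod_two (n := occ s + occ t),
      hst, ← neg_one_pow_eq_pow_mod_two]
    ring
  · refine congrArg ψ.ofLp (funext fun k => ?_)
    by_cases hx : k = x
    · subst hx
      rw [upd2_left hne, upd2_left hne, hleft, ← rev_iterate_mod_two]
      have : ¬ y < k := by rw [Fin.lt_def]; omega
      simp [this]
    by_cases hy : k = y
    · subst hy
      have : x < k := by rw [Fin.lt_def]; omega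
      rw [upd2_right, upd2_right, hleft, hrest, rev_iterate_mod_two, rev_iterate_mod_two (_ + _)]
      simp [this]
    · rw [upd2_of_ne hx hy, upd2_of_ne hx hy, hleft]
      have : x < k ↔ y < k := by
        rw [Fin.lt_def, Fin.lt_def]
        have : (k : ℕ) ≠ y := fun h => hy (Fin.ext h)
        omega
      rw [rev_iterate_mod_two, rev_iterate_mod_two (rest k + _)]
      by_cases hk : y < k
      · simp only [this, hk, if_true]
        have h2 : (rest k + occ s + occ t) % 2 = (rest k + q) % 2 := by omega
        rw [h2]
      · simp [this, hk]

/-- The equations for the transformed ground states at the bond `x, y`. -/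
def StringCond {L : ℕ} (x y : Fin L) (χ : Chain L) : Prop :=
  ∀ σ, χ (upd2 σ x y 0 2) = 0 ∧ χ (upd2 σ x y 2 0) = 0 ∧
    χ (upd2 σ x y 0 1) = χ (upd2 σ x y 1 0) ∧ χ (upd2 σ x y 2 1) = χ (upd2 σ x y 1 2) ∧
    χ (upd2 σ x y 0 0) + χ (upd2 σ x y 2 2) = 2 * χ (upd2 σ x y 1 1)

/-- None of the five equations mixes pairs of even and odd occupation. In each class the
transformation changes the pair only by signs and flips, so the equations can be carried over
separately. -/
lemma stringCond_kennedyTasaki {L : ℕ} {x y : Fin L} (hxy : (y : ℕ) = x + 1) {ψ : Chain L}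
    (h : bond x y ψ = 0) : StringCond x y (kennedyTasaki L ψ) := by
  have hne : x ≠ y := by rintro rfl; omega
  rw [bond_eq_zero_iff' hne] at h
  intro σ
  obtain ⟨ε, τ, n, hn, he⟩ := kennedyTasaki_upd2 hxy σ 0
  obtain ⟨ε', τ', n', hn', ho⟩ := kennedyTasaki_upd2 hxy σ 1
  rw [he 0 2 (by decide), he 2 0 (by decide), he 0 0 (by decide), he 2 2 (by decide),
    he 1 1 (by decide), ho 0 1 (by decide), ho 1 0 (by decide), ho 2 1 (by decide),
    ho 1 2 (by decide)]
  obtain ⟨h1, h2, -, -, h5⟩ := h τ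
  obtain ⟨-, -, h3, h4, -⟩ := h τ'
  interval_cases n <;> interval_cases n' <;> simp [occ, Fin.rev, h1, h2] <;>
    refine ⟨?_, ?_, ?_⟩
  all_goals first
    | linear_combination (-ε') * h3
    | linear_combination (-ε') * h4
    | linear_combination (-ε) * h5

lemma bond_kennedyTasaki {L : ℕ} {x y : Fin L} (hxy : (y : ℕ) = x + 1) {χ : Chain L}
    (h : StringCond x y χ) : bond x y (kennedyTasaki L χ) = 0 := by
  have hne : x ≠ y := by rintro rfl; omega
  rw [bond_eq_zero_iff' hne]
  intro σ
  obtain ⟨ε, τ, n, hn, he⟩ := kennedyTasaki_upd2 hxy σ 0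
  obtain ⟨ε', τ', n', hn', ho⟩ := kennedyTasaki_upd2 hxy σ 1
  rw [he 0 2 (by decide), he 2 0 (by decide), he 0 0 (by decide), he 2 2 (by decide),
    he 1 1 (by decide), ho 0 1 (by decide), ho 1 0 (by decide), ho 2 1 (by decide),
    ho 1 2 (by decide)]
  obtain ⟨h1, h2, -, -, h5⟩ := h τ
  obtain ⟨-, -, h3, h4, -⟩ := h τ'
  interval_cases n <;> interval_cases n' <;> simp [occ, Fin.rev, h1, h2] <;>
    refine ⟨?_, ?_, ?_⟩
  all_goals first
    | linear_combination (-ε') * h3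
    | linear_combination (-ε') * h4
    | linear_combination (-ε) * h5

/-- The image of the ground state space under the Kennedy–Tasaki transformation. -/
def stringSpace (L a b : ℕ) : Submodule ℂ (Chain L) :=
  (groundSpace L a b).map (kennedyTasaki L : Chain L →ₗ[ℂ] Chain L)

lemma mem_stringSpace_iff_kennedyTasaki {L a b : ℕ} {χ : Chain L} :
    χ ∈ stringSpace L a b ↔ kennedyTasaki L χ ∈ groundSpace L a b := by
  constructor
  · rintro ⟨ψ, hψ, rfl⟩
    simpa [kennedyTasaki_apply_self] using hψ
  · intro h
    exact ⟨_, h, kennedyTasaki_apply_self χ⟩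

lemma mem_stringSpace_iff {L a b : ℕ} {χ : Chain L} :
    χ ∈ stringSpace L a b ↔ ∀ x y : Fin L, a ≤ (x : ℕ) → (y : ℕ) = x + 1 → (y : ℕ) ≤ b →
      StringCond x y χ := by
  rw [mem_stringSpace_iff_kennedyTasaki, mem_groundSpace_iff]
  refine forall_congr' fun x => forall_congr' fun y => forall_congr' fun ha =>
    forall_congr' fun hxy => forall_congr' fun hb => ⟨fun h => ?_, fun h => ?_⟩
  · rw [← kennedyTasaki_apply_self χ]
    exact stringCond_kennedyTasaki hxy h
  · exact bond_kennedyTasaki hxy h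

end AKLT

end

/-! ### The transformed ground states are spanned by product states. -/

noncomputable section

namespace AKLT

open Complex

/-- The product vector with one-site factors `f x`. -/
def prodVec {L : ℕ} (f : Fin L → Fin 3 → ℂ) : Chain L :=
  WithLp.toLp 2 fun σ => ∏ x, f x (σ x)

lemma prodVec_apply {L : ℕ} (f : Fin L → Fin 3 → ℂ) (σ : Fin L → Fin 3) :
    prodVec f σ = ∏ x, f x (σ x) := rfl

/-- The inner product of one-site vectors. -/
def siteInner (u v : Fin 3 → ℂ) : ℂ := ∑ s, (starRingEnd ℂ) (u s) * v s

lemma inner_prodVec {L : ℕ} (f g : Fin L → Fin 3 → ℂ) :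
    inner ℂ (prodVec f) (prodVec g) = ∏ x, siteInner (f x) (g x) := by
  simp only [PiLp.inner_apply, RCLike.inner_apply, prodVec_apply, map_prod, ← Finset.prod_mul_distrib,
    siteInner]
  rw [Fintype.prod_sum (fun x s => (starRingEnd ℂ) (f x s) * g x s)]
  refine Finset.sum_congr rfl fun σ _ => Finset.prod_congr rfl fun x _ => mul_comm _ _

/-- The sites of the interval `[a, b]`. -/
def sites (L a b : ℕ) : Finset (Fin L) := Finset.univ.filter fun x => a ≤ (x : ℕ) ∧ (x : ℕ) ≤ b

lemma mem_sites {L a b : ℕ} {x : Fin L} : x ∈ sites L a b ↔ a ≤ (x : ℕ) ∧ (x : ℕ) ≤ b := by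
  simp [sites]

lemma sqrt_two_sq : ((Real.sqrt 2 : ℝ) : ℂ) * ((Real.sqrt 2 : ℝ) : ℂ) = 2 := by
  rw [← Complex.ofReal_mul, Real.mul_self_sqrt (by norm_num)]
  norm_num

lemma sqrt_three_sq : ((Real.sqrt 3 : ℝ) : ℂ) * ((Real.sqrt 3 : ℝ) : ℂ) = 3 := by
  rw [← Complex.ofReal_mul, Real.mul_self_sqrt (by norm_num)]
  norm_num

lemma sqrt_two_ne : ((Real.sqrt 2 : ℝ) : ℂ) ≠ 0 := by
  intro h
  have := sqrt_two_sq
  rw [h] at this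
  norm_num at this

lemma sqrt_three_ne : ((Real.sqrt 3 : ℝ) : ℂ) ≠ 0 := by
  intro h
  have := sqrt_three_sq
  rw [h] at this
  norm_num at this

/-- The equations for two-site transformed ground states. -/
def PairCond (F : Fin 3 → Fin 3 → ℂ) : Prop :=
  F 0 2 = 0 ∧ F 2 0 = 0 ∧ F 0 1 = F 1 0 ∧ F 2 1 = F 1 2 ∧ F 0 0 + F 2 2 = 2 * F 1 1

lemma pairCond_phi (i : Fin 4) : PairCond fun s t => phi i s * phi i t := by
  have h2 := sqrt_two_sq
  have h3 := sqrt_three_ne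
  fin_cases i <;> simp [PairCond, phi, div_mul_div_comm, h2] <;> ring_nf <;> simp

lemma PairCond.smul {F : Fin 3 → Fin 3 → ℂ} (h : PairCond F) (c : ℂ) :
    PairCond fun s t => c * F s t := by
  obtain ⟨h1, h2, h3, h4, h5⟩ := h
  refine ⟨?_, ?_, ?_, ?_, ?_⟩ <;> simp only [h1, h2, h3, h4, mul_zero]
  linear_combination c * h5

/-- A two-site transformed ground state is a combination of the four product states. -/
lemma PairCond.eq_sum {F : Fin 3 → Fin 3 → ℂ} (h : PairCond F) (s t : Fin 3) :
    F s t = ∑ i, (![3 / 4 * F 0 0 + 3 / 2 / (Real.sqrt 2 : ℂ) * F 0 1,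
      3 / 4 * F 0 0 - 3 / 2 / (Real.sqrt 2 : ℂ) * F 0 1,
      3 / 4 * F 2 2 + 3 / 2 / (Real.sqrt 2 : ℂ) * F 2 1,
      3 / 4 * F 2 2 - 3 / 2 / (Real.sqrt 2 : ℂ) * F 2 1] i) * (phi i s * phi i t) := by
  obtain ⟨h1, h2, h3, h4, h5⟩ := h
  have e2 := sqrt_two_sq
  have e3 := sqrt_three_sq
  have n2 := sqrt_two_ne
  have n3 := sqrt_three_ne
  have h6 : F 1 1 = (F 0 0 + F 2 2) / 2 := by rw [h5]; ring
  fin_cases s <;> fin_cases t <;>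
    simp [Fin.sum_univ_four, phi, div_mul_div_comm, e2, e3, h1, h2, ← h3, ← h4, h6] <;>
    field_simp <;> ring_nf

lemma phi_one (i : Fin 4) : phi i 1 = 1 / (Real.sqrt 3 : ℂ) := by
  fin_cases i <;> simp [phi]

/-- Appending a site to an interval whose first spin is `+`. -/
lemma PairCond.append_plus {c : Fin 4 → Fin 3 → ℂ}
    (h : PairCond fun t s => ∑ i, c i s * (phi i 0 * phi i t)) (s : Fin 3) :
    c 0 s = (Real.sqrt 3 : ℂ) * c 0 1 * phi 0 s ∧ c 1 s = (Real.sqrt 3 : ℂ) * c 1 1 * phi 1 s := by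
  obtain ⟨h1, h2, h3, h4, h5⟩ := h
  have e2 := sqrt_two_sq
  have e3 := sqrt_three_sq
  have n2 := sqrt_two_ne
  have n3 := sqrt_three_ne
  simp [Fin.sum_univ_four, phi, div_mul_div_comm, e2, e3] at h1 h2 h3 h4 h5
  set r : ℂ := ((Real.sqrt 2 : ℝ) : ℂ) with hr
  have k1 : c 0 2 = 0 := by
    have : r * c 0 2 = 0 := by linear_combination (3 * r / 4) * h1 - (3 / 2) * h4
    exact (mul_eq_zero.1 this).resolve_left n2
  have k2 : c 1 2 = 0 := by linear_combination (3 / 2) * h1 - k1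
  have k3 : c 0 0 = r * c 0 1 := by
    have : r * (c 0 0 - r * c 0 1) = 0 := by
      linear_combination (3 * r / 4) * h5 - (3 / 2) * h3 - (1 / 2) * (c 0 1 + c 1 1) * e2
    have := (mul_eq_zero.1 this).resolve_left n2
    linear_combination this
  have k4 : c 1 0 = -r * c 1 1 := by
    have : r * (c 1 0 + r * c 1 1) = 0 := by
      linear_combination (3 * r / 4) * h5 + (3 / 2) * h3 + (1 / 2) * (c 0 1 + c 1 1) * e2
    have := (mul_eq_zero.1 this).resolve_left n2
    linear_combination this
  fin_cases s <;> simp [phi, k1, k2, k3, k4, ← hr] <;> constructor <;> field_simp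

/-- Appending a site to an interval whose first spin is `-`. -/
lemma PairCond.append_minus {c : Fin 4 → Fin 3 → ℂ}
    (h : PairCond fun t s => ∑ i, c i s * (phi i 2 * phi i t)) (s : Fin 3) :
    c 2 s = (Real.sqrt 3 : ℂ) * c 2 1 * phi 2 s ∧ c 3 s = (Real.sqrt 3 : ℂ) * c 3 1 * phi 3 s := by
  obtain ⟨h1, h2, h3, h4, h5⟩ := h
  have e2 := sqrt_two_sq
  have e3 := sqrt_three_sq
  have n2 := sqrt_two_ne
  have n3 := sqrt_three_ne
  simp [Fin.sum_univ_four, phi, div_mul_div_comm, e2, e3] at h1 h2 h3 h4 h5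
  set r : ℂ := ((Real.sqrt 2 : ℝ) : ℂ) with hr
  have k1 : c 2 0 = 0 := by
    have : r * c 2 0 = 0 := by linear_combination (3 * r / 4) * h2 - (3 / 2) * h3
    exact (mul_eq_zero.1 this).resolve_left n2
  have k2 : c 3 0 = 0 := by linear_combination (3 / 2) * h2 - k1
  have k3 : c 2 2 = r * c 2 1 := by
    have : r * (c 2 2 - r * c 2 1) = 0 := by
      linear_combination (3 * r / 4) * h5 - (3 / 2) * h4 - (1 / 2) * (c 2 1 + c 3 1) * e2
    have := (mul_eq_zero.1 this).resolve_left n2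
    linear_combination this
  have k4 : c 3 2 = -r * c 3 1 := by
    have : r * (c 3 2 + r * c 3 1) = 0 := by
      linear_combination (3 * r / 4) * h5 + (3 / 2) * h4 + (1 / 2) * (c 2 1 + c 3 1) * e2
    have := (mul_eq_zero.1 this).resolve_left n2
    linear_combination this
  fin_cases s <;> simp [phi, k1, k2, k3, k4, ← hr] <;> constructor <;> field_simp

lemma upd2_congr {L : ℕ} {x y : Fin L} {σ σ' : Fin L → Fin 3}
    (h : ∀ z, z ≠ x → z ≠ y → σ z = σ' z) (s t : Fin 3) : upd2 σ x y s t = upd2 σ' x y s t := by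
  ext z
  simp only [upd2, Function.update_apply]
  split_ifs with h1 h2
  · rfl
  · rfl
  · rw [h z h2 h1]

lemma stringSpace_mono {L a b b' : ℕ} (h : b ≤ b') : stringSpace L a b' ≤ stringSpace L a b := by
  intro χ hχ
  rw [mem_stringSpace_iff] at hχ ⊢
  exact fun x y ha hxy hb => hχ x y ha hxy (hb.trans h)

/-- Transformed ground states of the interval `[a, a + 1 + k]` are combinations of the four product
states of the interval, with coefficients that depend on the other sites. -/
lemma exists_coeff_of_mem_stringSpace {L a : ℕ} (k : ℕ) (hL : a + 1 + k < L) {χ : Chain L}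
    (hχ : χ ∈ stringSpace L a (a + 1 + k)) :
    ∃ g : Fin 4 → (Fin L → Fin 3) → ℂ,
      (∀ i σ σ', (∀ x, x ∉ sites L a (a + 1 + k) → σ x = σ' x) → g i σ = g i σ') ∧
      ∀ σ, χ σ = ∑ i, g i σ * ∏ x ∈ sites L a (a + 1 + k), phi i (σ x) := by
  induction k with
  | zero =>
    let x : Fin L := ⟨a, by omega⟩
    let y : Fin L := ⟨a + 1, by omega⟩
    have hne : x ≠ y := by simp [x, y]
    have hsites : sites L a (a + 1 + 0) = {x, y} := by
      ext z
      simp only [mem_sites, Finset.mem_insert, Finset.mem_singleton, x, y, Fin.ext_iff]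
      omega
    have hc : ∀ σ, PairCond fun s t => χ (upd2 σ x y s t) :=
      (mem_stringSpace_iff.1 hχ x y le_rfl rfl le_rfl)
    refine ⟨fun i σ => ![3 / 4 * χ (upd2 σ x y 0 0) + 3 / 2 / (Real.sqrt 2 : ℂ) * χ (upd2 σ x y 0 1),
      3 / 4 * χ (upd2 σ x y 0 0) - 3 / 2 / (Real.sqrt 2 : ℂ) * χ (upd2 σ x y 0 1),
      3 / 4 * χ (upd2 σ x y 2 2) + 3 / 2 / (Real.sqrt 2 : ℂ) * χ (upd2 σ x y 2 1),
      3 / 4 * χ (upd2 σ x y 2 2) - 3 / 2 / (Real.sqrt 2 : ℂ) * χ (upd2 σ x y 2 1)] i, ?_, ?_⟩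
    · intro i σ σ' h
      have : ∀ s t, upd2 σ x y s t = upd2 σ' x y s t :=
        upd2_congr fun z hzx hzy => h z (by rw [hsites]; simp [hzx, hzy])
      simp only [this]
    · intro σ
      have := (hc σ).eq_sum (σ x) (σ y)
      rw [upd2_self hne] at this
      rw [this, hsites]
      simp only [Finset.prod_pair hne]
  | succ k ih =>
    obtain ⟨g, hg, hgχ⟩ := ih (by omega) (stringSpace_mono (by omega) hχ)
    set I := sites L a (a + 1 + k) with hI
    -- `x` and `y` are the first and the last site of the interval already treated, which are
    -- distinct since it has at least two sites; `z` is the site to be appended.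
    let x : Fin L := ⟨a, by omega⟩
    let y : Fin L := ⟨a + 1 + k, by omega⟩
    let z : Fin L := ⟨a + 1 + (k + 1), hL⟩
    have hxy : x ≠ y := by simp [x, y, Fin.ext_iff]; omega
    have hyz : y ≠ z := by simp [z, y, Fin.ext_iff]
    have hxI : x ∈ I := by simp [hI, mem_sites, x]; omega
    have hyI : y ∈ I := by simp [hI, mem_sites, y]; omega
    have hzI : z ∉ I := by simp [hI, mem_sites, z]
    have hsites : sites L a (a + 1 + (k + 1)) = insert z I := by
      ext w
      simp only [mem_sites, Finset.mem_insert, hI, z, Fin.ext_iff]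
      omega
    have hcond := mem_stringSpace_iff.1 hχ y z (by simp [y]; omega) rfl le_rfl
    have hxIy : x ∈ I.erase y := Finset.mem_erase.2 ⟨hxy, hxI⟩
    let κ : ℂ := ∏ w ∈ (I.erase y).erase x, (1 / (Real.sqrt 3 : ℂ))
    have hκ : κ ≠ 0 := by
      simp only [κ, Finset.prod_const]
      exact pow_ne_zero _ (one_div_ne_zero sqrt_three_ne)
    have key : ∀ (v : Fin 3) (σ : Fin L → Fin 3), PairCond fun t s =>
        ∑ i, g i (Function.update σ z s) * (phi i v * phi i t) := by
      intro v σ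
      -- All four `φ_i` have the component `1/√3` along `|0⟩`, so spins 0 inside the interval
      -- contribute only the common nonzero factor `κ`. The first spin `v` serves to separate the
      -- two pairs of states.
      let ρ : Fin L → Fin 3 := fun w => if w ∈ I then (if w = x then v else 1) else σ w
      have e : ∀ t s, χ (upd2 ρ y z t s)
          = κ * ∑ i, g i (Function.update σ z s) * (phi i v * phi i t) := by
        intro t s
        rw [hgχ, Finset.mul_sum]
        refine Finset.sum_congr rfl fun i _ => ?_
        have e1 : g i (upd2 ρ y z t s) = g i (Function.update σ z s) := by
          refine hg i _ _ fun w hw => ?_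
          have hwy : w ≠ y := by rintro rfl; exact hw hyI
          by_cases hwz : w = z
          · subst hwz; simp
          · simp [upd2_of_ne hwy hwz, ρ, hw, hwz]
        have e2 : ∏ w ∈ I, phi i (upd2 ρ y z t s w) = phi i t * (phi i v * κ) := by
          rw [← Finset.mul_prod_erase I _ hyI, ← Finset.mul_prod_erase _ _ hxIy]
          congr 1
          · rw [upd2_left hyz]
          congr 1
          · have hxz : x ≠ z := fun h => hzI (h ▸ hxI)
            rw [upd2_of_ne hxy hxz]
            simp [ρ, hxI]
          · refine Finset.prod_congr rfl fun w hw => ?_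
            simp only [Finset.mem_erase] at hw
            have hwz : w ≠ z := fun h => hzI (h ▸ hw.2.2)
            rw [upd2_of_ne hw.2.1 hwz, ← phi_one i]
            simp [ρ, hw.2.2, hw.1]
        rw [e1, e2]
        ring
      have h := PairCond.smul (F := fun t s => χ (upd2 ρ y z t s)) (hcond ρ) κ⁻¹
      simpa only [e, inv_mul_cancel_left₀ hκ] using h
    -- A first spin `+` eliminates `φ_3, φ_4`, a first spin `-` eliminates `φ_1, φ_2`. The equations
    -- at `y, z` for the remaining two states force the dependence of `g i` on the spin at `z` to be
    -- proportional to `φ_i`.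
    have hstep : ∀ i σ, g i σ
        = (Real.sqrt 3 : ℂ) * g i (Function.update σ z 1) * phi i (σ z) := by
      intro i σ
      have hp := (key 0 σ).append_plus (σ z)
      have hm := (key 2 σ).append_minus (σ z)
      simp only [Function.update_eq_self] at hp hm
      fin_cases i
      · exact hp.1
      · exact hp.2
      · exact hm.1
      · exact hm.2
    refine ⟨fun i σ => (Real.sqrt 3 : ℂ) * g i (Function.update σ z 1), ?_, ?_⟩
    · intro i σ σ' h
      show _ * _ = _ * _
      congr 1
      refine hg i _ _ fun w hw => ?_
      by_cases hwz : w = z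
      · subst hwz; simp
      · simp only [Function.update_of_ne hwz]
        exact h w (by rw [hsites]; simp [hwz, hw])
    · intro σ
      rw [hgχ, hsites]
      refine Finset.sum_congr rfl fun i _ => ?_
      rw [Finset.prod_insert hzI, hstep i σ]
      ring

lemma stringCond_prodVec {L : ℕ} {x y : Fin L} (hxy : x ≠ y) {f : Fin L → Fin 3 → ℂ} {i : Fin 4}
    (hx : f x = phi i) (hy : f y = phi i) : StringCond x y (prodVec f) := by
  intro σ
  have e : ∀ s t, prodVec f (upd2 σ x y s t)
      = (∏ w ∈ (Finset.univ.erase x).erase y, f w (σ w)) * (phi i s * phi i t) := by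
    intro s t
    rw [prodVec_apply, ← Finset.mul_prod_erase _ _ (Finset.mem_univ x),
      ← Finset.mul_prod_erase (Finset.univ.erase x) _
        (Finset.mem_erase.2 ⟨Ne.symm hxy, Finset.mem_univ y⟩), upd2_left hxy, upd2_right, hx, hy]
    rw [Finset.prod_congr rfl (g := fun w => f w (σ w))]
    · ring
    · intro w hw
      simp only [Finset.mem_erase] at hw
      rw [upd2_of_ne hw.2.1 hw.1]
  have h := (pairCond_phi i).smul (∏ w ∈ (Finset.univ.erase x).erase y, f w (σ w))
  simp only [e]
  exact h

/-- Expanding the coefficients from `exists_coeff_of_mem_stringSpace` in basis vectors of the sites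
outside the interval leaves only product vectors. -/
lemma stringSpace_eq_span {L a b : ℕ} (hab : a < b) (hb : b < L) :
    stringSpace L a b = Submodule.span ℂ
      {v | ∃ (i : Fin 4) (f : Fin L → Fin 3 → ℂ), (∀ x ∈ sites L a b, f x = phi i) ∧
        v = prodVec f} := by
  refine le_antisymm ?_ (Submodule.span_le.2 ?_)
  · intro χ hχ
    obtain ⟨k, rfl⟩ := Nat.exists_eq_add_of_le (Nat.succ_le_of_lt hab)
    obtain ⟨g, hg, hgχ⟩ := exists_coeff_of_mem_stringSpace k hb hχ
    set I := sites L a (a + 1 + k) with hI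
    -- Basis vectors `τ x` outside the interval. Configurations of the outside are represented by
    -- the `τ` that are 0 on the interval, so that each is counted once.
    let f : Fin 4 → (Fin L → Fin 3) → Fin L → Fin 3 → ℂ := fun i τ x =>
      if x ∈ I then phi i else fun s => if s = τ x then 1 else 0
    have hχ' : χ = ∑ i, ∑ τ : Fin L → Fin 3,
        (if ∀ x ∈ I, τ x = 0 then g i τ else 0) • prodVec (f i τ) := by
      ext σ
      rw [hgχ]
      simp only [WithLp.ofLp_sum, Finset.sum_apply, PiLp.smul_apply, smul_eq_mul]
      refine Finset.sum_congr rfl fun i _ => ?_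
      rw [Finset.sum_eq_single (fun x => if x ∈ I then 0 else σ x)]
      · rw [if_pos (by intro x hx; simp [hx])]
        congr 1
        · exact hg i _ _ fun x hx => by simp [hx]
        · rw [prodVec_apply, ← Finset.prod_subset (Finset.subset_univ I)]
          · refine Finset.prod_congr rfl fun x hx => ?_
            simp [f, hx]
          · intro x _ hx
            simp [f, hx]
      · intro τ _ hτ
        split_ifs with h
        · have : ∃ x, x ∉ I ∧ σ x ≠ τ x := by
            by_contra hcon
            push Not at hcon
            refine hτ (funext fun x => ?_)
            by_cases hx : x ∈ I
            · simp [hx, h x hx]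
            · simp [hx, hcon x hx]
          obtain ⟨x, hx, hne⟩ := this
          rw [prodVec_apply, Finset.prod_eq_zero (Finset.mem_univ x), mul_zero]
          simp [f, hx, hne]
        · simp
      · simp
    rw [hχ']
    refine Submodule.sum_mem _ fun i _ => Submodule.sum_mem _ fun τ _ =>
      Submodule.smul_mem _ _ (Submodule.subset_span ⟨i, f i τ, fun x hx => ?_, rfl⟩)
    simp [f, hx]
  · rintro _ ⟨i, f, hf, rfl⟩
    rw [SetLike.mem_coe, mem_stringSpace_iff]
    intro x y hx hxy hy
    refine stringCond_prodVec (by rintro rfl; omega) (hf x ?_) (hf y ?_) <;> rw [mem_sites] <;> omega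

end AKLT

end

/-! ### Gram matrices and the projection of product vectors. -/

noncomputable section

namespace AKLT

open Complex

/-- The sign of the four product states under the change of `(-1/3)` into `1/3`. -/
def phiSign : Fin 4 → ℂ := ![1, 1, -1, -1]

lemma phiSign_mul_self (i : Fin 4) : phiSign i * phiSign i = 1 := by
  fin_cases i <;> simp [phiSign]

/-- The overlap is `-1/3` within the pairs `φ_{1,2}` and `φ_{3,4}` and `1/3` between them. Splitting
off the signs makes all off-diagonal entries equal, hence the Gram matrix symmetric under all
permutations. -/
lemma siteInner_phi (i j : Fin 4) : siteInner (phi i) (phi j)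
    = phiSign i * phiSign j * (if i = j then 1 else -1 / 3) := by
  have e2 := sqrt_two_sq
  have e3 := sqrt_three_sq
  have n3 := sqrt_three_ne
  fin_cases i <;> fin_cases j <;>
    simp [siteInner, phi, phiSign, Fin.sum_univ_three, Complex.conj_ofReal, div_mul_div_comm, e2, e3] <;>
    norm_num

lemma Phi_eq_prodVec (N : ℕ) (i : Fin 4) : Phi N i = prodVec fun _ => phi i := rfl

lemma M_apply (N : ℕ) (i j : Fin 4) : M N i j = siteInner (phi i) (phi j) ^ N := by
  simp [M, Phi_eq_prodVec, inner_prodVec]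

/-- The Gram matrix up to signs. -/
def gram (x : ℂ) : Matrix (Fin 4) (Fin 4) ℂ := Matrix.of fun i j => if i = j then 1 else x

/-- Its inverse. -/
def gramInv (x : ℂ) : Matrix (Fin 4) (Fin 4) ℂ :=
  Matrix.of fun i j => ((if i = j then 1 else 0) - x / (1 + 3 * x)) / (1 - x)

lemma M_eq_gram (N : ℕ) (i j : Fin 4) :
    M N i j = (phiSign i * phiSign j) ^ N * gram ((-1 / 3) ^ N) i j := by
  rw [M_apply, siteInner_phi, mul_pow]
  congr 1
  by_cases h : i = j <;> simp [gram, h]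

/-- The matrix is `(1 - x) 1 + x J` with `J` the all-ones matrix and `J² = 4 J`; its eigenvalues are
`1 - x` and `1 + 3x`. -/
lemma gram_mul_gramInv {x : ℂ} (h1 : 1 - x ≠ 0) (h3 : 1 + 3 * x ≠ 0) : gram x * gramInv x = 1 := by
  have hu : x / (1 + 3 * x) * (1 + 3 * x) = x := div_mul_cancel₀ _ h3
  ext i j
  simp only [Matrix.mul_apply, gram, gramInv, Fin.sum_univ_four, Matrix.of_apply]
  generalize x / (1 + 3 * x) = u at hu
  fin_cases i <;> fin_cases j <;> simp <;> field_simp <;> linear_combination -hu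

/-- For `N = 1` the second expression is zero, as it must be for four vectors in `ℂ³`. -/
lemma pow_neg_third_ne {N : ℕ} (hN : 2 ≤ N) :
    (1 - (-1 / 3 : ℂ) ^ N ≠ 0) ∧ (1 + 3 * (-1 / 3 : ℂ) ^ N ≠ 0) := by
  have h : |(-1 / 3 : ℝ) ^ N| ≤ 1 / 9 := by
    rw [abs_pow]
    calc |(-1 / 3 : ℝ)| ^ N ≤ |(-1 / 3 : ℝ)| ^ 2 :=
          pow_le_pow_of_le_one (by positivity) (by norm_num [abs_of_neg]) hN
      _ = 1 / 9 := by norm_num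
  rw [abs_le] at h
  constructor
  · intro h0
    have : (1 - (-1 / 3 : ℝ) ^ N) = 0 := by exact_mod_cast h0
    linarith
  · intro h0
    have : (1 + 3 * (-1 / 3 : ℝ) ^ N) = 0 := by exact_mod_cast h0
    linarith

/-- The inverse Gram matrix, written with signs. -/
lemma M_mul_eq_one {N : ℕ} (hN : 2 ≤ N) :
    M N * Matrix.of (fun i j => (phiSign i * phiSign j) ^ N * gramInv ((-1 / 3) ^ N) i j) = 1 := by
  obtain ⟨h1, h3⟩ := pow_neg_third_ne hN
  ext i j
  have h := congrFun (congrFun (gram_mul_gramInv h1 h3) i) j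
  rw [Matrix.mul_apply] at h ⊢
  simp only [M_eq_gram, Matrix.of_apply]
  have e : ∀ k, (phiSign i * phiSign k) ^ N * gram ((-1 / 3) ^ N) i k *
      ((phiSign k * phiSign j) ^ N * gramInv ((-1 / 3) ^ N) k j)
      = (phiSign i * phiSign j) ^ N * (gram ((-1 / 3) ^ N) i k * gramInv ((-1 / 3) ^ N) k j) := by
    intro k
    have : (phiSign i * phiSign k) ^ N * (phiSign k * phiSign j) ^ N
        = (phiSign i * phiSign j) ^ N := by
      rw [← mul_pow]
      congr 1
      linear_combination (phiSign i * phiSign j) * phiSign_mul_self k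
    linear_combination (gram ((-1 / 3) ^ N) i k * gramInv ((-1 / 3) ^ N) k j) * this
  simp only [e, ← Finset.mul_sum]
  rw [h]
  by_cases hij : i = j
  · subst hij
    simp [phiSign_mul_self]
  · simp [hij]

lemma W_apply {N : ℕ} (hN : 2 ≤ N) (i j : Fin 4) :
    W N i j = (phiSign i * phiSign j) ^ N * gramInv ((-1 / 3) ^ N) i j := by
  rw [W, Matrix.inv_eq_right_inv (M_mul_eq_one hN)]
  rfl

lemma M_mul_W {N : ℕ} (hN : 2 ≤ N) : M N * W N = 1 := by
  rw [W, Matrix.inv_eq_right_inv (M_mul_eq_one hN), M_mul_eq_one hN]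

lemma W_mul_M {N : ℕ} (hN : 2 ≤ N) : W N * M N = 1 :=
  mul_eq_one_comm.1 (M_mul_W hN)

lemma eq_zero_of_M_mulVec {N : ℕ} (hN : 2 ≤ N) {c : Fin 4 → ℂ}
    (h : ∀ i, ∑ j, M N i j * c j = 0) : c = 0 := by
  have h' : (M N).mulVec c = 0 := funext h
  rw [← Matrix.one_mulVec c, ← W_mul_M hN, ← Matrix.mulVec_mulVec, h', Matrix.mulVec_zero]

lemma linearIndependent_Phi {N : ℕ} (hN : 2 ≤ N) : LinearIndependent ℂ (Phi N) := by
  rw [Fintype.linearIndependent_iff]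
  intro c hc
  refine congrFun (eq_zero_of_M_mulVec hN fun i => ?_)
  have := congrArg (inner ℂ (Phi N i)) hc
  rw [inner_zero_right, inner_sum] at this
  rw [← this]
  refine Finset.sum_congr rfl fun j _ => ?_
  rw [inner_smul_right, mul_comm]
  rfl

lemma stringSpace_full {N : ℕ} (hN : 2 ≤ N) :
    stringSpace N 0 (N - 1) = Submodule.span ℂ (Set.range (Phi N)) := by
  rw [stringSpace_eq_span (by omega) (by omega)]
  congr 1
  ext v
  constructor
  · rintro ⟨i, f, hf, rfl⟩
    refine ⟨i, ?_⟩
    rw [Phi_eq_prodVec]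
    congr 1
    funext x
    exact (hf x (mem_sites.2 ⟨Nat.zero_le _, by omega⟩)).symm
  · rintro ⟨i, rfl⟩
    exact ⟨i, fun _ => phi i, fun _ _ => rfl, rfl⟩

/-- Replace the factors of a product vector on the interval `[a, b]` by `φ_k`. -/
def fill {L : ℕ} (a b : ℕ) (f : Fin L → Fin 3 → ℂ) (k : Fin 4) : Fin L → Fin 3 → ℂ :=
  fun x => if x ∈ sites L a b then phi k else f x

/-- The orthogonal projection of a product vector onto the transformed ground state space. -/
lemma starProjection_prodVec {L a b : ℕ} (hab : a < b) (hb : b < L) (f : Fin L → Fin 3 → ℂ) :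
    (stringSpace L a b).starProjection (prodVec f)
      = ∑ k, (∑ l, W (sites L a b).card k l * ∏ x ∈ sites L a b, siteInner (phi l) (f x))
        • prodVec (fill a b f k) := by
  have hcard : 2 ≤ (sites L a b).card := by
    have : ({⟨a, by omega⟩, ⟨b, hb⟩} : Finset (Fin L)) ⊆ sites L a b := by
      intro x hx
      simp only [Finset.mem_insert, Finset.mem_singleton] at hx
      rw [mem_sites]
      rcases hx with rfl | rfl <;> simp <;> omega
    calc 2 = ({⟨a, by omega⟩, ⟨b, hb⟩} : Finset (Fin L)).card := by
          rw [Finset.card_pair]; simp [Fin.ext_iff]; omega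
      _ ≤ _ := Finset.card_le_card this
  refine Submodule.eq_starProjection_of_mem_orthogonal ?_ ?_
  · rw [stringSpace_eq_span hab hb]
    refine Submodule.sum_mem _ fun k _ => Submodule.smul_mem _ _ (Submodule.subset_span
      ⟨k, _, fun x hx => ?_, rfl⟩)
    simp [fill, hx]
  · rw [stringSpace_eq_span hab hb, Submodule.mem_orthogonal]
    intro u hu
    induction hu using Submodule.span_induction with
    | zero => simp
    | add u v _ _ hu hv => rw [inner_add_left, hu, hv, add_zero]
    | smul c u _ hu => rw [inner_smul_left, hu, mul_zero]
    | mem u hu =>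
      obtain ⟨i, g, hg, rfl⟩ := hu
      -- The factor of the inner products that comes from the complement of the interval is common
      -- to all terms; on the interval the claim is `M W = 1`.
      set I := sites L a b
      have hsplit : ∀ f : Fin L → Fin 3 → ℂ, inner ℂ (prodVec g) (prodVec f)
          = (∏ x ∈ I, siteInner (phi i) (f x)) * ∏ x ∈ Iᶜ, siteInner (g x) (f x) := by
        intro f
        rw [inner_prodVec, ← Finset.prod_mul_prod_compl I]
        congr 1
        exact Finset.prod_congr rfl fun x hx => by rw [hg x hx]
      have hfill : ∀ k, inner ℂ (prodVec g) (prodVec (fill a b f k))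
          = M I.card i k * ∏ x ∈ Iᶜ, siteInner (g x) (f x) := by
        intro k
        rw [hsplit, M_apply]
        congr 1
        · rw [Finset.prod_congr rfl (g := fun _ => siteInner (phi i) (phi k)), Finset.prod_const]
          intro x hx
          simp only [fill]
          rw [if_pos hx]
        · refine Finset.prod_congr rfl fun x hx => ?_
          simp only [fill]
          rw [if_neg (Finset.mem_compl.1 hx)]
      rw [inner_sub_right, hsplit, inner_sum, sub_eq_zero]
      simp only [inner_smul_right, hfill]
      have hMW : ∀ l, ∑ k, M I.card i k * W I.card k l = if i = l then 1 else 0 := by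
        intro l
        have := congrFun (congrFun (M_mul_W hcard) i) l
        rwa [Matrix.mul_apply, Matrix.one_apply] at this
      calc (∏ x ∈ I, siteInner (phi i) (f x)) * ∏ x ∈ Iᶜ, siteInner (g x) (f x)
          = (∑ l, (∑ k, M I.card i k * W I.card k l) * ∏ x ∈ I, siteInner (phi l) (f x))
            * ∏ x ∈ Iᶜ, siteInner (g x) (f x) := by
            simp [hMW]
        _ = _ := by
            simp only [Fin.sum_univ_four]
            ring

lemma card_sites {L a b : ℕ} (hab : a ≤ b) (hb : b < L) : (sites L a b).card = b - a + 1 := by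
  have : (sites L a b).map Fin.valEmbedding = Finset.Icc a b := by
    ext z
    simp only [Finset.mem_map, mem_sites, Fin.valEmbedding_apply, Finset.mem_Icc]
    constructor
    · rintro ⟨x, hx, rfl⟩; exact hx
    · intro hz; exact ⟨⟨z, by omega⟩, hz, rfl⟩
  rw [← Finset.card_map Fin.valEmbedding, this, Nat.card_Icc]
  omega

lemma kennedyTasaki_groundProj {L a b : ℕ} (ψ : Chain L) :
    kennedyTasaki L (groundProj L a b (kennedyTasaki L ψ))
      = (stringSpace L a b).starProjection ψ := by
  symm
  refine Submodule.eq_starProjection_of_mem_orthogonal ?_ ?_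
  · exact ⟨_, Submodule.starProjection_apply_mem _ _, rfl⟩
  · rw [Submodule.mem_orthogonal]
    rintro _ ⟨u, hu, rfl⟩
    have h : inner ℂ u (kennedyTasaki L ψ - groundProj L a b (kennedyTasaki L ψ)) = 0 :=
      (Submodule.mem_orthogonal _ _).1 (Submodule.sub_starProjection_mem_orthogonal _) u hu
    rw [ContinuousLinearMap.coe_coe, kennedyTasaki_inner, map_sub, kennedyTasaki_apply_self]
    exact h

end AKLT

end

/-! ### The operator `K` on the vectors `Θ_{ij}`. -/

noncomputable section

namespace AKLT

open Complex

lemma kennedyTasaki_K_apply (m n : ℕ) (ψ : Chain (m + n + 1)) :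
    (kennedyTasaki (m + n + 1) * K m n * star (kennedyTasaki (m + n + 1))) ψ
      = (stringSpace (m + n + 1) 0 m).starProjection
        ((stringSpace (m + n + 1) m (m + n)).starProjection
          ((stringSpace (m + n + 1) 0 m).starProjection ψ)) := by
  rw [star_kennedyTasaki]
  simp only [← kennedyTasaki_groundProj, kennedyTasaki_apply_self]
  rfl

/-- The one-site factors of `Θ_{ij}`. -/
def thetaFun (m n : ℕ) (i j : Fin 4) : Fin (m + n + 1) → Fin 3 → ℂ :=
  fun x => if (x : ℕ) ≤ m then phi i else phi j

lemma Theta_eq_prodVec (m n : ℕ) (ij : Fin 4 × Fin 4) :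
    Theta m n ij = prodVec (thetaFun m n ij.1 ij.2) := by
  ext σ
  simp only [Theta, prodVec_apply, thetaFun]
  refine Finset.prod_congr rfl fun x _ => ?_
  split_ifs <;> rfl

variable {m n : ℕ}

lemma sites_left (hm : 1 ≤ m) :
    sites (m + n + 1) 0 m = insert ⟨m, by omega⟩ (sites (m + n + 1) 0 (m - 1)) := by
  ext x
  simp only [mem_sites, Finset.mem_insert, Fin.ext_iff]
  omega

lemma sites_right :
    sites (m + n + 1) m (m + n) = insert ⟨m, by omega⟩ (sites (m + n + 1) (m + 1) (m + n)) := by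
  ext x
  simp only [mem_sites, Finset.mem_insert, Fin.ext_iff]
  omega

lemma prod_left (hm : 1 ≤ m) {f : Fin (m + n + 1) → Fin 3 → ℂ} {i k : Fin 4} (s : Fin 4)
    (hf : ∀ x : Fin (m + n + 1), (x : ℕ) < m → f x = phi i)
    (hk : ∀ x : Fin (m + n + 1), (x : ℕ) = m → f x = phi k) :
    ∏ x ∈ sites (m + n + 1) 0 m, siteInner (phi s) (f x) = M 1 s k * M m s i := by
  rw [sites_left hm, Finset.prod_insert (by simp [mem_sites]; omega), hk _ rfl, M_apply, M_apply,
    pow_one, Finset.prod_congr rfl (g := fun _ => siteInner (phi s) (phi i)), Finset.prod_const,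
    card_sites (by omega) (by omega), show m - 1 - 0 + 1 = m by omega]
  intro x hx
  rw [mem_sites] at hx
  rw [hf x (by omega)]

lemma prod_right (hn : 1 ≤ n) {f : Fin (m + n + 1) → Fin 3 → ℂ} {i j : Fin 4} (l : Fin 4)
    (hf : ∀ x : Fin (m + n + 1), (x : ℕ) = m → f x = phi i)
    (hj : ∀ x : Fin (m + n + 1), m < (x : ℕ) → f x = phi j) :
    ∏ x ∈ sites (m + n + 1) m (m + n), siteInner (phi l) (f x) = M 1 l i * M n l j := by
  rw [sites_right, Finset.prod_insert (by simp [mem_sites]), hf _ rfl, M_apply, M_apply,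
    pow_one, Finset.prod_congr rfl (g := fun _ => siteInner (phi l) (phi j)), Finset.prod_const,
    card_sites (by omega) (by omega), show m + n - (m + 1) + 1 = n by omega]
  intro x hx
  rw [mem_sites] at hx
  rw [hj x (by omega)]

lemma fill_left {f : Fin (m + n + 1) → Fin 3 → ℂ} {k : Fin 4} (r : Fin 4)
    (hk : ∀ x : Fin (m + n + 1), m < (x : ℕ) → f x = phi k) :
    prodVec (fill 0 m f r) = Theta m n (r, k) := by
  rw [Theta_eq_prodVec]
  congr 1
  funext x
  by_cases hx : (x : ℕ) ≤ m
  · simp [fill, thetaFun, mem_sites, hx]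
  · simp [fill, thetaFun, mem_sites, hx, hk x (by omega)]

lemma Theta_mem_stringSpace (hm : 1 ≤ m) (ij : Fin 4 × Fin 4) :
    Theta m n ij ∈ stringSpace (m + n + 1) 0 m := by
  rw [stringSpace_eq_span (by omega) (by omega), Theta_eq_prodVec]
  refine Submodule.subset_span ⟨ij.1, _, fun x hx => ?_, rfl⟩
  rw [mem_sites] at hx
  simp [thetaFun, hx.2]

/-- The first projection fixes `Θ_{ij}`. The second puts `φ_k` on `[0, n]` and leaves `φ_i` on `[-m,
-1]`. The third puts `φ_r` on `[-m, 0]` and leaves `φ_k` on `[1, n]`. The site 0 belongs to both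
intervals, whence the two factors `M(0,0)` in `𝒜`. -/
theorem kennedyTasaki_K_Theta (hm : 1 ≤ m) (hn : 1 ≤ n) (ij : Fin 4 × Fin 4) :
    (kennedyTasaki (m + n + 1) * K m n * star (kennedyTasaki (m + n + 1))) (Theta m n ij)
      = ∑ rk, A m n ij rk • Theta m n rk := by
  obtain ⟨i, j⟩ := ij
  rw [kennedyTasaki_K_apply, Submodule.starProjection_eq_self_iff.2 (Theta_mem_stringSpace hm _),
    Theta_eq_prodVec, starProjection_prodVec (by omega) (by omega), map_sum]
  simp only [map_smul]
  have hsecond : ∀ k, (stringSpace (m + n + 1) 0 m).starProjection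
      (prodVec (fill m (m + n) (thetaFun m n i j) k))
      = ∑ r, (∑ s, W (m + 1) r s * (M 1 s k * M m s i)) • Theta m n (r, k) := by
    intro k
    rw [starProjection_prodVec (by omega) (by omega), card_sites (by omega) (by omega), Nat.sub_zero]
    refine Finset.sum_congr rfl fun r _ => ?_
    congr 1
    · refine Finset.sum_congr rfl fun s _ => ?_
      rw [prod_left hm (i := i) (k := k)]
      · intro x hx
        simp [fill, mem_sites, thetaFun, hx.le]
        omega
      · intro x hx
        simp [fill, mem_sites, hx]
    · refine fill_left r fun x hx => ?_
      simp [fill, mem_sites]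
      omega
  simp only [hsecond]
  rw [card_sites (by omega) (by omega), show m + n - m + 1 = n + 1 by omega]
  have hfirst : ∀ l, ∏ x ∈ sites (m + n + 1) m (m + n), siteInner (phi l) (thetaFun m n i j x)
      = M 1 l i * M n l j := by
    intro l
    refine prod_right hn l (fun x hx => ?_) (fun x hx => ?_)
    · simp [thetaFun, hx]
    · simp [thetaFun, hx]
  simp only [hfirst, Finset.smul_sum, smul_smul]
  rw [Fintype.sum_prod_type, Finset.sum_comm]
  refine Finset.sum_congr rfl fun r _ => Finset.sum_congr rfl fun k _ => ?_
  congr 1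
  simp only [A, Matrix.of_apply, Finset.sum_mul_sum]
  refine Finset.sum_congr rfl fun l _ => Finset.sum_congr rfl fun s _ => ?_
  ring

/-- After the projection for `[0, n]` only vectors that are some `φ_k` on `[0, n]` occur, and the
last projection does not touch `[1, n]`. -/
theorem range_kennedyTasaki_K_le (hm : 1 ≤ m) (hn : 1 ≤ n) :
    LinearMap.range ((kennedyTasaki (m + n + 1) * K m n * star (kennedyTasaki (m + n + 1)) :
        Op (m + n + 1)) : Chain (m + n + 1) →ₗ[ℂ] Chain (m + n + 1))
      ≤ Submodule.span ℂ (Set.range (Theta m n)) := by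
  rintro _ ⟨ψ, rfl⟩
  rw [ContinuousLinearMap.coe_coe, kennedyTasaki_K_apply]
  have h : ∀ v ∈ stringSpace (m + n + 1) m (m + n),
      (stringSpace (m + n + 1) 0 m).starProjection v ∈ Submodule.span ℂ (Set.range (Theta m n)) := by
    intro v hv
    rw [stringSpace_eq_span (by omega) (by omega)] at hv
    induction hv using Submodule.span_induction with
    | zero => simp
    | add u v _ _ hu hv => rw [map_add]; exact Submodule.add_mem _ hu hv
    | smul c u _ hu => rw [map_smul]; exact Submodule.smul_mem _ _ hu
    | mem u hu =>
      obtain ⟨k, f, hf, rfl⟩ := hu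
      rw [starProjection_prodVec (by omega) (by omega)]
      refine Submodule.sum_mem _ fun r _ => Submodule.smul_mem _ _ (Submodule.subset_span ⟨(r, k), ?_⟩)
      refine (fill_left r fun x hx => hf x ?_).symm
      rw [mem_sites]
      omega
  exact h _ (Submodule.starProjection_apply_mem _ _)

lemma inner_Theta (ij rk : Fin 4 × Fin 4) :
    inner ℂ (Theta m n ij) (Theta m n rk) = M (m + 1) ij.1 rk.1 * M n ij.2 rk.2 := by
  rw [Theta_eq_prodVec, Theta_eq_prodVec, inner_prodVec,
    ← Finset.prod_mul_prod_compl (sites (m + n + 1) 0 m), M_apply, M_apply]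
  congr 1
  · rw [Finset.prod_congr rfl (g := fun _ => siteInner (phi ij.1) (phi rk.1)), Finset.prod_const,
      card_sites (by omega) (by omega), Nat.sub_zero]
    intro x hx
    rw [mem_sites] at hx
    simp [thetaFun, hx.2]
  · rw [Finset.prod_congr rfl (g := fun _ => siteInner (phi ij.2) (phi rk.2)), Finset.prod_const,
      Finset.card_compl, card_sites (by omega) (by omega), Fintype.card_fin,
      show m + n + 1 - (m - 0 + 1) = n by omega]
    intro x hx
    simp only [Finset.mem_compl, mem_sites] at hx
    have : ¬ (x : ℕ) ≤ m := by omega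
    simp [thetaFun, this]

/-- A linear relation between the `Θ_{ij}` is one in the second index. -/
lemma sum_M_mul_eq_zero (hm : 1 ≤ m) {c : Fin 4 × Fin 4 → ℂ}
    (hc : ∑ ij, c ij • Theta m n ij = 0) (i l : Fin 4) : ∑ j, M n l j * c (i, j) = 0 := by
  have h : (fun i => ∑ j, M n l j * c (i, j)) = 0 := by
    refine eq_zero_of_M_mulVec (N := m + 1) (by omega) fun r => ?_
    have := congrArg (inner ℂ (Theta m n (r, l))) hc
    rw [inner_zero_right, inner_sum, Fintype.sum_prod_type] at this
    rw [← this]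
    refine Finset.sum_congr rfl fun i _ => ?_
    rw [Finset.mul_sum]
    refine Finset.sum_congr rfl fun j _ => ?_
    rw [inner_smul_right, inner_Theta]
    ring
  exact congrFun h i

theorem linearIndependent_Theta (hm : 1 ≤ m) (hn : 2 ≤ n) : LinearIndependent ℂ (Theta m n) := by
  rw [Fintype.linearIndependent_iff]
  rintro c hc ⟨i, j⟩
  exact congrFun (eq_zero_of_M_mulVec hn fun l => sum_M_mul_eq_zero hm hc i l) j

/-- The coefficients of a linear relation between the `Θ_{ij}` are in the left kernel of `𝒜`. -/
lemma vecMul_A_eq_zero (hm : 1 ≤ m) {c : Fin 4 × Fin 4 → ℂ}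
    (hc : ∑ ij, c ij • Theta m n ij = 0) : Matrix.vecMul c (A m n) = 0 := by
  funext rk
  -- The index `j` enters `𝒜` only through `M(1,n)_{lj}`, so the sum over `j` is the relation of
  -- `sum_M_mul_eq_zero`.
  have e : Matrix.vecMul c (A m n) rk = ∑ i, ∑ l, ∑ s, W (n + 1) rk.2 l * M 1 l i *
      W (m + 1) rk.1 s * M 1 s rk.2 * M m s i * ∑ j, M n l j * c (i, j) := by
    simp only [Matrix.vecMul, dotProduct, A, Matrix.of_apply, Fintype.sum_prod_type, Finset.mul_sum]
    refine Finset.sum_congr rfl fun i _ => ?_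
    rw [Finset.sum_comm]
    refine Finset.sum_congr rfl fun l _ => ?_
    rw [Finset.sum_comm]
    refine Finset.sum_congr rfl fun s _ => Finset.sum_congr rfl fun j _ => ?_
    ring
  rw [e]
  simp [sum_M_mul_eq_zero hm hc]

end AKLT

end

/-! ### Permutation symmetry of the matrix `𝒜`. -/

noncomputable section

namespace AKLT

open Complex Polynomial

/-- The constant and the linear coefficient (in `z`) of
`3 (3 + z) ∑_l gramInv(-z/3)_{kl} gram(-1/3)_{li} gram(z)_{lj}`. -/
def overlapInt (d : Fin 2) (k i j : Fin 4) : ℤ :=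
  if d = 0 then (if k = i ∧ k = j then 12 else 0) - (if k = j then 3 else 0)
  else (if k = i then 12 else 0) + (if k = j then 3 else 0) + (if i = j then 4 else 0)
    - (if k = i ∧ k = j then 12 else 0) - 4

/-- The rows of `gram (-1/3)` sum to zero, so `∑_l gram(-1/3)_{li} gram(z)_{lj}` carries the factor
`1 - z`. It cancels the denominator of the rank-one part of `gramInv (-z/3)`, and the numerator is
affine in `z`. -/
lemma gramInv_overlap {z : ℂ} (h1 : 1 - z ≠ 0) (h3 : 3 + z ≠ 0) (k i j : Fin 4) :
    ∑ l, gramInv (-z / 3) k l * gram (-1 / 3) l i * gram z l j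
      = (overlapInt 0 k i j + z * overlapInt 1 k i j) / (3 * (3 + z)) := by
  have e1 : 1 + 3 * (-z / 3) = 1 - z := by ring
  have e2 : 1 - -z / 3 = (3 + z) / 3 := by ring
  have hu : (-z / 3) / (1 - z) * (1 - z) = -z / 3 := div_mul_cancel₀ _ h1
  simp only [gramInv, gram, Matrix.of_apply, e1, e2]
  generalize (-z / 3) / (1 - z) = u at hu
  have hv : (3 + z) * (3 + z)⁻¹ = 1 := mul_inv_cancel₀ h3
  simp only [div_eq_mul_inv, mul_inv, inv_inv]
  generalize (3 + z)⁻¹ = v at hv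
  revert k i j
  simp only [Fin.sum_univ_four, overlapInt]
  intro k i j
  fin_cases k <;> fin_cases i <;> fin_cases j <;> simp <;>
    first
    | linear_combination v * hu
    | linear_combination (-3 * v) * hu

/-- The signs that relate `𝒜` to a matrix without signs. -/
def thetaSign (m n : ℕ) (ij : Fin 4 × Fin 4) : ℂ := phiSign ij.1 ^ (m + 1) * phiSign ij.2 ^ n

lemma thetaSign_mul_self (m n : ℕ) (ij : Fin 4 × Fin 4) :
    thetaSign m n ij * thetaSign m n ij = 1 := by
  rw [thetaSign, mul_mul_mul_comm, ← mul_pow, ← mul_pow, phiSign_mul_self, phiSign_mul_self]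
  simp

/-- The coefficients of the matrix `𝒜` without signs, as a polynomial in `x = (-1/3)^m` and
`y = (-1/3)^n`, up to the factor `9 (3 + x) (3 + y)`. -/
def coreInt (d e : Fin 2) (ij rk : Fin 4 × Fin 4) : ℤ :=
  overlapInt e rk.2 ij.1 ij.2 * overlapInt d rk.1 rk.2 ij.1

/-- The matrix `𝒜` without signs, up to the factor `9 (3 + x) (3 + y)`. -/
def core (x y : ℂ) : Matrix (Fin 4 × Fin 4) (Fin 4 × Fin 4) ℂ :=
  Matrix.of fun ij rk => coreInt 0 0 ij rk + x * coreInt 1 0 ij rk + y * coreInt 0 1 ij rk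
    + x * y * coreInt 1 1 ij rk

lemma pow_neg_third_ne' {N : ℕ} (hN : 1 ≤ N) :
    (1 - (-1 / 3 : ℂ) ^ N ≠ 0) ∧ (3 + (-1 / 3 : ℂ) ^ N ≠ 0) := by
  have h : |(-1 / 3 : ℝ) ^ N| ≤ 1 / 3 := by
    rw [abs_pow]
    calc |(-1 / 3 : ℝ)| ^ N ≤ |(-1 / 3 : ℝ)| ^ 1 :=
          pow_le_pow_of_le_one (by positivity) (by norm_num [abs_of_neg]) hN
      _ = 1 / 3 := by norm_num
  rw [abs_le] at h
  constructor
  · intro h0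
    have : (1 - (-1 / 3 : ℝ) ^ N) = 0 := by exact_mod_cast h0
    linarith
  · intro h0
    have : (3 + (-1 / 3 : ℝ) ^ N) = 0 := by exact_mod_cast h0
    linarith

lemma W_overlap {N : ℕ} (hN : 1 ≤ N) (k i j : Fin 4) :
    ∑ l, W (N + 1) k l * M 1 l i * M N l j
      = phiSign k ^ (N + 1) * phiSign i * phiSign j ^ N *
        ((overlapInt 0 k i j + (-1 / 3) ^ N * overlapInt 1 k i j) / (3 * (3 + (-1 / 3) ^ N))) := by
  obtain ⟨h1, h3⟩ := pow_neg_third_ne' hN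
  rw [← gramInv_overlap h1 h3, Finset.mul_sum]
  refine Finset.sum_congr rfl fun l _ => ?_
  rw [W_apply (by omega), M_eq_gram, M_eq_gram, pow_one, pow_one,
    show (-1 / 3 : ℂ) ^ (N + 1) = -(-1 / 3) ^ N / 3 by rw [pow_succ]; ring]
  have hl : (phiSign l) ^ (N + 1) * phiSign l * phiSign l ^ N = 1 := by
    rw [pow_succ, mul_assoc (phiSign l ^ N), phiSign_mul_self, mul_one, ← mul_pow,
      phiSign_mul_self, one_pow]
  simp only [mul_pow]
  linear_combination (phiSign k ^ (N + 1) * phiSign i * phiSign j ^ N *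
    gramInv (-(-1 / 3) ^ N / 3) k l * gram (-1 / 3) l i * gram ((-1 / 3) ^ N) l j) * hl

/-- Conjugation by a diagonal matrix of signs does not change the spectrum, and what is left has
integer coefficients in `x` and `y`. -/
lemma A_eq_core {m n : ℕ} (hm : 1 ≤ m) (hn : 1 ≤ n) (ij rk : Fin 4 × Fin 4) :
    A m n ij rk = thetaSign m n ij * (core ((-1 / 3) ^ m) ((-1 / 3) ^ n) ij rk
      / (9 * (3 + (-1 / 3) ^ m) * (3 + (-1 / 3) ^ n))) * thetaSign m n rk := by
  obtain ⟨-, h3⟩ := pow_neg_third_ne' hm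
  obtain ⟨-, h3'⟩ := pow_neg_third_ne' hn
  have e : A m n ij rk = (∑ l, W (n + 1) rk.2 l * M 1 l ij.1 * M n l ij.2)
      * ∑ s, W (m + 1) rk.1 s * M 1 s rk.2 * M m s ij.1 := by
    rw [Finset.sum_mul_sum, A, Matrix.of_apply]
    refine Finset.sum_congr rfl fun l _ => Finset.sum_congr rfl fun s _ => ?_
    ring
  have hk : phiSign rk.2 ^ (n + 1) * phiSign rk.2 = phiSign rk.2 ^ n := by
    rw [pow_succ, mul_assoc, phiSign_mul_self, mul_one]
  rw [e, W_overlap hn, W_overlap hm, core, Matrix.of_apply]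
  simp only [thetaSign, coreInt]
  push_cast
  rw [← hk]
  generalize (-1 / 3 : ℂ) ^ m = x at *
  generalize (-1 / 3 : ℂ) ^ n = y at *
  simp only [div_eq_mul_inv, mul_inv]
  ring

/-- The three nontrivial characters of `ℤ₂ × ℤ₂`. -/
def chr : Fin 3 → Fin 4 → ℤ := ![![1, 1, -1, -1], ![1, -1, 1, -1], ![1, -1, -1, 1]]

/-- The index set of a basis adapted to the permutation symmetry of the four product states: two
invariants, three times three vectors, and five more. -/
abbrev SymIdx : Type := Fin 2 ⊕ (Fin 3 ⊕ (Fin 3 ⊕ (Fin 3 ⊕ Fin 5)))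

/-- Three vectors that transform like the character `a`. -/
def symVec (a : Fin 3) (p : Fin 3) (r k : Fin 4) : ℤ :=
  ![chr a r, chr a k, chr (a + 1) r * chr (a + 2) k + chr (a + 2) r * chr (a + 1) k] p

/-- The adapted basis. -/
def symBasis (rk : Fin 4 × Fin 4) : SymIdx → ℤ :=
  Sum.elim (fun p => ![1, ∑ a, chr a rk.1 * chr a rk.2] p)
    (Sum.elim (fun p => symVec 0 p rk.1 rk.2) (Sum.elim (fun p => symVec 1 p rk.1 rk.2)
      (Sum.elim (fun p => symVec 2 p rk.1 rk.2) fun p =>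
        ![chr 0 rk.1 * chr 0 rk.2 - chr 1 rk.1 * chr 1 rk.2,
          chr 0 rk.1 * chr 0 rk.2 + chr 1 rk.1 * chr 1 rk.2 - 2 * (chr 2 rk.1 * chr 2 rk.2),
          chr 1 rk.1 * chr 2 rk.2 - chr 2 rk.1 * chr 1 rk.2,
          chr 2 rk.1 * chr 0 rk.2 - chr 0 rk.1 * chr 2 rk.2,
          chr 0 rk.1 * chr 1 rk.2 - chr 1 rk.1 * chr 0 rk.2] p)))

/-- The square norms of the adapted basis. -/
def symNorm : SymIdx → ℤ :=
  Sum.elim ![16, 48] (Sum.elim ![16, 16, 32] (Sum.elim ![16, 16, 32] (Sum.elim ![16, 16, 32]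
    ![32, 96, 32, 32, 32])))

/-- The block of the invariant vectors. -/
def blockTwo (d e : Fin 2) : Matrix (Fin 2) (Fin 2) ℤ :=
  ![![!![27, 54; 18, 63], !![81, 162; -18, -27]],
    ![!![9, -54; 6, 45], !![27, -162; -6, 63]]] d e

/-- The block of the three vectors of a character. -/
def blockThree (d e : Fin 2) : Matrix (Fin 3) (Fin 3) ℤ :=
  ![![!![27, 18, 36; 18, 27, 36; 18, 18, 45], !![81, 54, 108; -18, -15, -12; -18, -6, -21]],
    ![!![9, 6, 36; -18, 9, -36; 18, 6, 27], !![27, 18, 108; 18, -5, 12; -18, -2, -51]]] d e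

/-- The scalar on the remaining five vectors. -/
def blockFive (d e : Fin 2) : ℤ := ![![9, -9], ![-9, 9]] d e

/-- The coefficients of `core` in the adapted basis. -/
def symBlock (d e : Fin 2) : Matrix SymIdx SymIdx ℤ :=
  Matrix.fromBlocks (blockTwo d e) 0 0 (Matrix.fromBlocks (blockThree d e) 0 0
    (Matrix.fromBlocks (blockThree d e) 0 0 (Matrix.fromBlocks (blockThree d e) 0 0
      (Matrix.diagonal fun _ => blockFive d e))))

/-- The coefficients are built from equalities between the indices alone, hence commute with
simultaneous permutations. The characters span the standard representation of `S₄`, which explains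
the three equal 3×3 blocks. As `core` is affine in `x` and in `y`, four integer identities suffice.
-/
lemma coreInt_symBasis : ∀ (d e : Fin 2) (ij : Fin 4 × Fin 4) (c : SymIdx),
    ∑ rk, coreInt d e ij rk * symBasis rk c = ∑ c', symBasis ij c' * symBlock d e c' c := by
  decide +kernel

lemma symBasis_orthogonal : ∀ c c' : SymIdx,
    ∑ rk, symBasis rk c * symBasis rk c' = if c = c' then symNorm c else 0 := by
  decide +kernel

end AKLT

end

/-! ### The characteristic polynomial of `𝒜`. -/

noncomputable section

namespace AKLT

open Complex Polynomial

/-- Matrices that are conjugate by a rectangular matrix have the same characteristic polynomial. -/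
lemma charpoly_eq_of_conj {ι κ R : Type*} [CommRing R] [Fintype ι] [DecidableEq ι] [Fintype κ]
    [DecidableEq κ] {A : Matrix ι ι R} {B : Matrix κ κ R} {P : Matrix ι κ R} {Q : Matrix κ ι R}
    (hPQ : P * Q = 1) (hQP : Q * P = 1) (h : A * P = P * B) : A.charpoly = B.charpoly := by
  have hA : A = P * B * Q := by rw [← h, Matrix.mul_assoc, hPQ, Matrix.mul_one]
  have hPQ' : P.map (C : R →+* R[X]) * Q.map (C : R →+* R[X]) = 1 := by
    rw [← Matrix.map_mul, hPQ]; simp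
  have hQP' : Q.map (C : R →+* R[X]) * P.map (C : R →+* R[X]) = 1 := by
    rw [← Matrix.map_mul, hQP]; simp
  rw [Matrix.charpoly, Matrix.charpoly, ← Matrix.det_conj_of_mul_eq_one (N := B.charmatrix) hPQ' hQP']
  congr 1
  rw [Matrix.charmatrix, Matrix.charmatrix, Matrix.mul_sub, Matrix.sub_mul, hA]
  congr 1
  · simp only [Matrix.scalar_apply, ← Matrix.smul_one_eq_diagonal, Matrix.mul_smul, Matrix.smul_mul,
      Matrix.mul_one, hPQ']
  · simp [Matrix.map_mul]

/-- The diagonal blocks for given `x` and `y`. -/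
def evalBlock {κ : Type*} (B : Fin 2 → Fin 2 → Matrix κ κ ℤ) (x y : ℂ) : Matrix κ κ ℂ :=
  Matrix.of fun p q => B 0 0 p q + x * B 1 0 p q + y * B 0 1 p q + x * y * B 1 1 p q

/-- The basis is orthogonal, so the inverse `Q` of the change of basis `P` is its transpose divided
by the square norms. The signs of `𝒜` are absorbed in `P` and `Q`. -/
lemma charpoly_A_eq {m n : ℕ} (hm : 1 ≤ m) (hn : 1 ≤ n) :
    (A m n).charpoly = ((9 * (3 + (-1 / 3 : ℂ) ^ m) * (3 + (-1 / 3) ^ n))⁻¹ •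
      evalBlock symBlock ((-1 / 3) ^ m) ((-1 / 3) ^ n)).charpoly := by
  set x : ℂ := (-1 / 3) ^ m
  set y : ℂ := (-1 / 3) ^ n
  set c : ℂ := (9 * (3 + x) * (3 + y))⁻¹
  let P : Matrix (Fin 4 × Fin 4) SymIdx ℂ := Matrix.of fun rk p => thetaSign m n rk * symBasis rk p
  let Q : Matrix SymIdx (Fin 4 × Fin 4) ℂ :=
    Matrix.of fun p rk => (symNorm p : ℂ)⁻¹ * symBasis rk p * thetaSign m n rk
  have hnorm : ∀ p, (symNorm p : ℂ) ≠ 0 := by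
    have : ∀ p, symNorm p ≠ 0 := by decide
    exact fun p => by exact_mod_cast this p
  have hQP : Q * P = 1 := by
    ext p q
    rw [Matrix.mul_apply]
    have e : ∀ rk, Q p rk * P rk q = (symNorm p : ℂ)⁻¹ * ((symBasis rk p * symBasis rk q : ℤ) : ℂ) := by
      intro rk
      simp only [P, Q, Matrix.of_apply]
      push_cast
      linear_combination ((symNorm p : ℂ)⁻¹ * symBasis rk p * symBasis rk q) * thetaSign_mul_self m n rk
    simp only [e, ← Finset.mul_sum, ← Int.cast_sum, symBasis_orthogonal]
    by_cases hpq : p = q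
    · subst hpq; simp [hnorm]
    · simp [hpq]
  have hPQ : P * Q = 1 :=
    (Matrix.mul_eq_one_comm_of_card_eq _ _ _ (by simp)).1 hQP
  refine charpoly_eq_of_conj hPQ hQP ?_
  ext ij p
  rw [Matrix.mul_apply, Matrix.mul_apply]
  have e : ∀ rk, A m n ij rk * P rk p
      = thetaSign m n ij * c * (core x y ij rk * symBasis rk p) := by
    intro rk
    rw [A_eq_core hm hn]
    change thetaSign m n ij * (core x y ij rk / (9 * (3 + x) * (3 + y))) * thetaSign m n rk *
      (thetaSign m n rk * symBasis rk p) = _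
    rw [div_eq_mul_inv]
    linear_combination (thetaSign m n ij * c * core x y ij rk * symBasis rk p)
      * thetaSign_mul_self m n rk
  have e' : ∀ p', P ij p' * (c • evalBlock symBlock x y) p' p
      = thetaSign m n ij * c * (symBasis ij p' * evalBlock symBlock x y p' p) := by
    intro p'
    simp only [P, Matrix.of_apply, Matrix.smul_apply, smul_eq_mul]
    ring
  simp only [e, e', ← Finset.mul_sum]
  congr 1
  have h := fun d e => congrArg (fun z : ℤ => (z : ℂ)) (coreInt_symBasis d e ij p)
  push_cast at h
  simp only [core, evalBlock, Matrix.of_apply, add_mul, mul_add, Finset.sum_add_distrib]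
  have e1 : ∀ (z : ℂ) (d e : Fin 2), ∑ rk, z * (coreInt d e ij rk : ℂ) * symBasis rk p
      = ∑ p', (symBasis ij p' : ℂ) * (z * symBlock d e p' p) := by
    intro z d e
    simp only [mul_assoc, mul_left_comm _ z, ← Finset.mul_sum]
    rw [h]
  rw [e1, e1, e1, h]

lemma charpoly_fin_three' (B : Matrix (Fin 3) (Fin 3) ℂ) (p q r : ℂ)
    (h1 : B 0 0 + B 1 1 + B 2 2 = p + q + r)
    (h2 : B 0 0 * B 1 1 - B 0 1 * B 1 0 + B 0 0 * B 2 2 - B 0 2 * B 2 0 + B 1 1 * B 2 2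
      - B 1 2 * B 2 1 = p * q + p * r + q * r)
    (h3 : B.det = p * q * r) :
    B.charpoly = (X - C p) * (X - C q) * (X - C r) := by
  have e1 := congrArg (C : ℂ →+* ℂ[X]) h1
  have e2 := congrArg (C : ℂ →+* ℂ[X]) h2
  have e3 := congrArg (C : ℂ →+* ℂ[X]) h3
  rw [Matrix.det_fin_three] at e3
  simp only [map_add, map_mul, map_sub] at e1 e2 e3
  rw [Matrix.charpoly, Matrix.det_fin_three]
  simp
  linear_combination (-X ^ 2) * e1 + X * e2 - e3

lemma charpoly_fin_two' (B : Matrix (Fin 2) (Fin 2) ℂ) (p q : ℂ)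
    (h1 : B 0 0 + B 1 1 = p + q) (h2 : B 0 0 * B 1 1 - B 0 1 * B 1 0 = p * q) :
    B.charpoly = (X - C p) * (X - C q) := by
  have e1 := congrArg (C : ℂ →+* ℂ[X]) h1
  have e2 := congrArg (C : ℂ →+* ℂ[X]) h2
  simp only [map_add, map_mul, map_sub] at e1 e2
  rw [Matrix.charpoly, Matrix.det_fin_two]
  simp
  linear_combination (-X) * e1 + e2

/-! ### The eigenvalues in terms of `x = (-1/3)^m` and `y = (-1/3)^n`. -/

section Lam

variable (m n : ℕ)

/-- Multiplication by `-1/3` maps the interval `[-1/3, 1/9]` into itself. -/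
lemma pow_neg_third_bounds {N : ℕ} (hN : 1 ≤ N) :
    -(1 / 3) ≤ (-1 / 3 : ℝ) ^ N ∧ (-1 / 3 : ℝ) ^ N ≤ 1 / 9 := by
  obtain ⟨k, rfl⟩ := Nat.exists_eq_add_of_le hN
  induction k with
  | zero => norm_num
  | succ k ih =>
    have := ih (by omega)
    rw [show 1 + (k + 1) = (1 + k) + 1 by ring, pow_succ]
    constructor <;> linarith [this.1, this.2]

lemma lamDen_eq : lamDen m n
    = (3 + (-1 / 3 : ℝ) ^ m) * (3 + (-1 / 3 : ℝ) ^ n) / 9 := by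
  rw [lamDen, pow_succ, pow_succ]; ring

lemma lamR_eq : lamR m n = ((-1 / 3) ^ m - (-1 / 3) ^ n) ^ 2
    - 128 / 81 * ((-1 / 3 : ℝ) ^ m) ^ 2 * ((-1 / 3) ^ n) ^ 2
    + 4 / 9 * (-1 / 3) ^ m * (-1 / 3) ^ n * (1 + (-1 / 3) ^ m) * (1 + (-1 / 3) ^ n) := by
  rw [lamR, show 2 * m + 2 * n + 4 = m + m + (n + n) + 4 by ring, pow_add, pow_add, pow_add, pow_add,
    pow_add, pow_add]
  ring

lemma lam5_eq : lam5 m n = (1 - (-1 / 3) ^ m) * (1 - (-1 / 3) ^ n)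
    / ((3 + (-1 / 3 : ℝ) ^ m) * (3 + (-1 / 3 : ℝ) ^ n)) := by
  rw [lam5, lamDen_eq, div_div_eq_mul_div]; ring

variable {m n}

lemma lam1_eq (hm : 1 ≤ m) (hn : 1 ≤ n) : lam1 m n = (1 + 3 * (-1 / 3) ^ m) * (1 + 3 * (-1 / 3) ^ n)
    / ((3 + (-1 / 3 : ℝ) ^ m) * (3 + (-1 / 3 : ℝ) ^ n)) := by
  obtain ⟨m, rfl⟩ := Nat.exists_eq_add_of_le' hm
  obtain ⟨n, rfl⟩ := Nat.exists_eq_add_of_le' hn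
  rw [lam1, lamDen_eq, div_div_eq_mul_div, Nat.add_sub_cancel, Nat.add_sub_cancel,
    pow_succ (-1 / 3 : ℝ) m, pow_succ (-1 / 3 : ℝ) n]
  ring

variable (m n)

/-- The rational part of the numerator of `λ_{3±}`. -/
def lamQ : ℝ := 1 + (-1 / 3) ^ m + (-1 / 3) ^ n - 19 / 9 * (-1 / 3) ^ m * (-1 / 3) ^ n

lemma lam3plus_eq : lam3plus m n = (lamQ m n + 2 * Real.sqrt (lamR m n))
    / ((3 + (-1 / 3 : ℝ) ^ m) * (3 + (-1 / 3 : ℝ) ^ n)) := by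
  rw [lam3plus, lamDen_eq, div_div_eq_mul_div, lamQ, pow_add, pow_add]; ring

lemma lam3minus_eq : lam3minus m n = (lamQ m n - 2 * Real.sqrt (lamR m n))
    / ((3 + (-1 / 3 : ℝ) ^ m) * (3 + (-1 / 3 : ℝ) ^ n)) := by
  rw [lam3minus, lamDen_eq, div_div_eq_mul_div, lamQ, pow_add, pow_add]; ring

variable {m n}

lemma lamR_nonneg (hm : 1 ≤ m) (hn : 1 ≤ n) : 0 ≤ lamR m n := by
  rw [lamR_eq]
  obtain ⟨h1, h2⟩ := pow_neg_third_bounds hm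
  obtain ⟨h3, h4⟩ := pow_neg_third_bounds hn
  generalize (-1 / 3 : ℝ) ^ m = x at *
  generalize (-1 / 3 : ℝ) ^ n = y at *
  have hp : 4 / 9 ≤ (1 + x) * (1 + y) := by nlinarith
  have hq : (1 + x) * (1 + y) ≤ 100 / 81 := by nlinarith
  have hxy : x * y ≤ 1 / 9 := by nlinarith
  have hxy' : -(1 / 9) ≤ x * y := by nlinarith
  -- If `xy ≥ 0`, the last term of `R` is at least `16/81 xy` and dominates `128/81 (xy)² ≤ 128/729
  -- xy`. If `xy ≤ 0`, the square `(x - y)² = (x + y)² - 4xy` dominates the other two terms.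
  rcases le_total 0 (x * y) with h | h
  · nlinarith [sq_nonneg (x - y), mul_nonneg h (sub_nonneg.2 hp), mul_nonneg h (sub_nonneg.2 hxy)]
  · nlinarith [sq_nonneg (x + y), mul_nonneg (neg_nonneg.2 h) (sub_nonneg.2 hq),
      mul_nonneg (neg_nonneg.2 h) (by linarith : (0 : ℝ) ≤ 1 / 9 + x * y)]

end Lam

/-- The 2×2 block has the eigenvalues `1, λ_1` and the 3×3 block `1, λ_{3+}, λ_{3-}`. The latter
occurs three times, so 1 has multiplicity four. It suffices to compare elementary symmetric
functions, in which the root of `R` enters only through its square. -/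
theorem charpoly_A {m n : ℕ} (hm : 1 ≤ m) (hn : 1 ≤ n) :
    (A m n).charpoly = (X - C 1) ^ 4 * (X - C (lam5 m n : ℂ)) ^ 5 * (X - C (lam1 m n : ℂ))
        * (X - C (lam3plus m n : ℂ)) ^ 3 * (X - C (lam3minus m n : ℂ)) ^ 3 := by
  obtain ⟨-, h3⟩ := pow_neg_third_ne' hm
  obtain ⟨-, h3'⟩ := pow_neg_third_ne' hn
  have hR := congrArg (fun r : ℝ => (r : ℂ))
    ((Real.sq_sqrt (lamR_nonneg hm hn)).trans (lamR_eq m n))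
  rw [charpoly_A_eq hm hn, lam5_eq, lam1_eq hm hn, lam3plus_eq, lam3minus_eq, lamQ]
  push_cast at hR ⊢
  generalize ((Real.sqrt (lamR m n) : ℝ) : ℂ) = w at *
  generalize (-1 / 3 : ℂ) ^ m = x at *
  generalize (-1 / 3 : ℂ) ^ n = y at *
  have hE : (3 + x) * (3 + y) ≠ 0 := mul_ne_zero h3 h3'
  have hc : (9 * (3 + x) * (3 + y))⁻¹ = 1 / 9 * ((3 + x) * (3 + y))⁻¹ := by
    rw [mul_assoc, mul_inv]; ring
  simp only [div_eq_mul_inv _ ((3 + x) * (3 + y))]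
  rw [hc]
  have hv : (3 + x) * (3 + y) * ((3 + x) * (3 + y))⁻¹ = 1 := mul_inv_cancel₀ hE
  generalize ((3 + x) * (3 + y))⁻¹ = v at *
  set c := 1 / 9 * v with hcdef
  have hblocks : c • evalBlock symBlock x y = Matrix.fromBlocks (c • evalBlock blockTwo x y) 0 0
      (Matrix.fromBlocks (c • evalBlock blockThree x y) 0 0
        (Matrix.fromBlocks (c • evalBlock blockThree x y) 0 0
          (Matrix.fromBlocks (c • evalBlock blockThree x y) 0 0
            (((1 - x) * (1 - y) * v) • (1 : Matrix (Fin 5) (Fin 5) ℂ))))) := by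
    have hfive : c • evalBlock (fun d e => (Matrix.diagonal fun _ => blockFive d e : Matrix (Fin 5) (Fin 5) ℤ)) x y
        = ((1 - x) * (1 - y) * v) • (1 : Matrix (Fin 5) (Fin 5) ℂ) := by
      ext p q
      by_cases hpq : p = q
      · subst hpq
        simp [evalBlock, blockFive, c]
        ring
      · simp [evalBlock, hpq]
    rw [← hfive]
    ext (p | p | p | p | p) (q | q | q | q | q) <;>
      simp [evalBlock, symBlock]
  have h2 : (c • evalBlock blockTwo x y).charpoly
      = (X - C 1) * (X - C ((1 + 3 * x) * (1 + 3 * y) * v)) := by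
    apply charpoly_fin_two'
    · simp [evalBlock, blockTwo, c]
      linear_combination (1 : ℂ) * hv
    · simp [evalBlock, blockTwo, c]
      linear_combination (v * (1 + 3 * x) * (1 + 3 * y)) * hv
  have h3 : (c • evalBlock blockThree x y).charpoly
      = (X - C 1) * (X - C ((1 + x + y - 19 / 9 * x * y + 2 * w) * v))
        * (X - C ((1 + x + y - 19 / 9 * x * y - 2 * w) * v)) := by
    apply charpoly_fin_three'
    · simp [evalBlock, blockThree, c]
      linear_combination (1 : ℂ) * hv
    · simp [evalBlock, blockThree, c]
      linear_combination (v * 2 * (1 + x + y - 19 / 9 * x * y)) * hv + 4 * v ^ 2 * hR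
    · rw [Matrix.det_fin_three]
      simp [evalBlock, blockThree, c]
      linear_combination (v ^ 2 * ((1 + x + y - 19 / 9 * x * y) ^ 2 - 4 * w ^ 2)) * hv
        + 4 * v ^ 3 * (3 + x) * (3 + y) * hR
  have h5 : (((1 - x) * (1 - y) * v) • (1 : Matrix (Fin 5) (Fin 5) ℂ)).charpoly
      = (X - C ((1 - x) * (1 - y) * v)) ^ 5 := by
    rw [Matrix.smul_one_eq_diagonal, Matrix.charpoly_diagonal]
    simp
  rw [hblocks]
  simp only [Matrix.charpoly_fromBlocks_zero₁₂, h2, h3, h5]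
  ring

end AKLT

end

/-! ### The number `ε(m,n)` as an eigenvalue. -/

noncomputable section

namespace AKLT

open Complex Polynomial

section TwoProjections

variable {E : Type*} [NormedAddCommGroup E] [InnerProductSpace ℂ E] [FiniteDimensional ℂ E]
  {S T : Submodule ℂ E}

/-- Neither projection can have decreased the norm, and a vector whose projection has the same norm
lies in the subspace. -/
lemma mem_inf_of_starProjection_eq {v : E}
    (h : S.starProjection (T.starProjection (S.starProjection v)) = v) : v ∈ S ⊓ T := by
  have hS : v ∈ S := h ▸ Submodule.starProjection_apply_mem _ _
  rw [Submodule.starProjection_eq_self_iff.2 hS] at h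
  refine ⟨hS, (Submodule.mem_iff_norm_starProjection _ _).2 ?_⟩
  refine le_antisymm (Submodule.norm_starProjection_apply_le _ _) ?_
  calc ‖v‖ = ‖S.starProjection (T.starProjection v)‖ := by rw [h]
    _ ≤ _ := Submodule.norm_starProjection_apply_le _ _

/-- A bound for the eigenvalues of `P_S P_T P_S` other than `1` bounds the quadratic form of `P_T`
on the part of `S` that is orthogonal to `S ⊓ T`. -/
lemma re_inner_starProjection_le {c : ℝ} (hc : ∀ (t : ℝ) (v : E), v ≠ 0 →
      S.starProjection (T.starProjection (S.starProjection v)) = (t : ℂ) • v → t = 1 ∨ t ≤ c)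
    {ψ : E} (hS : ψ ∈ S) (hψ : ψ ∈ (S ⊓ T)ᗮ) :
    (inner ℂ ψ (T.starProjection ψ)).re ≤ c * ‖ψ‖ ^ 2 := by
  let k : E →ₗ[ℂ] E := (S.starProjection * T.starProjection * S.starProjection : E →L[ℂ] E)
  have hk : ∀ v, k v = S.starProjection (T.starProjection (S.starProjection v)) := fun _ => rfl
  have hsym : k.IsSymmetric := by
    intro u v
    rw [hk, hk, Submodule.inner_starProjection_left_eq_right,
      Submodule.inner_starProjection_left_eq_right, Submodule.inner_starProjection_left_eq_right]
  let b := hsym.eigenvectorBasis rfl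
  let t := hsym.eigenvalues rfl
  have hb : ∀ i, k (b i) = (t i : ℂ) • b i := fun i => hsym.apply_eigenvectorBasis rfl i
  -- For `ψ` in `S` the forms of `P_T` and of `P_S P_T P_S` agree, and the latter is diagonal in the
  -- basis `b`.
  have e : inner ℂ ψ (T.starProjection ψ) = ∑ i, (t i : ℂ) * (‖inner ℂ (b i) ψ‖ ^ 2 : ℝ) := by
    have h1 : inner ℂ ψ (T.starProjection ψ) = inner ℂ ψ (k ψ) := by
      rw [hk, Submodule.starProjection_eq_self_iff.2 hS,
        ← Submodule.inner_starProjection_left_eq_right S, Submodule.starProjection_eq_self_iff.2 hS]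
    rw [h1, ← b.sum_inner_mul_inner]
    refine Finset.sum_congr rfl fun i _ => ?_
    rw [← hsym (b i) ψ, hb, inner_smul_left, Complex.conj_ofReal, mul_left_comm,
      ← inner_conj_symm ψ (b i), Complex.conj_mul', Complex.ofReal_pow]
  rw [e, Complex.re_sum, ← b.sum_sq_norm_inner_right, Finset.mul_sum]
  refine Finset.sum_le_sum fun i _ => ?_
  rw [Complex.re_ofReal_mul, Complex.ofReal_re]
  -- Eigenvectors for the eigenvalue 1 lie in `S ⊓ T`, to which `ψ` is orthogonal, so they do not
  -- contribute.
  rcases hc (t i) (b i) (b.orthonormal.ne_zero i) (hb i) with h | h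
  · have hmem : b i ∈ S ⊓ T := by
      refine mem_inf_of_starProjection_eq ?_
      rw [← hk, hb, h, Complex.ofReal_one, one_smul]
    rw [hψ _ hmem]
    simp
  · exact mul_le_mul_of_nonneg_right h (by positivity)

/-- Eigenvectors of `P_S P_T P_S` for eigenvalues other than `0` and `1`. -/
lemma mem_of_eigenvector {t : ℝ} (h0 : t ≠ 0) (h1 : t ≠ 1) {v : E}
    (h : S.starProjection (T.starProjection (S.starProjection v)) = (t : ℂ) • v) :
    v ∈ S ∧ v ∈ (S ⊓ T)ᗮ ∧ (inner ℂ v (T.starProjection v)).re = t * ‖v‖ ^ 2 := by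
  have h0' : (t : ℂ) ≠ 0 := by exact_mod_cast h0
  have hS : v ∈ S := by
    rw [← S.smul_mem_iff h0', ← h]
    exact Submodule.starProjection_apply_mem _ _
  refine ⟨hS, fun u hu => ?_, ?_⟩
  · have h2 := congrArg (inner ℂ u) h
    rw [← Submodule.inner_starProjection_left_eq_right,
      Submodule.starProjection_eq_self_iff.2 hu.1, ← Submodule.inner_starProjection_left_eq_right,
      Submodule.starProjection_eq_self_iff.2 hu.2, ← Submodule.inner_starProjection_left_eq_right,
      Submodule.starProjection_eq_self_iff.2 hu.1, inner_smul_right] at h2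
    have h3 : (1 - (t : ℂ)) * inner ℂ u v = 0 := by rw [sub_mul, ← h2]; ring
    refine (mul_eq_zero.1 h3).resolve_left ?_
    rw [← ne_eq, sub_ne_zero]
    exact_mod_cast h1.symm
  · have h2 := congrArg (inner ℂ v) h
    rw [← Submodule.inner_starProjection_left_eq_right,
      Submodule.starProjection_eq_self_iff.2 hS, inner_smul_right, inner_self_eq_norm_sq_to_K] at h2
    rw [h2, ← Complex.ofReal_re (t * ‖v‖ ^ 2)]
    push_cast
    rfl

end TwoProjections

/-! ### Comparison of the spectra of `K` and `𝒜`. -/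

section Intertwine

variable {m n : ℕ}

/-- The linear combination of the `Θ_{ij}` with given coefficients. -/
def thetaSum (m n : ℕ) : (Fin 4 × Fin 4 → ℂ) →ₗ[ℂ] Chain (m + n + 1) :=
  Fintype.linearCombination ℂ (Theta m n)

lemma thetaSum_apply (c : Fin 4 × Fin 4 → ℂ) : thetaSum m n c = ∑ ij, c ij • Theta m n ij := rfl

/-- The operator `K` in the transformed picture. -/
def ktK (m n : ℕ) : Module.End ℂ (Chain (m + n + 1)) :=
  ((kennedyTasaki (m + n + 1) * K m n * star (kennedyTasaki (m + n + 1)) : Op (m + n + 1)) :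
    Chain (m + n + 1) →ₗ[ℂ] Chain (m + n + 1))

/-- The rows of `𝒜` are the images of the `Θ_{ij}`, so coefficient vectors are transformed by the
transpose. -/
lemma ktK_thetaSum (hm : 1 ≤ m) (hn : 1 ≤ n) (c : Fin 4 × Fin 4 → ℂ) :
    ktK m n (thetaSum m n c) = thetaSum m n (Matrix.toLin' (A m n).transpose c) := by
  rw [thetaSum_apply, map_sum, thetaSum_apply]
  have : ∀ ij, ktK m n (c ij • Theta m n ij) = ∑ rk, (c ij * A m n ij rk) • Theta m n rk := by
    intro ij
    rw [map_smul, ktK, ContinuousLinearMap.coe_coe, kennedyTasaki_K_Theta hm hn, Finset.smul_sum]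
    simp only [smul_smul]
  simp only [this]
  rw [Finset.sum_comm]
  refine Finset.sum_congr rfl fun rk _ => ?_
  rw [← Finset.sum_smul, Matrix.toLin'_apply, Matrix.mulVec_transpose]
  rfl

lemma aeval_ktK_thetaSum (hm : 1 ≤ m) (hn : 1 ≤ n) (p : ℂ[X]) (c : Fin 4 × Fin 4 → ℂ) :
    aeval (ktK m n) p (thetaSum m n c)
      = thetaSum m n (aeval (Matrix.toLin' (A m n).transpose) p c) := by
  induction p using Polynomial.induction_on' generalizing c with
  | add p q hp hq => simp only [map_add, LinearMap.add_apply, hp, hq]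
  | monomial k a =>
    simp only [aeval_monomial, Module.algebraMap_end_eq_smul_id, Module.End.mul_apply,
      LinearMap.smul_apply, LinearMap.id_coe, id_eq, map_smul]
    congr 1
    induction k generalizing c with
    | zero => simp
    | succ k ih => rw [pow_succ, pow_succ, Module.End.mul_apply, Module.End.mul_apply,
        ktK_thetaSum hm hn, ih]

/-- The nonzero eigenvalues of `K` are eigenvalues of `𝒜`. -/
lemma charpoly_eval_eq_zero (hm : 1 ≤ m) (hn : 1 ≤ n) {t : ℂ} (ht : t ≠ 0)
    {v : Chain (m + n + 1)} (hv : v ≠ 0) (h : ktK m n v = t • v) :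
    (A m n).charpoly.eval t = 0 := by
  have hmem : v ∈ LinearMap.range (thetaSum m n) := by
    rw [← Submodule.smul_mem_iff _ ht, ← h, thetaSum, Fintype.range_linearCombination]
    exact range_kennedyTasaki_K_le hm hn ⟨v, rfl⟩
  obtain ⟨c, rfl⟩ := hmem
  -- By Cayley–Hamilton the characteristic polynomial of `𝒜`, evaluated at `K`, annihilates the span
  -- of the `Θ_{ij}`, whether or not they are independent.
  have h1 := Module.End.aeval_apply_of_hasEigenvector (p := (A m n).charpoly)
    (Module.End.hasEigenvector_iff.2 ⟨Module.End.mem_eigenspace_iff.2 h, hv⟩)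
  rw [aeval_ktK_thetaSum hm hn, ← Matrix.charpoly_transpose, ← Matrix.charpoly_toLin',
    LinearMap.aeval_self_charpoly, LinearMap.zero_apply, map_zero, Matrix.charpoly_toLin',
    Matrix.charpoly_transpose] at h1
  exact (smul_eq_zero.1 h1.symm).resolve_right hv

/-- The nonzero eigenvalues of `𝒜` are eigenvalues of `K`. -/
lemma exists_eigenvector_ktK (hm : 1 ≤ m) (hn : 1 ≤ n) {t : ℂ} (ht : t ≠ 0)
    (h : (A m n).charpoly.eval t = 0) : ∃ v, v ≠ 0 ∧ ktK m n v = t • v := by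
  have h1 : Module.End.HasEigenvalue (Matrix.toLin' (A m n).transpose) t := by
    rw [Module.End.hasEigenvalue_iff_isRoot_charpoly, Matrix.charpoly_toLin',
      Matrix.charpoly_transpose]
    exact h
  obtain ⟨c, hc⟩ := h1.exists_hasEigenvector
  refine ⟨thetaSum m n c, fun h0 => hc.2 ?_, ?_⟩
  -- A linear relation between the `Θ_{ij}` would put the eigenvector into the left kernel of `𝒜`,
  -- against `t ≠ 0`. This covers `n = 1`, where such relations exist.
  · have h2 := vecMul_A_eq_zero hm h0
    have h3 := hc.apply_eq_smul
    rw [Matrix.toLin'_apply, Matrix.mulVec_transpose, h2] at h3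
    exact (smul_eq_zero.1 h3.symm).resolve_left ht
  · rw [ktK_thetaSum hm hn, hc.apply_eq_smul, map_smul]

lemma ktK_kennedyTasaki (ψ : Chain (m + n + 1)) :
    ktK m n (kennedyTasaki (m + n + 1) ψ) = kennedyTasaki (m + n + 1) (K m n ψ) := by
  rw [ktK, star_kennedyTasaki]
  change kennedyTasaki (m + n + 1) (K m n (kennedyTasaki (m + n + 1) (kennedyTasaki (m + n + 1) ψ))) = _
  rw [kennedyTasaki_apply_self]

/-- The two intervals share a site, so every bond of the union lies in one of them. -/
lemma groundSpace_inf (m n : ℕ) : groundSpace (m + n + 1) 0 m ⊓ groundSpace (m + n + 1) m (m + n)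
    = groundSpace (m + n + 1) 0 (m + n) := by
  ext ψ
  rw [Submodule.mem_inf, mem_groundSpace_iff, mem_groundSpace_iff, mem_groundSpace_iff]
  constructor
  · rintro ⟨h1, h2⟩ x y - hxy hy
    rcases le_or_gt (y : ℕ) m with h | h
    · exact h1 x y (Nat.zero_le _) hxy h
    · exact h2 x y (by omega) hxy hy
  · exact fun h => ⟨fun x y h1 h2 h3 => h x y h1 h2 (by omega),
      fun x y _ h2 h3 => h x y (Nat.zero_le _) h2 h3⟩

end Intertwine

/-! ### Estimates of the eigenvalues. -/

section Numerics

variable {m n : ℕ}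

lemma lam5_pos (hm : 1 ≤ m) (hn : 1 ≤ n) : 0 < lam5 m n := by
  rw [lam5_eq]
  obtain ⟨h1, h2⟩ := pow_neg_third_bounds hm
  obtain ⟨h3, h4⟩ := pow_neg_third_bounds hn
  have e1 : 0 < 1 - (-1 / 3 : ℝ) ^ m := by linarith
  have e2 : 0 < 1 - (-1 / 3 : ℝ) ^ n := by linarith
  have e3 : 0 < 3 + (-1 / 3 : ℝ) ^ m := by linarith
  have e4 : 0 < 3 + (-1 / 3 : ℝ) ^ n := by linarith
  positivity

lemma lamDen_pos (hm : 1 ≤ m) (hn : 1 ≤ n) :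
    0 < (3 + (-1 / 3 : ℝ) ^ m) * (3 + (-1 / 3 : ℝ) ^ n) := by
  obtain ⟨h1, h2⟩ := pow_neg_third_bounds hm
  obtain ⟨h3, h4⟩ := pow_neg_third_bounds hn
  exact mul_pos (by linarith) (by linarith)

lemma lam3minus_le_lam3plus (hm : 1 ≤ m) (hn : 1 ≤ n) : lam3minus m n ≤ lam3plus m n := by
  rw [lam3plus_eq, lam3minus_eq]
  refine div_le_div_of_nonneg_right ?_ (lamDen_pos hm hn).le
  linarith [Real.sqrt_nonneg (lamR m n)]

/-- The numerator of `λ_{3+}` is bounded by `c` if its square-root part is. -/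
lemma lam3plus_le {c d : ℝ} (hm : 1 ≤ m) (hn : 1 ≤ n) (hd : 0 ≤ d) (hR : 4 * lamR m n ≤ d ^ 2)
    (h : lamQ m n + d ≤ c * ((3 + (-1 / 3 : ℝ) ^ m) * (3 + (-1 / 3 : ℝ) ^ n))) :
    lam3plus m n ≤ c := by
  rw [lam3plus_eq, div_le_iff₀ (lamDen_pos hm hn)]
  have : Real.sqrt (lamR m n) ≤ d / 2 := Real.sqrt_le_iff.2 ⟨by linarith, by nlinarith⟩
  linarith

lemma lam_lt_one (hm : 1 ≤ m) (hn : 1 ≤ n) :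
    max (lam5 m n) (max (lam1 m n) (lam3plus m n)) < 1 := by
  have hD := lamDen_pos hm hn
  -- The constants `9/10` and `d = 2` are crude; any bound below 1 would do.
  have h9 : lam3plus m n ≤ 9 / 10 := by
    refine lam3plus_le (d := 2) hm hn (by norm_num) ?_ ?_
    · rw [lamR_eq]
      obtain ⟨h1, h2⟩ := pow_neg_third_bounds hm
      obtain ⟨h3, h4⟩ := pow_neg_third_bounds hn
      generalize (-1 / 3 : ℝ) ^ m = x at *
      generalize (-1 / 3 : ℝ) ^ n = y at *
      have hp : 0 ≤ (1 + x) * (1 + y) := by nlinarith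
      have hq : (1 + x) * (1 + y) ≤ 100 / 81 := by nlinarith
      have hxy : x * y ≤ 1 / 9 := by nlinarith
      have hxy' : -(1 / 9) ≤ x * y := by nlinarith
      have hpq : x * y * ((1 + x) * (1 + y)) ≤ 1 / 9 * (100 / 81) := by
        nlinarith [mul_nonneg hp (sub_nonneg.2 hxy)]
      have hd : (x - y) ^ 2 ≤ 16 / 81 := by
        have : |x - y| ≤ 4 / 9 := abs_le.2 ⟨by linarith, by linarith⟩
        nlinarith [sq_abs (x - y), abs_nonneg (x - y)]
      nlinarith [sq_nonneg (x * y)]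
    · rw [lamQ]
      obtain ⟨h1, h2⟩ := pow_neg_third_bounds hm
      obtain ⟨h3, h4⟩ := pow_neg_third_bounds hn
      generalize (-1 / 3 : ℝ) ^ m = x at *
      generalize (-1 / 3 : ℝ) ^ n = y at *
      nlinarith
  refine max_lt ?_ (max_lt ?_ (by linarith))
  · rw [lam5_eq, div_lt_one hD]
    obtain ⟨h1, h2⟩ := pow_neg_third_bounds hm
    obtain ⟨h3, h4⟩ := pow_neg_third_bounds hn
    nlinarith
  · rw [lam1_eq hm hn, div_lt_one hD]
    obtain ⟨h1, h2⟩ := pow_neg_third_bounds hm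
    obtain ⟨h3, h4⟩ := pow_neg_third_bounds hn
    nlinarith

end Numerics

/-- The supremum is attained at an eigenvector of `K` for the largest eigenvalue other than 1. It
lies strictly between 0 and 1, so such an eigenvector is automatically in `𝒢(-m,0)` and orthogonal
to `𝒢(-m,n)`. -/
theorem eps_eq {m n : ℕ} (hm : 1 ≤ m) (hn : 1 ≤ n) :
    eps m n = max (lam5 m n) (max (lam1 m n) (lam3plus m n)) := by
  set Λ := max (lam5 m n) (max (lam1 m n) (lam3plus m n)) with hΛ
  have hpos : 0 < Λ := (lam5_pos hm hn).trans_le (le_max_left _ _)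
  have hlt : Λ < 1 := lam_lt_one hm hn
  have hroot : ∀ t : ℝ, (A m n).charpoly.eval (t : ℂ) = 0 ↔
      t = 1 ∨ t = lam5 m n ∨ t = lam1 m n ∨ t = lam3plus m n ∨ t = lam3minus m n := by
    intro t
    rw [charpoly_A hm hn]
    simp only [eval_mul, eval_pow, eval_sub, eval_X, eval_C, mul_eq_zero, pow_eq_zero_iff,
      ne_eq, OfNat.ofNat_ne_zero, not_false_eq_true, sub_eq_zero, Complex.ofReal_inj,
      Complex.ofReal_eq_one]
    tauto
  refine IsGreatest.csSup_eq ⟨?_, ?_⟩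
  · have h : (A m n).charpoly.eval (Λ : ℂ) = 0 := by
      rw [hroot, hΛ]
      rcases max_choice (lam5 m n) (max (lam1 m n) (lam3plus m n)) with h | h
      · exact Or.inr (Or.inl h)
      · rw [h]
        rcases max_choice (lam1 m n) (lam3plus m n) with h | h <;> rw [h] <;> tauto
    obtain ⟨v, hv, hKv⟩ := exists_eigenvector_ktK hm hn (by exact_mod_cast hpos.ne') h
    set w := kennedyTasaki (m + n + 1) v with hw
    have hwv : kennedyTasaki (m + n + 1) w = v := kennedyTasaki_apply_self v
    have hw0 : w ≠ 0 := fun h0 => hv (by rw [← hwv, h0, map_zero])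
    have hKw : K m n w = (Λ : ℂ) • w := by
      rw [← kennedyTasaki_apply_self (K m n w), ← ktK_kennedyTasaki, hwv, hKv, map_smul]
    obtain ⟨h1, h2, h3⟩ := mem_of_eigenvector hpos.ne' hlt.ne hKw
    rw [groundSpace_inf] at h2
    have hn0 : ‖w‖ ≠ 0 := norm_ne_zero_iff.2 hw0
    refine ⟨((‖w‖⁻¹ : ℝ) : ℂ) • w, Submodule.smul_mem _ _ h1, Submodule.smul_mem _ _ h2, ?_, ?_⟩
    · rw [norm_smul, Complex.norm_real, norm_inv, norm_norm, inv_mul_cancel₀ hn0]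
    · rw [map_smul, inner_smul_left, inner_smul_right, Complex.conj_ofReal, Complex.re_ofReal_mul,
        Complex.re_ofReal_mul]
      change _ = _ * (_ * (inner ℂ w ((groundSpace (m + n + 1) m (m + n)).starProjection w)).re)
      rw [h3]
      field_simp
  · rintro _ ⟨ψ, h1, h2, h3, rfl⟩
    rw [← groundSpace_inf] at h2
    have := re_inner_starProjection_le (c := Λ) (fun t v hv h => ?_) h1 h2
    · rw [h3] at this
      simpa [groundProj] using this
    -- The eigenvalue 0 of `K` need not come from `𝒜`, but it does not exceed `Λ`.
    by_cases ht : t = 0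
    · exact Or.inr (ht ▸ hpos.le)
    have hev : (A m n).charpoly.eval (t : ℂ) = 0 := by
      refine charpoly_eval_eq_zero hm hn (v := kennedyTasaki (m + n + 1) v) (by exact_mod_cast ht)
        (fun h0 => hv ?_) ?_
      · rw [← kennedyTasaki_apply_self v, h0, map_zero]
      · rw [ktK_kennedyTasaki]
        change kennedyTasaki (m + n + 1) (Submodule.starProjection _ (Submodule.starProjection _
          (Submodule.starProjection _ v))) = _
        rw [h, map_smul]
    have h5 : lam5 m n ≤ Λ := le_max_left _ _
    have h1' : lam1 m n ≤ Λ := (le_max_left _ _).trans (le_max_right _ _)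
    have h3' : lam3plus m n ≤ Λ := (le_max_right _ _).trans (le_max_right _ _)
    have h4' := lam3minus_le_lam3plus hm hn
    rcases (hroot t).1 hev with h | h | h | h | h
    · exact Or.inl h
    all_goals exact Or.inr (by linarith)

lemma lam5_one_one : lam5 1 1 = 1 / 4 := by rw [lam5_eq]; norm_num

lemma lam5_three_three : lam5 3 3 = (7 / 20) ^ 2 := by rw [lam5_eq]; norm_num

/-- For fixed `n`, `λ_5` decreases in `(-1/3)^m`, so its maximum over `m ≥ 1` is at `m = 1`, where
it equals `1/4`. -/
lemma lam_le_of_one {m : ℕ} (hm : 1 ≤ m) :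
    max (lam5 m 1) (max (lam1 m 1) (lam3plus m 1)) ≤ 1 / 4 := by
  have hD := lamDen_pos hm le_rfl
  obtain ⟨h1, h2⟩ := pow_neg_third_bounds hm
  refine max_le ?_ (max_le ?_ ?_)
  · rw [lam5_eq, div_le_iff₀ hD]
    nlinarith
  · rw [lam1_eq hm le_rfl, div_le_iff₀ hD]
    nlinarith
  -- For `n = 1` the number `4R` is a perfect square, and `d` is its root.
  · refine lam3plus_le (d := 2 / 3 + 46 / 27 * (-1 / 3) ^ m) hm le_rfl (by linarith) ?_ ?_
    · rw [lamR_eq]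
      nlinarith
    · rw [lamQ]
      nlinarith

lemma lam_le_of_three {m : ℕ} (hm : 3 ≤ m) :
    max (lam5 m 3) (max (lam1 m 3) (lam3plus m 3)) ≤ (7 / 20) ^ 2 := by
  have hm1 : 1 ≤ m := by omega
  have hD := lamDen_pos hm1 (by norm_num : 1 ≤ 3)
  obtain ⟨h1, h2⟩ : -(1 / 27) ≤ (-1 / 3 : ℝ) ^ m ∧ (-1 / 3 : ℝ) ^ m ≤ 1 / 81 := by
    obtain ⟨k, rfl⟩ := Nat.exists_eq_add_of_le hm
    obtain ⟨h1, h2⟩ := pow_neg_third_bounds (N := 1 + k) (by omega)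
    rw [show 3 + k = 1 + k + 2 by ring, pow_add]
    constructor <;> linarith
  refine max_le ?_ (max_le ?_ ?_)
  · rw [lam5_eq, div_le_iff₀ hD]
    norm_num at *
    nlinarith
  · rw [lam1_eq hm1 (by norm_num), div_le_iff₀ hD]
    norm_num at *
    nlinarith
  -- An affine upper bound for `2√R` with room to spare; its slope makes both sides of the final
  -- inequality vary nearly equally with `(-1/3)^m`.
  · refine lam3plus_le (d := 12 / 100 - 7 / 10 * (-1 / 3) ^ m) hm1 (by norm_num) (by linarith) ?_ ?_
    · rw [lamR_eq]
      norm_num at *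
      nlinarith
    · rw [lamQ]
      norm_num at *
      nlinarith

lemma eps_one_one : eps 1 1 = 1 / 4 := by
  rw [eps_eq le_rfl le_rfl]
  exact le_antisymm (lam_le_of_one le_rfl) (lam5_one_one ▸ le_max_left _ _)

lemma eps_three_three : eps 3 3 = (7 / 20) ^ 2 := by
  rw [eps_eq (by norm_num) (by norm_num)]
  exact le_antisymm (lam_le_of_three le_rfl) (lam5_three_three ▸ le_max_left _ _)

lemma epsSup_eq_of_forall_le {m n : ℕ} {c : ℝ} (h : ∀ k, m ≤ k → eps k n ≤ c) (hc : eps m n = c) :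
    epsSup m n = c := by
  refine IsLUB.ciSup_eq ⟨?_, fun b hb => ?_⟩
  · rintro _ ⟨k, rfl⟩
    exact h k k.2
  · exact hc ▸ hb ⟨⟨m, le_refl m⟩, rfl⟩

lemma epsSup_one_one : epsSup 1 1 = 1 / 4 :=
  epsSup_eq_of_forall_le (fun _ hk => eps_eq hk le_rfl ▸ lam_le_of_one hk) eps_one_one

lemma epsSup_three_three : epsSup 3 3 = (7 / 20) ^ 2 :=
  epsSup_eq_of_forall_le (fun _ hk => (eps_eq (le_trans (by norm_num : 1 ≤ 3) hk)
    (by norm_num : 1 ≤ 3)).trans_le (lam_le_of_three hk)) eps_three_three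

end AKLT

end

/-! ### Angles between neighbouring bond projections: functions of three and four sites. -/

noncomputable section

namespace AKLT

open Complex

section Local

/-- The projection of real two-site functions onto spin 2. -/
def twoProj (h : Fin 3 → Fin 3 → ℝ) (a b : Fin 3) : ℝ :=
  ∑ s, ∑ t, (quintProj (a, b) (s, t) : ℝ) / 6 * h s t

lemma twoProj_eq (h : Fin 3 → Fin 3 → ℝ) (a b : Fin 3) :
    twoProj h a b = ![![h 0 0, (h 0 1 + h 1 0) / 2, (h 0 2 + 2 * h 1 1 + h 2 0) / 6],
      ![(h 0 1 + h 1 0) / 2, (h 0 2 + 2 * h 1 1 + h 2 0) / 3, (h 1 2 + h 2 1) / 2],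
      ![(h 0 2 + 2 * h 1 1 + h 2 0) / 6, (h 1 2 + h 2 1) / 2, h 2 2]] a b := by
  fin_cases a <;> fin_cases b <;>
    simp [twoProj, Fin.sum_univ_three, quintProj, Fin.sum_univ_five, quint, quintNorm] <;>
    norm_num <;> ring

/-- The components of a real two-site function along the spins 0 and 1. -/
def lowPart (i : Fin 4) (h : Fin 3 → Fin 3 → ℝ) : ℝ :=
  ![h 0 2 - h 1 1 + h 2 0, h 0 1 - h 1 0, h 0 2 - h 2 0, h 1 2 - h 2 1] i

/-- The inverse square norms of the vectors of spins 0 and 1. -/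
def lowWeight : Fin 4 → ℝ := ![1 / 3, 1 / 2, 1 / 2, 1 / 2]

/-- The complement of spin 2 is spanned by the orthogonal vectors of spin 0 (the first one) and spin
1 (the other three). -/
lemma sum_sq_sub_twoProj (h : Fin 3 → Fin 3 → ℝ) :
    ∑ a, ∑ b, (h a b - twoProj h a b) ^ 2 = ∑ i, lowWeight i * lowPart i h ^ 2 := by
  simp only [twoProj_eq, Fin.sum_univ_three, Fin.sum_univ_four, lowPart, lowWeight]
  simp
  ring

lemma sum_sq_twoProj (h : Fin 3 → Fin 3 → ℝ) :
    ∑ a, ∑ b, twoProj h a b ^ 2 = h 0 0 ^ 2 + (h 0 1 + h 1 0) ^ 2 / 2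
      + (h 0 2 + 2 * h 1 1 + h 2 0) ^ 2 / 6 + (h 1 2 + h 2 1) ^ 2 / 2 + h 2 2 ^ 2 := by
  simp only [twoProj_eq, Fin.sum_univ_three]
  simp
  ring

lemma eq_of_twoProj_eq_zero {h : Fin 3 → Fin 3 → ℝ} (h0 : ∀ a b, twoProj h a b = 0) :
    h 0 0 = 0 ∧ h 2 2 = 0 ∧ h 1 0 = -h 0 1 ∧ h 2 1 = -h 1 2 ∧ h 1 1 = -(h 0 2 + h 2 0) / 2 := by
  have e := fun a b => (twoProj_eq h a b).symm.trans (h0 a b)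
  have e1 := e 0 0
  have e2 := e 2 2
  have e3 := e 0 1
  have e4 := e 1 2
  have e5 := e 1 1
  simp at e1 e2 e3 e4 e5
  exact ⟨e1, e2, by linarith, by linarith, by linarith⟩

/-- On the functions of three sites without spin 2 at the last two sites, the projection onto spin 2
at the first two sites is at a small angle. -/
lemma three_site (f : Fin 3 → Fin 3 → Fin 3 → ℝ)
    (h : ∀ b c d, twoProj (f b) c d = 0) :
    2 / 3 * ∑ b, ∑ c, ∑ d, twoProj (fun b c => f b c d) b c ^ 2
      ≤ ∑ b, ∑ c, ∑ d, (twoProj (fun b c => f b c d) b c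
        - twoProj (fun c d => twoProj (fun b c => f b c d) b c) c d) ^ 2 := by
  have hr : ∀ b, ∑ c, ∑ d, (twoProj (fun b c => f b c d) b c
        - twoProj (fun c d => twoProj (fun b c => f b c d) b c) c d) ^ 2
      = ∑ i, lowWeight i * lowPart i (fun c d => twoProj (fun b c => f b c d) b c) ^ 2 :=
    fun b => sum_sq_sub_twoProj _
  have hl : ∑ b, ∑ c, ∑ d, twoProj (fun b c => f b c d) b c ^ 2
      = ∑ d, ∑ b, ∑ c, twoProj (fun b c => f b c d) b c ^ 2 := by
    simp only [Fin.sum_univ_three]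
    ring
  rw [hl]
  simp only [hr, sum_sq_twoProj]
  have e := fun b => eq_of_twoProj_eq_zero (h b)
  have e1 := fun b => (e b).1
  have e2 := fun b => (e b).2.1
  have e3 := fun b => (e b).2.2.1
  have e4 := fun b => (e b).2.2.2.1
  have e5 := fun b => (e b).2.2.2.2
  rw [← sub_nonneg]
  -- Once the values determined by the kernel equations are eliminated, the difference is a
  -- quadratic form in the remaining ones, and completing squares shows that it is nonnegative.
  have key : ∑ b, ∑ i, lowWeight i * lowPart i (fun c d => twoProj (fun b c => f b c d) b c) ^ 2
      - 2 / 3 * ∑ d, (f 0 0 d ^ 2 + (f 0 1 d + f 1 0 d) ^ 2 / 2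
      + (f 0 2 d + 2 * f 1 1 d + f 2 0 d) ^ 2 / 6 + (f 1 2 d + f 2 1 d) ^ 2 / 2 + f 2 2 d ^ 2)
      = 1/8 * f 0 0 1 ^ 2
        + 29/96 * (f 0 0 2 + 23/87 * f 0 2 0 - 46/87 * f 1 0 1) ^ 2
        + 4/27 * (f 0 1 2 + f 1 0 2 + 23/32 * f 1 2 0 - 23/32 * f 2 0 1) ^ 2
        + 55/2088 * (f 0 2 0 - 2 * f 1 0 1) ^ 2
        + 41/216 * (f 1 1 2 + 1/2 * f 2 0 2 + 69/82 * f 2 2 0) ^ 2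
        + 55/768 * (f 1 2 0 - f 2 0 1) ^ 2
        + 1/8 * f 2 1 2 ^ 2
        + 55/328 * f 2 2 0 ^ 2 := by
    simp only [twoProj_eq, Fin.sum_univ_three, Fin.sum_univ_four, lowPart, lowWeight, e1, e2, e3, e4,
      e5]
    simp
    ring
  rw [key]
  positivity

/-- On the functions of four sites without spin 2 at the first two and at the last two sites, the
projection onto spin 2 at the two middle sites is at a small angle. -/
lemma four_site (f : Fin 3 → Fin 3 → Fin 3 → Fin 3 → ℝ)
    (h1 : ∀ a b c d, twoProj (fun a b => f a b c d) a b = 0)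
    (h2 : ∀ a b c d, twoProj (f a b) c d = 0)
    {g : Fin 3 → Fin 3 → Fin 3 → Fin 3 → ℝ}
    (hg : ∀ a b c d, g a b c d = twoProj (fun b c => f a b c d) b c) :
    2 / 3 * ∑ a, ∑ b, ∑ c, ∑ d, g a b c d ^ 2
      ≤ ∑ a, ∑ b, ∑ c, ∑ d, (g a b c d - twoProj (fun a b => g a b c d) a b - twoProj (g a b) c d
          + twoProj (fun a b => twoProj (g a b) c d) a b) ^ 2 := by
  -- The summand is the square of `(1 - P) ⊗ (1 - P)` applied to `g`, with `P` the spin-2 projection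
  -- of the first and of the last pair. It is expanded in the vectors of spin 0 and 1 of both pairs.
  have hr : ∑ a, ∑ b, ∑ c, ∑ d, (g a b c d - twoProj (fun a b => g a b c d) a b
        - twoProj (g a b) c d + twoProj (fun a b => twoProj (g a b) c d) a b) ^ 2
      = ∑ i, lowWeight i * ∑ j, lowWeight j * lowPart j (fun c d =>
          lowPart i (fun a b => g a b c d)) ^ 2 := by
    have e1 : ∀ a b c d, g a b c d - twoProj (fun a b => g a b c d) a b
        - twoProj (g a b) c d + twoProj (fun a b => twoProj (g a b) c d) a b
        = (fun a b => g a b c d - twoProj (g a b) c d) a b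
          - twoProj (fun a b => g a b c d - twoProj (g a b) c d) a b := by
      intro a b c d
      have : twoProj (fun a b => g a b c d - twoProj (g a b) c d) a b
          = twoProj (fun a b => g a b c d) a b - twoProj (fun a b => twoProj (g a b) c d) a b := by
        rw [twoProj, twoProj, twoProj]
        simp only [mul_sub, Finset.sum_sub_distrib]
      rw [this]
      ring
    have e2 : ∀ i c d, lowPart i (fun a b => g a b c d - twoProj (g a b) c d)
        = lowPart i (fun a b => g a b c d)
          - twoProj (fun c d => lowPart i (fun a b => g a b c d)) c d := by
      intro i c d
      simp only [twoProj, Fin.sum_univ_three]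
      fin_cases i <;> simp [lowPart] <;> ring
    simp only [e1]
    have swap : ∀ F : Fin 3 → Fin 3 → Fin 3 → Fin 3 → ℝ, ∑ a, ∑ b, ∑ c, ∑ d, F a b c d
        = ∑ c, ∑ d, ∑ a, ∑ b, F a b c d := by
      intro F
      simp only [Fin.sum_univ_three]
      ring
    rw [swap]
    simp only [sum_sq_sub_twoProj]
    have swap' : ∀ F : Fin 3 → Fin 3 → Fin 4 → ℝ, ∑ c, ∑ d, ∑ i, F c d i
        = ∑ i, ∑ c, ∑ d, F c d i := by
      intro F
      simp only [Fin.sum_univ_three, Fin.sum_univ_four]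
      ring
    rw [swap']
    simp only [← Finset.mul_sum, e2, sum_sq_sub_twoProj]
  have hl : ∑ a, ∑ b, ∑ c, ∑ d, g a b c d ^ 2
      = ∑ a, ∑ d, ∑ b, ∑ c, twoProj (fun b c => f a b c d) b c ^ 2 := by
    simp only [hg, Fin.sum_univ_three]
    ring
  rw [hr, hl]
  simp only [sum_sq_twoProj]
  have e := fun c d => eq_of_twoProj_eq_zero (fun a b => h1 a b c d)
  have e' := fun a b => eq_of_twoProj_eq_zero (h2 a b)
  have e1 := fun c d => (e c d).1
  have e2 := fun c d => (e c d).2.1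
  have e3 := fun c d => (e c d).2.2.1
  have e4 := fun c d => (e c d).2.2.2.1
  have e5 := fun c d => (e c d).2.2.2.2
  have e1' := fun a b => (e' a b).1
  have e2' := fun a b => (e' a b).2.1
  have e3' := fun a b => (e' a b).2.2.1
  have e4' := fun a b => (e' a b).2.2.2.1
  have e5' := fun a b => (e' a b).2.2.2.2
  rw [← sub_nonneg]
  -- Again the kernel equations, now for both outer pairs, eliminate the dependent values, and the
  -- rest is completed to squares.
  have key : ∑ i, lowWeight i * ∑ j, lowWeight j * lowPart j (fun c d =>
          lowPart i (fun a b => g a b c d)) ^ 2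
      - 2 / 3 * ∑ a, ∑ d, (f a 0 0 d ^ 2 + (f a 0 1 d + f a 1 0 d) ^ 2 / 2
      + (f a 0 2 d + 2 * f a 1 1 d + f a 2 0 d) ^ 2 / 6 + (f a 1 2 d + f a 2 1 d) ^ 2 / 2
      + f a 2 2 d ^ 2)
      = 55/432 * (f 0 1 0 2 + 9/11 * f 0 1 2 0 - 9/11 * f 0 2 0 1 - 7/11 * f 2 0 0 1) ^ 2
        + 125/648 * (f 0 1 1 2 + 1/2 * f 0 2 0 2 + 22/25 * f 0 2 2 0
          + 19/25 * f 1 2 0 1 + 22/25 * f 2 0 0 2 + 19/50 * f 2 0 2 0) ^ 2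
        + 5/264 * (f 0 1 2 0 - f 0 2 0 1 - 2 * f 2 0 0 1) ^ 2
        + 55/432 * (f 0 2 1 2 - 9/11 * f 1 2 0 2 - 7/11 * f 1 2 2 0 + 9/11 * f 2 0 1 2) ^ 2
        + 269/2160 * (f 0 2 2 0 + 88/269 * f 1 2 0 1 - 181/269 * f 2 0 0 2 + 44/269 * f 2 0 2 0) ^ 2
        + 55/807 * (f 1 2 0 1 + f 2 0 0 2 + 1/2 * f 2 0 2 0) ^ 2
        + 5/264 * (f 1 2 0 2 + 2 * f 1 2 2 0 - f 2 0 1 2) ^ 2 := by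
    simp only [hg, twoProj_eq, Fin.sum_univ_three, Fin.sum_univ_four, lowPart, lowWeight]
    simp [e1, e2, e3, e4, e5, e1', e2', e3', e4', e5']
    ring
  rw [key]
  positivity

end Local

end AKLT

end

/-! ### Transfer of the local inequalities to the chain. -/

noncomputable section

namespace AKLT

open Complex

section Transfer

variable {L : ℕ} {x y z w : Fin L}

lemma sum_update (x : Fin L) (F : (Fin L → Fin 3) → ℝ) :
    ∑ σ, F σ = (1 / 3) * ∑ σ, ∑ s, F (Function.update σ x s) := by
  let e : (Fin L → Fin 3) × Fin 3 → (Fin L → Fin 3) × Fin 3 :=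
    fun p => (Function.update p.1 x p.2, p.1 x)
  have he : Function.Involutive e := by
    rintro ⟨σ, s⟩
    simp [e]
  have h : ∑ σ, ∑ s, F (Function.update σ x s) = ∑ σ, ∑ _s : Fin 3, F σ := by
    rw [← Fintype.sum_prod_type', ← Fintype.sum_prod_type']
    exact Fintype.sum_equiv he.toPerm _ _ fun p => rfl
  rw [h]
  simp [← Finset.mul_sum]

/-- Real-linear coordinates of the values of `bond x y ψ`. -/
lemma coord_bond (hxy : x ≠ y) (ρ : ℂ →ₗ[ℝ] ℝ) (ψ : Chain L) (σ : Fin L → Fin 3) :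
    ρ (bond x y ψ σ) = twoProj (fun s t => ρ (ψ (upd2 σ x y s t))) (σ x) (σ y) := by
  rw [bond_apply hxy, twoProj, map_sum]
  refine Finset.sum_congr rfl fun s _ => ?_
  rw [map_sum]
  refine Finset.sum_congr rfl fun t _ => ?_
  have : (quintProj (σ x, σ y) (s, t) : ℂ) / 6 * ψ (upd2 σ x y s t)
      = ((quintProj (σ x, σ y) (s, t) : ℝ) / 6 : ℝ) • ψ (upd2 σ x y s t) := by
    rw [Complex.real_smul]
    push_cast
    rfl
  rw [this, map_smul, smul_eq_mul]

lemma norm_sq_eq_sum (ψ : Chain L) :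
    ‖ψ‖ ^ 2 = ∑ σ, reLm (ψ σ) ^ 2 + ∑ σ, imLm (ψ σ) ^ 2 := by
  rw [EuclideanSpace.norm_sq_eq, ← Finset.sum_add_distrib]
  refine Finset.sum_congr rfl fun σ _ => ?_
  rw [← Complex.normSq_eq_norm_sq, Complex.normSq_apply]
  simp [sq]

/-- The configuration `σ` with the values at three sites replaced. -/
def upd3 (σ : Fin L → Fin 3) (x y z : Fin L) (a b c : Fin 3) : Fin L → Fin 3 :=
  Function.update (upd2 σ x y a b) z c

lemma sum_upd3 (hxy : x ≠ y) (z : Fin L) (F : (Fin L → Fin 3) → ℝ) :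
    ∑ σ, F σ = (1 / 27) * ∑ σ, ∑ a, ∑ b, ∑ c, F (upd3 σ x y z a b c) := by
  rw [sum_update z, sum_upd2 hxy]
  simp only [upd3]
  ring

/-- The configuration `σ` with the values at four sites replaced. -/
def upd4 (σ : Fin L → Fin 3) (x y z w : Fin L) (a b c d : Fin 3) : Fin L → Fin 3 :=
  upd2 (upd2 σ x y a b) z w c d

lemma sum_upd4 (hxy : x ≠ y) (hzw : z ≠ w) (F : (Fin L → Fin 3) → ℝ) :
    ∑ σ, F σ = (1 / 81) * ∑ σ, ∑ a, ∑ b, ∑ c, ∑ d, F (upd4 σ x y z w a b c d) := by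
  rw [sum_upd2 hzw, sum_upd2 hxy]
  simp only [upd4]
  ring

/-- The projections have real matrices, so real and imaginary parts can be treated separately; with
the other spins frozen, each is a real function of three sites. -/
lemma three_site_bond (hxy : x ≠ y) (hxz : x ≠ z) (hyz : y ≠ z) {ψ : Chain L}
    (h : bond y z ψ = 0) :
    2 / 3 * ‖bond x y ψ‖ ^ 2 ≤ ‖bond x y ψ - bond y z (bond x y ψ)‖ ^ 2 := by
  have hxy' : ∀ (ρ : ℂ →ₗ[ℝ] ℝ) (χ : Chain L) σ a b c, ρ (bond x y χ (upd3 σ x y z a b c))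
      = twoProj (fun a b => ρ (χ (upd3 σ x y z a b c))) a b := by
    intro ρ χ σ a b c
    rw [coord_bond hxy]
    congr 1
    · funext s t
      refine congrArg (fun τ => ρ (χ τ)) ?_
      ext u
      simp only [upd3, upd2, Function.update_apply]
      split_ifs <;> simp_all
    · simp [upd3, upd2, hxy, hxz]
    · simp [upd3, upd2, hyz]
  have hyz' : ∀ (ρ : ℂ →ₗ[ℝ] ℝ) (χ : Chain L) σ a b c, ρ (bond y z χ (upd3 σ x y z a b c))
      = twoProj (fun b c => ρ (χ (upd3 σ x y z a b c))) b c := by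
    intro ρ χ σ a b c
    rw [coord_bond hyz]
    congr 1
    · funext s t
      refine congrArg (fun τ => ρ (χ τ)) ?_
      ext u
      simp only [upd3, upd2, Function.update_apply]
      split_ifs <;> simp_all
    · simp [upd3, upd2, hyz]
    · simp [upd3]
  have key : ∀ ρ : ℂ →ₗ[ℝ] ℝ, 2 / 3 * ∑ σ, ρ (bond x y ψ σ) ^ 2
      ≤ ∑ σ, ρ ((bond x y ψ - bond y z (bond x y ψ)) σ) ^ 2 := by
    intro ρ
    rw [sum_upd3 hxy z, sum_upd3 hxy z fun σ => ρ ((bond x y ψ - bond y z (bond x y ψ)) σ) ^ 2,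
      mul_left_comm, Finset.mul_sum (a := (2 / 3 : ℝ))]
    refine mul_le_mul_of_nonneg_left (Finset.sum_le_sum fun σ _ => ?_) (by norm_num)
    have := three_site (fun a b c => ρ (ψ (upd3 σ x y z a b c))) fun a b c => by
      rw [← hyz', h]; simp
    simpa only [PiLp.sub_apply, map_sub, hyz', hxy'] using this
  rw [norm_sq_eq_sum, norm_sq_eq_sum, mul_add]
  exact add_le_add (key reLm) (key imLm)

lemma four_site_bond (hxy : x ≠ y) (hxz : x ≠ z) (hyz : y ≠ z) (hxw : x ≠ w) (hyw : y ≠ w)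
    (hzw : z ≠ w) {ψ : Chain L} (h1 : bond x y ψ = 0) (h2 : bond z w ψ = 0) :
    2 / 3 * ‖bond y z ψ‖ ^ 2 ≤ ‖bond y z ψ - bond x y (bond y z ψ) - bond z w (bond y z ψ)
      + bond x y (bond z w (bond y z ψ))‖ ^ 2 := by
  have hxy' : ∀ (ρ : ℂ →ₗ[ℝ] ℝ) (χ : Chain L) σ a b c d, ρ (bond x y χ (upd4 σ x y z w a b c d))
      = twoProj (fun a b => ρ (χ (upd4 σ x y z w a b c d))) a b := by
    intro ρ χ σ a b c d
    rw [coord_bond hxy]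
    congr 1
    · funext s t
      refine congrArg (fun τ => ρ (χ τ)) ?_
      ext u
      simp only [upd4, upd2, Function.update_apply]
      split_ifs <;> simp_all
    · simp [upd4, upd2, hxy, hxz, hxw]
    · simp [upd4, upd2, hyz, hyw]
  have hzw' : ∀ (ρ : ℂ →ₗ[ℝ] ℝ) (χ : Chain L) σ a b c d, ρ (bond z w χ (upd4 σ x y z w a b c d))
      = twoProj (fun c d => ρ (χ (upd4 σ x y z w a b c d))) c d := by
    intro ρ χ σ a b c d
    rw [coord_bond hzw]
    congr 1
    · funext s t
      exact congrArg (fun τ => ρ (χ τ)) (upd2_upd2 hzw _ _ _ _ _)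
    · exact upd2_left hzw _ _ _
    · exact upd2_right _ _ _
  have hyz' : ∀ (ρ : ℂ →ₗ[ℝ] ℝ) (χ : Chain L) σ a b c d, ρ (bond y z χ (upd4 σ x y z w a b c d))
      = twoProj (fun b c => ρ (χ (upd4 σ x y z w a b c d))) b c := by
    intro ρ χ σ a b c d
    rw [coord_bond hyz]
    congr 1
    · funext s t
      refine congrArg (fun τ => ρ (χ τ)) ?_
      ext u
      simp only [upd4, upd2, Function.update_apply]
      split_ifs <;> simp_all
    · simp [upd4, upd2, hyz, hyw]
    · simp [upd4, upd2, hzw]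
  have key : ∀ ρ : ℂ →ₗ[ℝ] ℝ, 2 / 3 * ∑ σ, ρ (bond y z ψ σ) ^ 2
      ≤ ∑ σ, ρ ((bond y z ψ - bond x y (bond y z ψ) - bond z w (bond y z ψ)
      + bond x y (bond z w (bond y z ψ))) σ) ^ 2 := by
    intro ρ
    rw [sum_upd4 hxy hzw, sum_upd4 hxy hzw fun σ => ρ ((bond y z ψ - bond x y (bond y z ψ)
      - bond z w (bond y z ψ) + bond x y (bond z w (bond y z ψ))) σ) ^ 2,
      mul_left_comm, Finset.mul_sum (a := (2 / 3 : ℝ))]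
    refine mul_le_mul_of_nonneg_left (Finset.sum_le_sum fun σ _ => ?_) (by norm_num)
    have := four_site (fun a b c d => ρ (ψ (upd4 σ x y z w a b c d)))
      (fun a b c d => by rw [← hxy', h1]; simp) (fun a b c d => by rw [← hzw', h2]; simp)
      fun a b c d => hyz' ρ ψ σ a b c d
    simpa only [PiLp.sub_apply, PiLp.add_apply, map_sub, map_add, hxy', hzw'] using this
  rw [norm_sq_eq_sum, norm_sq_eq_sum, mul_add]
  exact add_le_add (key reLm) (key imLm)

lemma bond_comm (x y : Fin L) : bond x y = bond y x := by
  simp only [bond, totalSpinSq, add_comm]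

lemma bond_bond_comm (hxy : x ≠ y) (hzw : z ≠ w) (hxz : x ≠ z) (hxw : x ≠ w) (hyz : y ≠ z)
    (hyw : y ≠ w) (ψ : Chain L) : bond x y (bond z w ψ) = bond z w (bond x y ψ) := by
  ext σ
  simp only [bond_apply hxy, bond_apply hzw, upd2_of_ne hxz.symm hyz.symm,
    upd2_of_ne hxw.symm hyw.symm, upd2_of_ne hxz hxw, upd2_of_ne hyz hyw,
    upd2_comm hxz hxw hyz hyw]
  simp only [Fin.sum_univ_three]
  ring

end Transfer

end AKLT

end

/-! ### Windows of three consecutive projections. -/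

noncomputable section

namespace AKLT

open Complex

section Window

variable {E : Type*} [NormedAddCommGroup E] [InnerProductSpace ℝ E]

/-- The mixed terms of a sum of vectors, if those at distance three or more are nonnegative. -/
lemma sum_le_norm_sq_sum {v : ℕ → E} (h0 : v 0 = 0) (h1 : v 1 = 0)
    (hfar : ∀ j k, j + 3 ≤ k → 0 ≤ inner ℝ (v j) (v k)) (n : ℕ) :
    ∑ k ∈ Finset.range n, (‖v (k + 2)‖ ^ 2 + 2 * inner ℝ (v (k + 1)) (v (k + 2))
      + 2 * inner ℝ (v k) (v (k + 2))) ≤ ‖∑ k ∈ Finset.range n, v (k + 2)‖ ^ 2 := by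
  induction n with
  | zero => simp
  | succ n ih =>
    rw [Finset.sum_range_succ, Finset.sum_range_succ, norm_add_sq_real]
    -- Of the products of the new vector with the earlier ones only the last two are kept. In the
    -- first two steps these involve `v 0` and `v 1`, which vanish.
    have key : inner ℝ (v (n + 1)) (v (n + 2)) + inner ℝ (v n) (v (n + 2))
        ≤ inner ℝ (∑ k ∈ Finset.range n, v (k + 2)) (v (n + 2)) := by
      match n with
      | 0 => simp [h0, h1]
      | 1 => simp [h1]
      | n + 2 =>
        rw [Finset.sum_range_succ, Finset.sum_range_succ, inner_add_left, inner_add_left, sum_inner]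
        have : 0 ≤ ∑ k ∈ Finset.range n, inner ℝ (v (k + 2)) (v (n + 2 + 2)) :=
          Finset.sum_nonneg fun k hk => hfar _ _ (by have := Finset.mem_range.1 hk; omega)
        linarith
    linarith

variable [FiniteDimensional ℝ E]

/-- For three projections of which the outer two commute, and such that the middle one is at a small
angle to the common kernel of the outer two, the mixed terms are bounded by the diagonal ones. -/
lemma window_nonneg {P₁ P₂ P₃ : E →ₗ[ℝ] E} (s₁ : P₁.IsSymmetric) (s₂ : P₂.IsSymmetric)
    (s₃ : P₃.IsSymmetric) (i₁ : ∀ u, P₁ (P₁ u) = P₁ u) (i₂ : ∀ u, P₂ (P₂ u) = P₂ u)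
    (i₃ : ∀ u, P₃ (P₃ u) = P₃ u) (hc : ∀ u, P₁ (P₃ u) = P₃ (P₁ u))
    (h : ∀ u, P₁ u = 0 → P₃ u = 0 → 2 / 3 * ‖P₂ u‖ ^ 2
      ≤ ‖P₂ u - P₁ (P₂ u) - P₃ (P₂ u) + P₁ (P₃ (P₂ u))‖ ^ 2) (x : E) :
    0 ≤ 0.205 * ‖P₁ x‖ ^ 2 + 0.41 * ‖P₂ x‖ ^ 2 + 0.205 * ‖P₃ x‖ ^ 2 + inner ℝ (P₁ x) (P₂ x)
      + inner ℝ (P₂ x) (P₃ x) + 2 * inner ℝ (P₁ x) (P₃ x) := by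
  -- Since `P₁` and `P₃` commute, `Q` is the projection onto their common kernel, and `p = 1 - Q`
  -- the one onto the sum of their ranges.
  let Q : E →ₗ[ℝ] E := LinearMap.id - P₁ - P₃ + P₁ ∘ₗ P₃
  have hQ : ∀ u, Q u = u - P₁ u - P₃ u + P₁ (P₃ u) := fun u => rfl
  let p : E →ₗ[ℝ] E := P₁ + P₃ - P₁ ∘ₗ P₃
  have hp : ∀ u, p u = P₁ u + P₃ u - P₁ (P₃ u) := fun u => rfl
  have hsum : ∀ u, u = p u + Q u := fun u => by rw [hp, hQ]; abel
  have hpsymm : ∀ u v, inner ℝ (p u) v = inner ℝ u (p v) := by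
    intro u v
    rw [hp, hp, inner_sub_left, inner_add_left, inner_sub_right, inner_add_right, s₁, s₃, s₁, s₃, hc]
  have hQsymm : ∀ u v, inner ℝ (Q u) v = inner ℝ u (Q v) := by
    intro u v
    have e1 := congrArg (inner ℝ · v) (hsum u)
    have e2 := congrArg (inner ℝ u) (hsum v)
    simp only [inner_add_left, inner_add_right] at e1 e2
    linarith [hpsymm u v]
  have hP₁Q : ∀ u, P₁ (Q u) = 0 := fun u => by
    rw [hQ]; simp only [map_sub, map_add, i₁]; abel
  have hP₃Q : ∀ u, P₃ (Q u) = 0 := fun u => by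
    rw [hQ]; simp only [map_sub, map_add, ← hc, i₃]; abel
  have hpQ : ∀ u, p (Q u) = 0 := fun u => by rw [hp, hP₁Q, hP₃Q]; simp
  have hpp : ∀ u, p (p u) = p u := fun u => by
    conv_rhs => rw [hsum u, map_add, hpQ, add_zero]
  -- the part of `P₂ x` in the range of `P₂ Q` and the rest
  set y := P₂ x with hy
  let R : Submodule ℝ E := LinearMap.range (P₂ ∘ₗ Q)
  set yw := R.starProjection y with hyw
  obtain ⟨u, hu⟩ : yw ∈ R := Submodule.starProjection_apply_mem _ _
  replace hu : P₂ (Q u) = yw := hu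
  set yz := y - yw with hyz
  have hort : ∀ w ∈ R, inner ℝ w yz = 0 := by
    intro w hw
    exact (Submodule.sub_starProjection_mem_orthogonal (K := R) y) w hw
  have hyzR : P₂ yz = yz := by rw [hyz, map_sub, ← hu, i₂, hy, i₂]
  -- The component of `y` orthogonal to the range of `P₂ Q` lies in the range of `P₂` and is killed
  -- by `Q`, hence it is fixed by `p`.
  have hQyz : Q yz = 0 := by
    rw [← inner_self_eq_zero (𝕜 := ℝ), hQsymm, ← hyzR, s₂, hyzR, real_inner_comm]
    exact hort _ ⟨Q yz, rfl⟩
  have hpyz : p yz = yz := by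
    conv_rhs => rw [hsum yz, hQyz, add_zero]
  set b := p yw with hb
  have hwz : inner ℝ yw yz = 0 := hort _ ⟨u, hu⟩
  -- By hypothesis `Q` keeps at least `2/3` of the square norm of `yw`, so its complement `p` keeps
  -- at most `1/3`.
  have hbb : 3 * inner ℝ b b ≤ inner ℝ yw yw := by
    have h1 := h (Q u) (hP₁Q u) (hP₃Q u)
    rw [hu, ← hQ, ← real_inner_self_eq_norm_sq, ← real_inner_self_eq_norm_sq] at h1
    have h2 : inner ℝ yw yw = inner ℝ b b + inner ℝ (Q yw) (Q yw) := by
      have h3 : inner ℝ b (Q yw) = 0 := by rw [hb, hpsymm, hpQ, inner_zero_right]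
      conv_lhs => rw [hsum yw]
      rw [← hb, inner_add_left, inner_add_right, inner_add_right, real_inner_comm b (Q yw), h3]
      ring
    linarith
  -- the remaining inner products
  set d := P₁ (P₃ x) with hd
  have hdd : inner ℝ (P₁ x) (P₃ x) = inner ℝ d d := by
    rw [s₁, ← hd, hd, s₁, i₁, s₃, ← hc, i₃]
  have hd₁ : inner ℝ (P₁ x) d = inner ℝ d d := by
    rw [← hdd, s₁, hd, i₁, ← s₁]
  have hd₃ : inner ℝ (P₃ x) d = inner ℝ d d := by
    rw [← hdd, s₃, hd, ← hc, i₃, ← s₁]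
  have hpx : p x = P₁ x + P₃ x - d := hp x
  have hdp : p d = d := by
    rw [hp, hd, ← hc, i₃, i₁]; abel
  have hvz : inner ℝ (p x) yz = inner ℝ yz yz := by
    rw [hpsymm, hpyz, ← hyzR, ← s₂, hyzR, ← hy]
    conv_lhs => rw [← sub_add_cancel y yw, ← hyz]
    rw [inner_add_left, hwz, add_zero]
  have hvw : inner ℝ (p x) yw = inner ℝ (p x) b := by
    rw [hb, ← hpsymm, hpp]
  have hdw : inner ℝ d yw = inner ℝ d b := by
    rw [hb, ← hpsymm, hdp]
  have hzb : inner ℝ yz b = 0 := by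
    rw [hb, ← hpsymm, hpyz, real_inner_comm, hwz]
  have hyy : y = yw + yz := by rw [hyz]; abel
  -- Weighted by 0.205, this square yields the products of `b` with `p x` and `d` with coefficient 1
  -- and costs `‖b‖² / 0.82`, which is less than the available `0.41 · 3 ‖b‖²`. A weight `c` in
  -- place of `0.41` needs `1/(2c) ≤ 3c`, that is, `c ≥ 1/√6 ≈ 0.408`. The next square absorbs the
  -- product of `yz` and `d`.
  have hsq : 0 ≤ inner ℝ (p x - yz + d + (100 / 41 : ℝ) • b) (p x - yz + d + (100 / 41 : ℝ) • b) :=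
    real_inner_self_nonneg
  have hsq' : 0 ≤ inner ℝ (yz + d) (yz + d) := real_inner_self_nonneg
  have hbn : 0 ≤ inner ℝ b b := real_inner_self_nonneg
  have hdn : 0 ≤ inner ℝ d d := real_inner_self_nonneg
  have hzn : 0 ≤ inner ℝ yz yz := real_inner_self_nonneg
  have e1 : ‖P₁ x‖ ^ 2 + ‖P₃ x‖ ^ 2 = inner ℝ (p x) (p x) + inner ℝ d d := by
    rw [hpx, ← real_inner_self_eq_norm_sq, ← real_inner_self_eq_norm_sq]
    simp only [inner_add_left, inner_sub_left, inner_add_right, inner_sub_right,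
      real_inner_comm (P₁ x) d, real_inner_comm (P₃ x) d, real_inner_comm (P₁ x) (P₃ x), hdd, hd₁,
      hd₃]
    ring
  have hvd : inner ℝ (p x) d = inner ℝ d d := by
    rw [hpx, inner_sub_left, inner_add_left, hd₁, hd₃]
    ring
  have e2 : inner ℝ (P₁ x) y + inner ℝ y (P₃ x) = inner ℝ (p x) b + inner ℝ d b
      + inner ℝ yz yz + inner ℝ yz d := by
    rw [real_inner_comm (P₃ x) y, ← inner_add_left]
    have : P₁ x + P₃ x = p x + d := by rw [hpx]; abel
    rw [this, hyy, inner_add_right, inner_add_left, inner_add_left, hvw, hvz, hdw,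
      real_inner_comm yz d]
    ring
  have e3 : ‖y‖ ^ 2 = inner ℝ yw yw + inner ℝ yz yz := by
    rw [← real_inner_self_eq_norm_sq, hyy, inner_add_left, inner_add_right, inner_add_right,
      real_inner_comm yw yz, hwz]
    ring
  simp only [inner_add_left, inner_sub_left, inner_add_right, inner_sub_right, inner_smul_left,
    inner_smul_right, conj_trivial, real_inner_comm (p x) b, real_inner_comm d b,
    real_inner_comm yz b, real_inner_comm (p x) d, real_inner_comm (p x) yz,
    real_inner_comm yz d, hvd, hvz, hzb] at hsq hsq'
  rw [hdd]
  linarith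

/-- A bound for the square of a sum of projections along a chain. -/
lemma inner_sum_le_norm_sq {P : ℕ → E →ₗ[ℝ] E} (hs : ∀ k, (P k).IsSymmetric)
    (hi : ∀ k u, P k (P k u) = P k u) (hc : ∀ j k, j + 2 ≤ k → ∀ u, P j (P k u) = P k (P j u))
    (hw : ∀ k u, P k u = 0 → P (k + 2) u = 0 → 2 / 3 * ‖P (k + 1) u‖ ^ 2
      ≤ ‖P (k + 1) u - P k (P (k + 1) u) - P (k + 2) (P (k + 1) u)
        + P k (P (k + 2) (P (k + 1) u))‖ ^ 2)
    (h0 : P 0 = 0) (h1 : P 1 = 0) {n : ℕ} (hn : ∀ k, n + 2 ≤ k → P k = 0) (x : E) :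
    0.18 * inner ℝ x (∑ k ∈ Finset.range n, P (k + 2) x)
      ≤ ‖∑ k ∈ Finset.range n, P (k + 2) x‖ ^ 2 := by
  have hsq : ∀ k, inner ℝ x (P k x) = ‖P k x‖ ^ 2 := fun k => by
    rw [← real_inner_self_eq_norm_sq, hs, hi]
  -- A product of commuting projections is a projection.
  have hfar : ∀ j k, j + 3 ≤ k → 0 ≤ inner ℝ (P j x) (P k x) := by
    intro j k hjk
    have : inner ℝ (P j x) (P k x) = inner ℝ (P j (P k x)) (P j (P k x)) := by
      rw [hs j, hs j, hi j, hs k, ← hc j k (by omega), hi k]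
    rw [this]
    exact real_inner_self_nonneg
  have h2 := sum_le_norm_sq_sum (v := fun k => P k x) (by simp [h0]) (by simp [h1]) hfar n
  -- Summed over all windows, including those that overhang the ends, each square norm has the
  -- weight `0.205 + 0.41 + 0.205 = 0.82`, and products of neighbours and of next neighbours both
  -- have the weight 2, as in the square of the sum. What remains of the diagonal is `1 - 0.82 =
  -- 0.18`.
  have hwin := Finset.sum_nonneg fun k (_ : k ∈ Finset.range (n + 2)) =>
    window_nonneg (hs k) (hs (k + 1)) (hs (k + 2)) (hi k) (hi (k + 1)) (hi (k + 2))
      (hc k (k + 2) le_rfl) (hw k) x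
  have shift : ∀ F : ℕ → ℝ, F 0 = 0 → F (n + 2) = 0 →
      ∑ k ∈ Finset.range (n + 2), F (k + 1) = ∑ k ∈ Finset.range (n + 2), F k := by
    intro F h h'
    have := Finset.sum_range_succ' F (n + 2)
    rw [Finset.sum_range_succ, h, h'] at this
    linarith
  have drop : ∀ F : ℕ → ℝ, F n = 0 → F (n + 1) = 0 →
      ∑ k ∈ Finset.range (n + 2), F k = ∑ k ∈ Finset.range n, F k := by
    intro F h h'
    rw [Finset.sum_range_succ, Finset.sum_range_succ, h, h']
    ring
  have z2 : P (n + 2) = 0 := hn _ le_rfl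
  have z3 : P (n + 1 + 2) = 0 := hn _ (by omega)
  have z4 : P (n + 2 + 1) = 0 := hn _ (by omega)
  have n1 := shift (fun k => ‖P k x‖ ^ 2) (by simp [h0]) (by simp [z2])
  have n2 := shift (fun k => ‖P (k + 1) x‖ ^ 2) (by simp [h1]) (by simp [z4])
  have n3 := shift (fun k => inner ℝ (P k x) (P (k + 1) x)) (by simp [h0]) (by simp [z2])
  have n4 := drop (fun k => ‖P (k + 2) x‖ ^ 2) (by simp [z2]) (by simp [z3])
  have n5 := drop (fun k => inner ℝ (P (k + 1) x) (P (k + 2) x)) (by simp [z2]) (by simp [z3])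
  have n6 := drop (fun k => inner ℝ (P k x) (P (k + 2) x)) (by simp [z2]) (by simp [z3])
  simp only [Finset.sum_add_distrib, ← Finset.mul_sum] at hwin h2
  rw [inner_sum]
  simp only [hsq]
  linarith

end Window

end AKLT

end

/-! ### From an operator inequality to a spectral gap. -/

noncomputable section

namespace AKLT

open Complex

section Complex

variable {E : Type*} [NormedAddCommGroup E] [InnerProductSpace ℂ E] [FiniteDimensional ℂ E]

/-- Only real parts of inner products enter, so the space may be regarded as a real one. -/
lemma re_inner_sum_le_norm_sq {P : ℕ → E →L[ℂ] E}
    (hs : ∀ k u v, inner ℂ (P k u) v = inner ℂ u (P k v))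
    (hi : ∀ k u, P k (P k u) = P k u) (hc : ∀ j k, j + 2 ≤ k → ∀ u, P j (P k u) = P k (P j u))
    (hw : ∀ k u, P k u = 0 → P (k + 2) u = 0 → 2 / 3 * ‖P (k + 1) u‖ ^ 2
      ≤ ‖P (k + 1) u - P k (P (k + 1) u) - P (k + 2) (P (k + 1) u)
        + P k (P (k + 2) (P (k + 1) u))‖ ^ 2)
    (h0 : P 0 = 0) (h1 : P 1 = 0) {n : ℕ} (hn : ∀ k, n + 2 ≤ k → P k = 0) (x : E) :
    0.18 * (inner ℂ x (∑ k ∈ Finset.range n, P (k + 2) x)).re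
      ≤ ‖∑ k ∈ Finset.range n, P (k + 2) x‖ ^ 2 := by
  let _ : InnerProductSpace ℝ E := InnerProductSpace.complexToReal
  let P' : ℕ → E →ₗ[ℝ] E := fun k => (P k : E →ₗ[ℂ] E).restrictScalars ℝ
  have hP : ∀ k u, P' k u = P k u := fun _ _ => rfl
  have h := inner_sum_le_norm_sq (P := P') (n := n)
    (fun k u v => congrArg Complex.re (hs k u v)) hi hc hw (LinearMap.ext fun u => by simp [hP, h0])
    (LinearMap.ext fun u => by simp [hP, h1])
    (fun k hk => LinearMap.ext fun u => by simp [hP, hn k hk]) x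
  exact h

/-- A symmetric operator `T` with `T² ≥ g T ≥ 0` has no eigenvalues between `0` and `g`. -/
lemma norm_sq_sub_starProjection_le {T : E →L[ℂ] E}
    (hs : ∀ u v, inner ℂ (T u) v = inner ℂ u (T v)) {g : ℝ} (h0 : ∀ u, 0 ≤ (inner ℂ u (T u)).re)
    (hg : ∀ u, g * (inner ℂ u (T u)).re ≤ ‖T u‖ ^ 2) (u : E) :
    g * ‖u - (LinearMap.ker (T : E →ₗ[ℂ] E)).starProjection u‖ ^ 2 ≤ (inner ℂ u (T u)).re := by
  have hsym : (T : E →ₗ[ℂ] E).IsSymmetric := hs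
  set S := LinearMap.ker (T : E →ₗ[ℂ] E) with hS
  let b := hsym.eigenvectorBasis rfl
  let t := hsym.eigenvalues rfl
  have hb : ∀ i, T (b i) = (t i : ℂ) • b i := fun i => hsym.apply_eigenvectorBasis rfl i
  have hbn : ∀ i, ‖b i‖ = 1 := b.orthonormal.1
  have hre : ∀ i, (inner ℂ (b i) (T (b i))).re = t i := fun i => by
    rw [hb, inner_smul_right, Complex.re_ofReal_mul, inner_self_eq_norm_sq_to_K, hbn]
    simp
  have e : inner ℂ u (T u) = ∑ i, (t i : ℂ) * (‖inner ℂ (b i) u‖ ^ 2 : ℝ) := by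
    rw [← b.sum_inner_mul_inner]
    refine Finset.sum_congr rfl fun i _ => ?_
    rw [← hs (b i) u, hb, inner_smul_left, Complex.conj_ofReal, mul_left_comm,
      ← inner_conj_symm u (b i), Complex.conj_mul', Complex.ofReal_pow]
  rw [e, Complex.re_sum, ← b.sum_sq_norm_inner_right, Finset.mul_sum]
  refine Finset.sum_le_sum fun i _ => ?_
  rw [Complex.re_ofReal_mul, Complex.ofReal_re]
  have ht0 : 0 ≤ t i := hre i ▸ h0 (b i)
  have htg := hg (b i)
  rw [hre, hb, norm_smul, hbn, Complex.norm_real, mul_one, Real.norm_eq_abs, sq_abs] at htg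
  rcases ht0.eq_or_lt with h | h
  · have hmem : b i ∈ S := by
      rw [hS, LinearMap.mem_ker, ContinuousLinearMap.coe_coe, hb, ← h]
      simp
    have : inner ℂ (b i) (u - S.starProjection u) = 0 :=
      Submodule.sub_starProjection_mem_orthogonal (K := S) u _ hmem
    rw [this, ← h]
    simp
  · have h1 : inner ℂ (b i) (S.starProjection u) = 0 := by
      have h2 : T (S.starProjection u) = 0 := by
        have : S.starProjection u ∈ S := Submodule.starProjection_apply_mem _ _
        exact this
      have h3 := hs (b i) (S.starProjection u)
      rw [h2, inner_zero_right, hb, inner_smul_left, mul_eq_zero] at h3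
      refine h3.resolve_left ?_
      rw [Complex.conj_ofReal]
      exact_mod_cast h.ne'
    rw [inner_sub_right, h1, sub_zero]
    have : g ≤ t i := by nlinarith
    exact mul_le_mul_of_nonneg_right this (by positivity)

end Complex

/-! ### The gap of the chain. -/

section Gap

lemma ham_inner {L a b : ℕ} (ψ χ : Chain L) :
    inner ℂ (ham L a b ψ) χ = inner ℂ ψ (ham L a b χ) := by
  rw [ham_apply, ham_apply, sum_inner, inner_sum]
  exact Finset.sum_congr rfl fun p _ => bond_inner _ _ _ _

lemma re_inner_ham_nonneg {L a b : ℕ} (ψ : Chain L) : 0 ≤ (inner ℂ ψ (ham L a b ψ)).re := by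
  rw [ham_apply, inner_sum, Complex.re_sum]
  refine Finset.sum_nonneg fun p _ => ?_
  rw [inner_bond_self, Complex.ofReal_re]
  positivity

/-- The operator inequality in the definition of the gap, in terms of quadratic forms. -/
lemma smul_le_ham_iff {L a b : ℕ} {g : ℝ} :
    (g : ℂ) • (1 - groundProj L a b) ≤ ham L a b ↔
      ∀ ψ, g * ‖ψ - groundProj L a b ψ‖ ^ 2 ≤ (inner ℂ ψ (ham L a b ψ)).re := by
  have key : ∀ ψ : Chain L, inner ℂ ψ (ψ - groundProj L a b ψ)
      = ((‖ψ - groundProj L a b ψ‖ ^ 2 : ℝ) : ℂ) := by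
    intro ψ
    have h : inner ℂ (groundProj L a b ψ) (ψ - groundProj L a b ψ) = 0 :=
      Submodule.sub_starProjection_mem_orthogonal (K := groundSpace L a b) ψ _
        (Submodule.starProjection_apply_mem _ _)
    have h' := inner_self_eq_norm_sq_to_K (𝕜 := ℂ) (ψ - groundProj L a b ψ)
    rw [inner_sub_left, h, sub_zero] at h'
    rw [h']
    simp
  have hform : ∀ ψ : Chain L, (inner ℂ ψ ((ham L a b - (g : ℂ) • (1 - groundProj L a b)) ψ)).re
      = (inner ℂ ψ (ham L a b ψ)).re - g * ‖ψ - groundProj L a b ψ‖ ^ 2 := by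
    intro ψ
    rw [sub_apply, inner_sub_right, smul_apply, inner_smul_right, sub_apply, one_apply_eq_self, key,
      Complex.sub_re, Complex.re_ofReal_mul, Complex.ofReal_re]
  rw [ContinuousLinearMap.le_def]
  constructor
  · intro h ψ
    have := h.re_inner_nonneg_right ψ
    rw [RCLike.re_eq_complex_re, hform] at this
    linarith
  · intro h
    refine ⟨fun ψ χ => ?_, fun ψ => ?_⟩
    · simp only [ContinuousLinearMap.coe_coe, sub_apply, smul_apply, one_apply_eq_self,
        inner_sub_left, inner_sub_right, inner_smul_left, inner_smul_right, ham_inner,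
        Complex.conj_ofReal, groundProj, Submodule.inner_starProjection_left_eq_right]
    · rw [ContinuousLinearMap.reApplyInnerSelf_apply, inner_re_symm]
      change 0 ≤ (inner ℂ ψ ((ham L a b - (g : ℂ) • (1 - groundProj L a b)) ψ)).re
      rw [hform]
      linarith [h ψ]

/-- The vector with all spins up. -/
def allUp (L : ℕ) : Chain L := EuclideanSpace.single (fun _ => 0) 1

lemma bond_allUp {L : ℕ} {x y : Fin L} (hxy : x ≠ y) : bond x y (allUp L) = allUp L := by
  have hval : ∀ σ : Fin L → Fin 3, allUp L σ = if σ = fun _ => 0 then 1 else 0 := fun σ => by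
    rw [allUp, PiLp.single_apply]
  ext σ
  rw [bond_apply hxy]
  have h0 : ∀ s t, (s, t) ≠ ((0, 0) : Fin 3 × Fin 3) → allUp L (upd2 σ x y s t) = 0 := by
    intro s t hst
    rw [hval, if_neg]
    intro h
    refine hst (Prod.ext ?_ ?_)
    · simpa [upd2_left hxy] using congrFun h x
    · simpa using congrFun h y
  rw [← Fintype.sum_prod_type' (f := fun s t => (quintProj (σ x, σ y) (s, t) : ℂ) / 6
    * allUp L (upd2 σ x y s t)), Finset.sum_eq_single ((0, 0) : Fin 3 × Fin 3)
    (fun p _ hp => by rw [h0 p.1 p.2 hp, mul_zero]) (by simp)]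
  by_cases h : σ x = 0 ∧ σ y = 0
  · have h6 : quintProj (0, 0) (0, 0) = 6 := by decide
    have := upd2_self hxy σ
    rw [h.1, h.2] at this
    rw [h.1, h.2, h6, this]
    norm_num
  · have h6 : ∀ a b : Fin 3, ¬(a = 0 ∧ b = 0) → quintProj (a, b) (0, 0) = 0 := by decide
    rw [h6 _ _ h, hval σ, if_neg]
    · simp
    · rintro rfl
      exact h ⟨rfl, rfl⟩

/-- An eigenvector for a nonzero eigenvalue is orthogonal to the ground states, so it can be used as
a trial vector. -/
lemma le_of_eigenvector {L a b : ℕ} {t : ℝ} (ht : t ≠ 0) {φ : Chain L} (hφ : φ ≠ 0)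
    (h : ham L a b φ = (t : ℂ) • φ) {g : ℝ}
    (hg : (g : ℂ) • (1 - groundProj L a b) ≤ ham L a b) : g ≤ t := by
  have hort : groundProj L a b φ = 0 := by
    rw [groundProj, Submodule.starProjection_apply_eq_zero_iff]
    intro u hu
    have h1 : ham L a b u = 0 := hu
    have h2 := ham_inner (a := a) (b := b) u φ
    rw [h1, inner_zero_left, h, inner_smul_right, eq_comm, mul_eq_zero] at h2
    exact h2.resolve_left (by exact_mod_cast ht)
  have h3 := smul_le_ham_iff.1 hg φ
  rw [hort, sub_zero, h, inner_smul_right, Complex.re_ofReal_mul, inner_self_eq_norm_sq_to_K] at h3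
  have h4 : ((‖φ‖ : ℂ) ^ 2).re = ‖φ‖ ^ 2 := by rw [← Complex.ofReal_pow, Complex.ofReal_re]
  have h5 : 0 < ‖φ‖ ^ 2 := by positivity
  refine le_of_mul_le_mul_right ?_ h5
  calc g * ‖φ‖ ^ 2 ≤ _ := h3
    _ = _ := by rw [← h4]; rfl

/-- The bonds of a chain of `N` sites, numbered from `2` on, and `0` for the other numbers. -/
def chainBond (N k : ℕ) : Op N :=
  if h : 2 ≤ k ∧ k - 1 < N then bond ⟨k - 2, by omega⟩ ⟨k - 1, h.2⟩ else 0

variable {N : ℕ}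

lemma chainBond_of_lt {k : ℕ} (hk : k + 1 < N) :
    chainBond N (k + 2) = bond ⟨k, by omega⟩ ⟨k + 1, hk⟩ := dif_pos ⟨by omega, by omega⟩

lemma chainBond_of_le {k : ℕ} (hk : N ≤ k + 1) : chainBond N (k + 2) = 0 :=
  dif_neg (by omega)

lemma chainBond_zero : chainBond N 0 = 0 := dif_neg (by omega)

lemma chainBond_one : chainBond N 1 = 0 := dif_neg (by omega)

/-- Either a bond or zero. -/
lemma chainBond_cases (k : ℕ) : chainBond N k = 0 ∨ ∃ x y : Fin N, (x : ℕ) + 2 = k ∧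
    (y : ℕ) + 1 = k ∧ chainBond N k = bond x y := by
  by_cases h : 2 ≤ k ∧ k - 1 < N
  · exact Or.inr ⟨⟨k - 2, by omega⟩, ⟨k - 1, h.2⟩, Nat.sub_add_cancel h.1,
      Nat.sub_add_cancel (by omega), dif_pos h⟩
  · exact Or.inl (dif_neg h)

lemma ham_eq_sum_chainBond (ψ : Chain N) :
    ham N 0 (N - 1) ψ = ∑ k ∈ Finset.range (N - 1), chainBond N (k + 2) ψ := by
  rw [ham_apply]
  refine Finset.sum_nbij (fun p => (p.1 : ℕ)) ?_ ?_ ?_ ?_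
  · rintro ⟨x, y⟩ h
    simp only [Finset.mem_filter, Finset.mem_univ, true_and] at h
    simp only [Finset.mem_range]
    omega
  · rintro ⟨x, y⟩ h ⟨x', y'⟩ h' he
    simp only [Finset.coe_filter, Finset.mem_univ, true_and, Set.mem_ofPred_eq] at h h'
    refine Prod.ext (Fin.ext he) (Fin.ext ?_)
    simp only at he ⊢
    omega
  · intro k hk
    simp only [Finset.coe_range, Set.mem_Iio] at hk
    refine ⟨(⟨k, by omega⟩, ⟨k + 1, by omega⟩), ?_, rfl⟩
    simp
    omega
  · rintro ⟨x, y⟩ h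
    simp only [Finset.mem_filter, Finset.mem_univ, true_and] at h
    simp only
    have hx : (x : ℕ) + 1 < N := by omega
    obtain rfl : y = ⟨(x : ℕ) + 1, hx⟩ := Fin.ext h.2.1
    rw [chainBond_of_lt hx]

/-- In the bulk the window covers four sites. At an end one outer bond is absent and three sites
remain, on the right end in mirrored order, which `bond_comm` repairs. If both are absent, nothing
is to be shown. -/
lemma chainBond_window (k : ℕ) (ψ : Chain N) (h1 : chainBond N k ψ = 0)
    (h2 : chainBond N (k + 2) ψ = 0) :
    2 / 3 * ‖chainBond N (k + 1) ψ‖ ^ 2 ≤ ‖chainBond N (k + 1) ψ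
      - chainBond N k (chainBond N (k + 1) ψ) - chainBond N (k + 2) (chainBond N (k + 1) ψ)
      + chainBond N k (chainBond N (k + 2) (chainBond N (k + 1) ψ))‖ ^ 2 := by
  rcases chainBond_cases (N := N) (k + 1) with h | ⟨y, z, hy, hz, h⟩
  · simp [h]
  rw [h]
  rcases chainBond_cases (N := N) k with hk | ⟨x, y', hx, hy', hk⟩ <;>
    rcases chainBond_cases (N := N) (k + 2) with hk' | ⟨z', w, hz', hw, hk'⟩
  · rw [hk, hk']
    simp only [zero_apply, sub_zero, add_zero]
    linarith [sq_nonneg ‖bond y z ψ‖]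
  · obtain rfl : z' = z := Fin.ext (by omega)
    rw [hk'] at h2
    rw [hk, hk']
    simpa using three_site_bond (by simp [Fin.ext_iff]; omega) (by simp [Fin.ext_iff]; omega)
      (by simp [Fin.ext_iff]; omega) h2
  · obtain rfl : y' = y := Fin.ext (by omega)
    rw [hk] at h1
    rw [hk, hk', bond_comm y', bond_comm x]
    rw [bond_comm] at h1
    simpa using three_site_bond (by simp [Fin.ext_iff]; omega) (by simp [Fin.ext_iff]; omega)
      (by simp [Fin.ext_iff]; omega) h1
  · obtain rfl : y' = y := Fin.ext (by omega)
    obtain rfl : z' = z := Fin.ext (by omega)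
    rw [hk] at h1
    rw [hk'] at h2
    rw [hk, hk']
    exact four_site_bond (by simp [Fin.ext_iff]; omega) (by simp [Fin.ext_iff]; omega)
      (by simp [Fin.ext_iff]; omega) (by simp [Fin.ext_iff]; omega) (by simp [Fin.ext_iff]; omega)
      (by simp [Fin.ext_iff]; omega) h1 h2

lemma re_inner_ham_le_norm_sq (ψ : Chain N) :
    0.18 * (inner ℂ ψ (ham N 0 (N - 1) ψ)).re ≤ ‖ham N 0 (N - 1) ψ‖ ^ 2 := by
  rw [ham_eq_sum_chainBond]
  refine re_inner_sum_le_norm_sq (P := chainBond N) ?_ ?_ ?_ chainBond_window chainBond_zero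
    chainBond_one ?_ ψ
  · intro k u v
    rcases chainBond_cases (N := N) k with h | ⟨x, y, -, -, h⟩
    · simp [h]
    · rw [h, bond_inner]
  · intro k u
    rcases chainBond_cases (N := N) k with h | ⟨x, y, -, -, h⟩
    · simp [h]
    · rw [h, bond_bond]
  · intro j k hjk u
    rcases chainBond_cases (N := N) j with h | ⟨x, y, hx, hy, h⟩
    · simp [h]
    rcases chainBond_cases (N := N) k with h' | ⟨z, w, hz, hw, h'⟩
    · simp [h']
    rw [h, h']
    apply bond_bond_comm <;> simp only [ne_eq, Fin.ext_iff] <;> omega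
  · intro k hk
    obtain ⟨k, rfl⟩ := Nat.exists_eq_add_of_le' (show 2 ≤ k by omega)
    exact chainBond_of_le (by omega)

/-- The supremum of an unbounded set of reals would be 0 by convention, so lower bounds for the gap
require this. The state with all spins up has the energy `N - 1`. -/
lemma gap_set_bddAbove (hN : 2 ≤ N) :
    BddAbove {g : ℝ | (g : ℂ) • (1 - groundProj N 0 (N - 1)) ≤ ham N 0 (N - 1)} := by
  refine ⟨((N - 1 : ℕ) : ℝ), fun g hg => le_of_eigenvector (φ := allUp N) ?_ ?_ ?_ hg⟩
  · have : N - 1 ≠ 0 := by omega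
    exact_mod_cast this
  · simp [allUp]
  · rw [ham_eq_sum_chainBond, Finset.sum_congr rfl (g := fun _ => allUp N), Finset.sum_const,
      Finset.card_range, ← Nat.cast_smul_eq_nsmul ℂ]
    · simp
    · intro k hk
      rw [Finset.mem_range] at hk
      rw [chainBond_of_lt (by omega), bond_allUp (by simp [Fin.ext_iff])]

lemma le_gap (hN : 2 ≤ N) {g : ℝ}
    (hg : ∀ ψ : Chain N, g * (inner ℂ ψ (ham N 0 (N - 1) ψ)).re ≤ ‖ham N 0 (N - 1) ψ‖ ^ 2) :
    (g : ℂ) • (1 - groundProj N 0 (N - 1)) ≤ ham N 0 (N - 1) ∧ g ≤ gap N := by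
  have h : (g : ℂ) • (1 - groundProj N 0 (N - 1)) ≤ ham N 0 (N - 1) :=
    smul_le_ham_iff.2 fun ψ => norm_sq_sub_starProjection_le ham_inner re_inner_ham_nonneg hg ψ
  exact ⟨h, le_csSup (gap_set_bddAbove hN) h⟩

lemma gap_le_of_eigenvector (hN : 2 ≤ N) {t : ℝ} (ht : t ≠ 0) {φ : Chain N} (hφ : φ ≠ 0)
    (h : ham N 0 (N - 1) φ = (t : ℂ) • φ) : gap N ≤ t :=
  -- The set is nonempty, as it contains `0.18`.
  csSup_le ⟨_, (le_gap hN re_inner_ham_le_norm_sq).1⟩ fun _ hg => le_of_eigenvector ht hφ h hg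

lemma gap_two : gap 2 = 1 := by
  have h : ∀ ψ : Chain 2, ham 2 0 (2 - 1) ψ = bond 0 1 ψ := by
    intro ψ
    rw [ham_eq_sum_chainBond]
    simp [chainBond_of_lt (N := 2) (k := 0) (by norm_num)]
  refine le_antisymm (gap_le_of_eigenvector le_rfl one_ne_zero (φ := allUp 2) ?_ ?_)
    (le_gap le_rfl fun ψ => ?_).2
  · simp [allUp]
  · rw [h, bond_allUp (by simp)]
    simp
  · rw [h, inner_bond_self, Complex.ofReal_re, one_mul]

/-- The values of an excited state of three sites. -/
def excited (a b c : Fin 3) : ℤ :=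
  if (a, b, c) = (0, 0, 1) then 1 else if (a, b, c) = (0, 1, 0) then -2
    else if (a, b, c) = (1, 0, 0) then 1 else 0

/-- One spin 0 among spins up, with amplitudes `1, -2, 1`, is an eigenvector for `1/2`. This bounds
`γ_6` from above, since it is a minimum that includes `γ(3)`. -/
lemma gap_three_le : gap 3 ≤ 1 / 2 := by
  let φ : Chain 3 := WithLp.toLp 2 fun σ => (excited (σ 0) (σ 1) (σ 2) : ℂ)
  have hφ : ∀ σ, φ σ = (excited (σ 0) (σ 1) (σ 2) : ℂ) := fun _ => rfl
  refine gap_le_of_eigenvector (by norm_num) (by norm_num) (φ := φ) ?_ ?_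
  · intro h
    have := congrArg (fun ψ : Chain 3 => ψ ![1, 0, 0]) h
    simp [hφ, excited] at this
  · rw [ham_eq_sum_chainBond]
    simp only [Nat.add_one_sub_one, Finset.sum_range_succ, Finset.sum_range_zero, zero_add]
    rw [chainBond_of_lt (N := 3) (k := 0) (by norm_num), chainBond_of_lt (N := 3) (k := 1) (by norm_num)]
    ext σ
    -- The eigenvalue equation multiplied by 6, so that it concerns integers.
    have key : ∀ a b c, ∑ s, ∑ t, quintProj (a, b) (s, t) * excited s t c
        + ∑ s, ∑ t, quintProj (b, c) (s, t) * excited a s t = 3 * excited a b c := by decide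
    have := congrArg (fun z : ℤ => (z : ℂ) / 6) (key (σ 0) (σ 1) (σ 2))
    push_cast at this
    have e01 : ∀ s t, φ (upd2 σ (⟨0, by norm_num⟩ : Fin 3) ⟨0 + 1, by norm_num⟩ s t)
        = excited s t (σ 2) := fun s t => rfl
    have e12 : ∀ s t, φ (upd2 σ (⟨1, by norm_num⟩ : Fin 3) ⟨1 + 1, by norm_num⟩ s t)
        = excited (σ 0) s t := fun s t => rfl
    rw [PiLp.add_apply, bond_apply (by simp), bond_apply (by simp), PiLp.smul_apply, hφ, smul_eq_mul]
    simp only [e01, e12]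
    rw [add_div, Finset.sum_div, Finset.sum_div] at this
    simp only [Finset.sum_div, mul_div_right_comm] at this
    refine this.trans ?_
    push_cast
    ring

lemma le_infGap : 0.18 ≤ infGap := by
  have : Nonempty (Set.Ici (2 : ℕ)) := ⟨⟨2, Set.mem_Ici.2 le_rfl⟩⟩
  exact le_ciInf fun N => (le_gap N.2 re_inner_ham_le_norm_sq).2

lemma minGap_six_le : minGap 6 ≤ 1 / 2 := by
  have h : minGap 6 ≤ gap 3 := ciInf_le (f := fun n : Set.Icc (2 : ℕ) 6 => gap n)
    (Set.finite_range _).bddBelow ⟨3, Set.mem_Icc.2 (by norm_num)⟩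
  exact h.trans gap_three_le

end Gap

end AKLT

end

/-! ### The theorem. -/

open AKLT Polynomial in
theorem mainTheorem4 :
    -- the Kennedy–Tasaki unitary turns the ground states into the span of four product states
    (∀ N : ℕ, 2 ≤ N →
      kennedyTasaki N ∈ unitary (Op N) ∧
      LinearIndependent ℂ (Phi N) ∧
      (groundSpace N 0 (N - 1)).map (kennedyTasaki N : Chain N →ₗ[ℂ] Chain N)
        = Submodule.span ℂ (Set.range (Phi N))) ∧
    -- the matrix of `G(-m,0) G(0,n) G(-m,0)` (conjugated by the unitary), its eigenvalues, `ε(m,n)`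
    (∀ m n : ℕ, 1 ≤ m → 1 ≤ n →
      (∀ ij, (kennedyTasaki (m + n + 1) * K m n * star (kennedyTasaki (m + n + 1))) (Theta m n ij)
        = ∑ rk, A m n ij rk • Theta m n rk) ∧
      LinearMap.range ((kennedyTasaki (m + n + 1) * K m n * star (kennedyTasaki (m + n + 1)) :
          Op (m + n + 1)) : Chain (m + n + 1) →ₗ[ℂ] Chain (m + n + 1))
        ≤ Submodule.span ℂ (Set.range (Theta m n)) ∧
      (2 ≤ n → LinearIndependent ℂ (Theta m n)) ∧
      0 ≤ lamR m n ∧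
      (A m n).charpoly = (X - C 1) ^ 4 * (X - C (lam5 m n : ℂ)) ^ 5 * (X - C (lam1 m n : ℂ))
        * (X - C (lam3plus m n : ℂ)) ^ 3 * (X - C (lam3minus m n : ℂ)) ^ 3 ∧
      max (lam5 m n) (max (lam1 m n) (lam3plus m n)) < 1 ∧
      eps m n = max (lam5 m n) (max (lam1 m n) (lam3plus m n))) ∧
    -- the uniform gap bound
    (eps 1 1 = lam5 1 1 ∧ lam5 1 1 = 1 / 4 ∧ epsSup 1 1 = 1 / 4 ∧ gap 2 = 1 ∧
      1 - Real.sqrt 3 / 2 ≤ infGap) ∧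
    -- the refinement
    (eps 3 3 = lam5 3 3 ∧ lam5 3 3 = (7 / 20) ^ 2 ∧ epsSup 3 3 = (7 / 20) ^ 2 ∧
      minGap 6 * (1 - 2 * Real.sqrt (epsSup 3 3 * (1 - epsSup 3 3))) ≤ infGap ∧
      0.137194 ≤ infGap) := by
  refine ⟨fun N hN => ⟨kennedyTasaki_mem_unitary N, linearIndependent_Phi hN, stringSpace_full hN⟩,
    fun m n hm hn => ⟨kennedyTasaki_K_Theta hm hn, range_kennedyTasaki_K_le hm hn,
      linearIndependent_Theta hm, lamR_nonneg hm hn, charpoly_A hm hn, lam_lt_one hm hn,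
      eps_eq hm hn⟩,
    ⟨eps_one_one.trans lam5_one_one.symm, lam5_one_one, epsSup_one_one, gap_two, ?_⟩,
    ⟨eps_three_three.trans lam5_three_three.symm, lam5_three_three, epsSup_three_three, ?_, ?_⟩⟩
  -- `1 - 1.64 / 2 = 0.18`.
  · have h : (1.64 : ℝ) ≤ Real.sqrt 3 := Real.le_sqrt_of_sq_le (by norm_num)
    linarith [le_infGap]
  -- With `γ_6 ≤ 1/2` the left side is at most `(1 - 2 · 0.32) / 2 = 0.18`. The upper bound `0.5`
  -- for the root keeps the factor of `γ_6` nonnegative.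
  · have h1 : (0.32 : ℝ) ≤ Real.sqrt (epsSup 3 3 * (1 - epsSup 3 3)) := by
      rw [epsSup_three_three]
      exact Real.le_sqrt_of_sq_le (by norm_num)
    have h2 : Real.sqrt (epsSup 3 3 * (1 - epsSup 3 3)) ≤ 0.5 := by
      rw [epsSup_three_three]
      exact Real.sqrt_le_iff.2 (by norm_num)
    nlinarith [le_infGap, minGap_six_le]
  · linarith [le_infGap]
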